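/- Let $a,b$ be real numbers with $a+b>2$ and $(a-b)^2<2(a+b)$ (these force $a,b>0$), and let $p\in[0,1]$. For $n\ge\max(a,b)$, consider the labeled stochastic block model with two clusters on the vertex set $[n]$: each vertex $u$ gets an independent uniform label $\sigma_u\in\{1,2\}$; given the labels, each pair of distinct vertices $u,w$ is joined by an edge of the random graph $G$, independently for each pair, with probability $a/n$ if $\sigma_u=\sigma_w$ and with probability $b/n$ otherwise; and, independently of $(G,\sigma)$, each vertex is placed in the revealed set $R$ independently with probability $p$. Write $\sigma_R$ for the restriction of $\sigma$ to $R$. Then, for any choice of a vertex $v=v_n\in[n]$ for each $n$, the limit below exists and satisfies $$\lim_{n\to\infty}\mathbb{E}\left|\Pr[\sigma_v=1\mid G,R,\sigma_R]-\frac12\right|\;\le\;\frac12\sqrt{\frac{p}{1-\frac{(a-b)^2}{2(a+b)}}}.$$ -/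

import Mathlib

open Filter Topology MeasureTheory ProbabilityTheory

namespace LabeledSBM

/-- An outcome of the labeled block model on the vertex set `Fin n` with `k` clusters: the graph
`G`, the cluster labels `σ`, and the set `R` of vertices whose label is revealed. -/
@[ext]
structure Outcome (n k : ℕ) where
  graph : SimpleGraph (Fin n)
  label : Fin n → Fin k
  revealed : Finset (Fin n)

/-- An outcome is just a triple `(G, σ, R)`. -/
def outcomeEquiv (n k : ℕ) :
    Outcome n k ≃ SimpleGraph (Fin n) × (Fin n → Fin k) × Finset (Fin n) where
  toFun ω := (ω.graph, ω.label, ω.revealed)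
  invFun t := ⟨t.1, t.2.1, t.2.2⟩
  left_inv _ := rfl
  right_inv _ := rfl

/-- There are finitely many outcomes. -/
noncomputable instance (n k : ℕ) : Fintype (Outcome n k) :=
  open Classical in Fintype.ofEquiv _ (outcomeEquiv n k).symm

/-- The sample space is finite, and every subset of it is an event. -/
instance (n k : ℕ) : MeasurableSpace (Outcome n k) := ⊤

instance (n k : ℕ) : DiscreteMeasurableSpace (Outcome n k) := ⟨fun _ => trivial⟩

/-- The probability of an edge between vertices with labels `i` and `j` in a graph on `n`
vertices: `a / n` if the labels agree and `b / n` if they do not. -/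
noncomputable def edgeProb (n : ℕ) {k : ℕ} (a b : ℝ) (i j : Fin k) : ℝ :=
  if i = j then a / n else b / n

open Classical in
/-- The conditional probability of the graph `G` given the labels `σ`: every pair of distinct
vertices is an edge with probability `edgeProb`, independently. -/
noncomputable def graphMass {n k : ℕ} (a b : ℝ) (σ : Fin n → Fin k) (G : SimpleGraph (Fin n)) :
    ℝ :=
  ∏ e : Fin n × Fin n with e.1 < e.2,
    if G.Adj e.1 e.2 then edgeProb n a b (σ e.1) (σ e.2) else 1 - edgeProb n a b (σ e.1) (σ e.2)

/-- The probability of the revealed set `R`: every vertex is revealed with probability `p`,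
independently. -/
noncomputable def revealMass {n : ℕ} (p : ℝ) (R : Finset (Fin n)) : ℝ :=
  ∏ u : Fin n, if u ∈ R then p else 1 - p

/-- The probability of the outcome `(G, σ, R)` in the labeled block model with parameters
`n, k, a, b, p`: labels are independent and uniform on `Fin k`, and `R` is independent of
`(G, σ)`. -/
noncomputable def mass {n k : ℕ} (a b p : ℝ) (ω : Outcome n k) : ℝ :=
  (∏ _u : Fin n, 1 / (k : ℝ)) * graphMass a b ω.label ω.graph * revealMass p ω.revealed

/-- The law of `(G, σ, R)` in the labeled block model with parameters `n, k, a, b, p`. It is a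
probability measure as soon as `a / n`, `b / n` and `p` lie in `[0, 1]` and `0 < k`
(see `isProbabilityMeasure_law`). -/
noncomputable def law (n k : ℕ) (a b p : ℝ) : Measure (Outcome n k) :=
  ∑ ω : Outcome n k, ENNReal.ofReal (mass a b p ω) • Measure.dirac ω

/-- The event that the observed data `(G, R, σ_R)` (the graph, the revealed set, and the labels
of the revealed vertices) are the same as in the outcome `ω`. -/
def sameObservation {n k : ℕ} (ω : Outcome n k) : Set (Outcome n k) :=
  {ω' | ω'.graph = ω.graph ∧ ω'.revealed = ω.revealed ∧
    ∀ u ∈ ω.revealed, ω'.label u = ω.label u}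

/-- The random variable `Pr[σ_v = i | G, R, σ_R]`, evaluated at the outcome `ω`. -/
noncomputable def posterior {n k : ℕ} (a b p : ℝ) (v : Fin n) (i : Fin k) (ω : Outcome n k) : ℝ :=
  ((law n k a b p)[|sameObservation ω]).real {ω' | ω'.label v = i}

/-- The quantity `E |Pr[σ_v = i | G, R, σ_R] - 1 / k|`. -/
noncomputable def expectedAdvantage (n k : ℕ) (a b p : ℝ) (v : Fin n) (i : Fin k) : ℝ :=
  ∫ ω, |posterior a b p v i ω - 1 / (k : ℝ)| ∂(law n k a b p)

theorem sum_graphMass {n k : ℕ} (a b : ℝ) (σ : Fin n → Fin k) :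
    ∑ G : SimpleGraph (Fin n), graphMass a b σ G = 1 := by
  classical
  set f : Fin n × Fin n → ℝ := fun e => edgeProb n a b (σ e.1) (σ e.2) with hf
  set P : Finset (Fin n × Fin n) := Finset.univ.filter fun e => e.1 < e.2 with hP
  have h1 : ∏ e ∈ P, (f e + (1 - f e)) = 1 := by simp
  rw [Finset.prod_add] at h1
  rw [← h1]
  refine Finset.sum_bij' (fun G _ => P.filter fun e => G.Adj e.1 e.2)
    (fun S _ => SimpleGraph.fromRel fun u v => u < v ∧ (u, v) ∈ S) ?_ ?_ ?_ ?_ ?_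
  · intro G _
    simp
  · intro S _
    simp
  · intro G _
    ext u v
    simp only [SimpleGraph.fromRel_adj, Finset.mem_filter, hP, Finset.mem_univ, true_and]
    constructor
    · rintro ⟨_, h | h⟩
      · exact h.2.2
      · exact h.2.2.symm
    · intro h
      refine ⟨h.ne, ?_⟩
      rcases lt_or_gt_of_ne h.ne with h' | h'
      · exact Or.inl ⟨h', h', h⟩
      · exact Or.inr ⟨h', h', h.symm⟩
  · intro S hS
    rw [Finset.mem_powerset] at hS
    ext ⟨u, v⟩
    simp only [SimpleGraph.fromRel_adj, Finset.mem_filter, hP, Finset.mem_univ, true_and]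
    constructor
    · rintro ⟨h, _, h' | h'⟩
      · exact h'.2
      · exact absurd h'.1 (not_lt_of_gt h)
    · intro h
      have h' : u < v := by simpa [hP] using hS h
      exact ⟨h', h'.ne, Or.inl ⟨h', h⟩⟩
  · intro G _
    rw [graphMass, Finset.prod_ite, ← hP, Finset.filter_not]

theorem sum_revealMass {n : ℕ} (p : ℝ) : ∑ R : Finset (Fin n), revealMass p R = 1 := by
  classical
  have h1 : ∏ _u : Fin n, (p + (1 - p)) = 1 := by simp
  rw [Finset.prod_add] at h1
  rw [← h1, Finset.powerset_univ]
  refine Finset.sum_congr rfl fun R _ => ?_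
  rw [revealMass, Finset.prod_ite, Finset.filter_not]
  simp

theorem mass_nonneg {n k : ℕ} {a b p : ℝ} (ha : 0 ≤ a) (han : a ≤ n) (hb : 0 ≤ b) (hbn : b ≤ n)
    (hp : 0 ≤ p) (hp' : p ≤ 1) (ω : Outcome n k) : 0 ≤ mass a b p ω := by
  have hn : (0 : ℝ) ≤ n := n.cast_nonneg
  have h1 := div_le_one_of_le₀ han hn
  have h2 := div_le_one_of_le₀ hbn hn
  have h3 := div_nonneg ha hn
  have h4 := div_nonneg hb hn
  refine mul_nonneg (mul_nonneg (Finset.prod_nonneg fun _ _ => by positivity)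
    (Finset.prod_nonneg fun e _ => ?_)) (Finset.prod_nonneg fun u _ => ?_)
  · unfold edgeProb
    split_ifs <;> linarith
  · split_ifs <;> linarith

theorem sum_mass {n k : ℕ} (hk : 0 < k) (a b p : ℝ) :
    ∑ ω : Outcome n k, mass a b p ω = 1 := by
  classical
  rw [← (outcomeEquiv n k).symm.sum_comp, Fintype.sum_prod_type_right]
  have hk' : (k : ℝ) ≠ 0 := by positivity
  simp only [mass, outcomeEquiv, Equiv.coe_fn_symm_mk, ← Finset.sum_mul, ← Finset.mul_sum,
    sum_graphMass, Fintype.sum_prod_type, sum_revealMass]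
  simp [hk']

/-- The law of the labeled block model is a probability measure. -/
theorem isProbabilityMeasure_law {n k : ℕ} {a b p : ℝ} (hk : 0 < k) (ha : 0 ≤ a) (han : a ≤ n)
    (hb : 0 ≤ b) (hbn : b ≤ n) (hp : 0 ≤ p) (hp' : p ≤ 1) :
    IsProbabilityMeasure (law n k a b p) := by
  refine ⟨?_⟩
  simp only [law, Measure.coe_finsetSum, Finset.sum_apply, Measure.smul_apply, smul_eq_mul,
    measure_univ, mul_one]
  rw [← ENNReal.ofReal_sum_of_nonneg fun ω _ => mass_nonneg ha han hb hbn hp hp' ω,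
    sum_mass hk, ENNReal.ofReal_one]

end LabeledSBM

/-! As the prior on the label of the vertex is uniform, the mean of |posterior - 1/2| is half the
total variation distance between the laws of the observation under the two labels
(`expectedAdvantage_eq`). Near the vertex the observation looks like a broadcasting tree with mean
offspring d = (a+b)/2 whose edges carry a binary symmetric channel of correlation (a-b)/(a+b). The
hypothesis says that l = (a-b)²/(2(a+b)), which is d times the squared correlation, is below 1: the
tree is below the Kesten–Stigum threshold.

Upper bound. For a binary experiment `1 - harm` is the second moment of the posterior bias, and it
dominates `tv ^ 2`. The channel contracts it by exactly the squared correlation, and `harm` is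
supermultiplicative over products in which one factor is symmetric. Hence V_r = `1 - harm` of the
depth-r tree with visible leaf labels satisfies V_{r+1} ≤ p + l V_r, so V_r ≤ p/(1-l) + l^r
(`one_sub_harm_tree_le`).

Graph and trees. At fixed depth and up to O(N^{-1/2}), the tree with visible leaves (`base = pure`)
can simulate the observation (`exploredByTrees`), and the observation can simulate the tree with
blank leaves (`base = fun _ => pure 0`, `treesRecovered`). The trees have N child slots per vertex,
each occupied with probability d/N, so that slots match vertices of the graph. The comparison
explores one vertex at a time; each exploration exchanges the order in which an edge and the label
of its far end are sampled. The affinity detects this exchange only at second order in the edge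
probability, which makes the sum over all vertices small.

Existence of the limit. Blanking the leaves loses affinity at most l^r (`bc_tree_sub_le`), hence
little `harm` and little total variation. Grouping slots in blocks shows that the tree with M slots
is almost a garbling of the tree with N ≥ M² slots (`exists_tree_coarsening`). Chaining graph,
visible tree, blank tree, finer blank tree and larger graph, the advantage at size m exceeds the one
at any much larger size by at most ε. A bounded sequence with this property converges, so no
limiting Galton–Watson tree has to be constructed. -/

/-- A probability law on a finite type, given by its mass function. -/
@[ext]
structure FiniteLaw (Ω : Type*) [Fintype Ω] where
  mass : Ω → ℝ
  nonneg : ∀ x, 0 ≤ mass x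
  sum_mass : ∑ x, mass x = 1

namespace FiniteLaw

/-! ### Finite probability laws as a monad, and expectations -/

section Monad

variable {Ω Ω' Ω'' : Type*} [Fintype Ω] [Fintype Ω'] [Fintype Ω'']

open Classical in
/-- The point mass. -/
noncomputable def pure (x : Ω) : FiniteLaw Ω where
  mass y := if y = x then 1 else 0
  nonneg y := by split_ifs <;> norm_num
  sum_mass := by simp

/-- Sampling from `μ` and then from the kernel `g`. -/
noncomputable def bind (μ : FiniteLaw Ω) (g : Ω → FiniteLaw Ω') : FiniteLaw Ω' where
  mass y := ∑ x, μ.mass x * (g x).mass y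
  nonneg y := Finset.sum_nonneg fun x _ => mul_nonneg (μ.nonneg x) ((g x).nonneg y)
  sum_mass := by
    rw [Finset.sum_comm]
    simp [← Finset.mul_sum, sum_mass]

theorem bind_mass (μ : FiniteLaw Ω) (g : Ω → FiniteLaw Ω') (y : Ω') :
    (μ.bind g).mass y = ∑ x, μ.mass x * (g x).mass y := rfl

open Classical in
theorem pure_mass (x y : Ω) : (pure x).mass y = if y = x then 1 else 0 := rfl

@[simp]
theorem pure_bind (x : Ω) (g : Ω → FiniteLaw Ω') : (pure x).bind g = g x := by
  classical
  ext y
  simp [bind_mass, pure_mass]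

@[simp]
theorem bind_pure (μ : FiniteLaw Ω) : μ.bind pure = μ := by
  classical
  ext y
  simp [bind_mass, pure_mass]

@[simp]
theorem bind_assoc (μ : FiniteLaw Ω) (g : Ω → FiniteLaw Ω') (h : Ω' → FiniteLaw Ω'') :
    (μ.bind g).bind h = μ.bind fun x => (g x).bind h := by
  ext y
  simp only [bind_mass, Finset.sum_mul, Finset.mul_sum]
  rw [Finset.sum_comm]
  simp only [mul_assoc]

theorem bind_comm (μ : FiniteLaw Ω) (ν : FiniteLaw Ω') (h : Ω → Ω' → FiniteLaw Ω'') :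
    (μ.bind fun x => ν.bind fun y => h x y) = ν.bind fun y => μ.bind fun x => h x y := by
  ext y
  simp only [bind_mass, Finset.mul_sum]
  rw [Finset.sum_comm]
  refine Finset.sum_congr rfl fun _ _ => Finset.sum_congr rfl fun _ _ => by ring

@[simp]
theorem bind_const (μ : FiniteLaw Ω) (ν : FiniteLaw Ω') : (μ.bind fun _ => ν) = ν := by
  ext y
  simp [bind_mass, ← Finset.sum_mul, sum_mass]

/-- The Bernoulli law. -/
noncomputable def bern (q : unitInterval) : FiniteLaw Bool where
  mass e := if e then q else 1 - q
  nonneg e := by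
    have := q.2.1
    have := q.2.2
    split_ifs <;> linarith
  sum_mass := by simp

@[simp]
theorem bern_true (q : unitInterval) : (bern q).mass true = q := rfl

@[simp]
theorem bern_false (q : unitInterval) : (bern q).mass false = 1 - q := rfl

theorem bern_zero : bern 0 = pure false := by
  ext e
  cases e <;> simp [pure_mass]

theorem bern_bind_mass (q : unitInterval) (g : Bool → FiniteLaw Ω) (x : Ω) :
    ((bern q).bind g).mass x = q * (g true).mass x + (1 - q) * (g false).mass x := by
  simp [bind_mass]

/-- The expectation of `f` under the law. -/
noncomputable def expect (μ : FiniteLaw Ω) (f : Ω → ℝ) : ℝ := ∑ x, μ.mass x * f x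

theorem expect_mono (μ : FiniteLaw Ω) {f g : Ω → ℝ} (h : ∀ x, f x ≤ g x) :
    μ.expect f ≤ μ.expect g :=
  Finset.sum_le_sum fun x _ => mul_le_mul_of_nonneg_left (h x) (μ.nonneg x)

theorem expect_const (μ : FiniteLaw Ω) (c : ℝ) : (μ.expect fun _ => c) = c := by
  simp [expect, ← Finset.sum_mul, sum_mass]

theorem expect_mul_left (μ : FiniteLaw Ω) (c : ℝ) (f : Ω → ℝ) :
    (μ.expect fun x => c * f x) = c * μ.expect f := by
  simp only [expect, Finset.mul_sum]
  exact Finset.sum_congr rfl fun _ _ => by ring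

theorem expect_bind (μ : FiniteLaw Ω) (g : Ω → FiniteLaw Ω') (f : Ω' → ℝ) :
    (μ.bind g).expect f = μ.expect fun x => (g x).expect f := by
  simp only [expect, bind_mass, Finset.sum_mul, Finset.mul_sum]
  rw [Finset.sum_comm]
  simp only [mul_assoc]

theorem expect_pure (x : Ω) (f : Ω → ℝ) : (pure x).expect f = f x := by
  classical
  simp [expect, pure_mass]

end Monad

/-! ### Total variation and Bhattacharyya affinity -/

section Distance

variable {Ω Ω' : Type*} [Fintype Ω] [Fintype Ω']

/-- The total variation distance. -/
noncomputable def tv (μ ν : FiniteLaw Ω) : ℝ := 1 / 2 * ∑ x, |μ.mass x - ν.mass x|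

theorem tv_nonneg (μ ν : FiniteLaw Ω) : 0 ≤ tv μ ν := by
  unfold tv
  positivity

theorem tv_self (μ : FiniteLaw Ω) : tv μ μ = 0 := by simp [tv]

theorem tv_comm (μ ν : FiniteLaw Ω) : tv μ ν = tv ν μ := by
  simp only [tv, abs_sub_comm]

theorem tv_triangle (μ ν ξ : FiniteLaw Ω) : tv μ ξ ≤ tv μ ν + tv ν ξ := by
  unfold tv
  rw [← mul_add, ← Finset.sum_add_distrib]
  refine mul_le_mul_of_nonneg_left (Finset.sum_le_sum fun x _ => ?_) (by norm_num)
  exact abs_sub_le _ _ _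

theorem tv_le_one (μ ν : FiniteLaw Ω) : tv μ ν ≤ 1 := by
  have h : ∑ x, |μ.mass x - ν.mass x| ≤ ∑ x, (μ.mass x + ν.mass x) := by
    refine Finset.sum_le_sum fun x _ => ?_
    rw [abs_le]
    constructor <;> linarith [μ.nonneg x, ν.nonneg x]
  rw [Finset.sum_add_distrib, μ.sum_mass, ν.sum_mass] at h
  unfold tv
  linarith

/-- Data processing. -/
theorem tv_bind_left (μ ν : FiniteLaw Ω) (g : Ω → FiniteLaw Ω') :
    tv (μ.bind g) (ν.bind g) ≤ tv μ ν := by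
  unfold tv
  refine mul_le_mul_of_nonneg_left ?_ (by norm_num)
  calc ∑ y, |(μ.bind g).mass y - (ν.bind g).mass y|
      ≤ ∑ y, ∑ x, |μ.mass x - ν.mass x| * (g x).mass y := by
        refine Finset.sum_le_sum fun y _ => ?_
        rw [bind_mass, bind_mass, ← Finset.sum_sub_distrib]
        refine (Finset.abs_sum_le_sum_abs _ _).trans (Finset.sum_le_sum fun x _ => ?_)
        rw [← sub_mul, abs_mul, abs_of_nonneg ((g x).nonneg y)]
    _ = ∑ x, |μ.mass x - ν.mass x| := by
        rw [Finset.sum_comm]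
        simp [← Finset.mul_sum, sum_mass]

theorem tv_bind_right (μ : FiniteLaw Ω) (g h : Ω → FiniteLaw Ω') :
    tv (μ.bind g) (μ.bind h) ≤ μ.expect fun x => tv (g x) (h x) := by
  calc tv (μ.bind g) (μ.bind h)
      ≤ 1 / 2 * ∑ y, ∑ x, μ.mass x * |(g x).mass y - (h x).mass y| := by
        refine mul_le_mul_of_nonneg_left (Finset.sum_le_sum fun y _ => ?_) (by norm_num)
        rw [bind_mass, bind_mass, ← Finset.sum_sub_distrib]
        refine (Finset.abs_sum_le_sum_abs _ _).trans (Finset.sum_le_sum fun x _ => ?_)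
        rw [← mul_sub, abs_mul, abs_of_nonneg (μ.nonneg x)]
    _ = μ.expect fun x => tv (g x) (h x) := by
        rw [Finset.sum_comm, Finset.mul_sum]
        refine Finset.sum_congr rfl fun x _ => ?_
        rw [← Finset.mul_sum]
        simp only [tv]
        ring

theorem tv_bind_right_le (μ : FiniteLaw Ω) (g h : Ω → FiniteLaw Ω') {c : ℝ}
    (hc : ∀ x, tv (g x) (h x) ≤ c) : tv (μ.bind g) (μ.bind h) ≤ c :=
  (tv_bind_right μ g h).trans ((expect_mono μ hc).trans_eq (expect_const μ c))

/-- The Bhattacharyya coefficient. -/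
noncomputable def bc (μ ν : FiniteLaw Ω) : ℝ := ∑ x, √(μ.mass x * ν.mass x)

theorem bc_nonneg (μ ν : FiniteLaw Ω) : 0 ≤ bc μ ν :=
  Finset.sum_nonneg fun _ _ => Real.sqrt_nonneg _

theorem bc_self (μ : FiniteLaw Ω) : bc μ μ = 1 := by
  simp only [bc, Real.sqrt_mul_self (μ.nonneg _), μ.sum_mass]

theorem sum_sq_sqrt_sub (μ ν : FiniteLaw Ω) :
    ∑ x, (√(μ.mass x) - √(ν.mass x)) ^ 2 = 2 - 2 * bc μ ν := by
  have h : ∀ x, (√(μ.mass x) - √(ν.mass x)) ^ 2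
      = μ.mass x + ν.mass x - 2 * √(μ.mass x * ν.mass x) := by
    intro x
    rw [Real.sqrt_mul (μ.nonneg x), sub_sq, Real.sq_sqrt (μ.nonneg x), Real.sq_sqrt (ν.nonneg x)]
    ring
  simp only [h, Finset.sum_sub_distrib, Finset.sum_add_distrib, μ.sum_mass, ν.sum_mass,
    ← Finset.mul_sum, bc]
  ring

theorem sum_sq_sqrt_add (μ ν : FiniteLaw Ω) :
    ∑ x, (√(μ.mass x) + √(ν.mass x)) ^ 2 = 2 + 2 * bc μ ν := by
  have h : ∀ x, (√(μ.mass x) + √(ν.mass x)) ^ 2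
      = μ.mass x + ν.mass x + 2 * √(μ.mass x * ν.mass x) := by
    intro x
    rw [Real.sqrt_mul (μ.nonneg x), add_sq, Real.sq_sqrt (μ.nonneg x), Real.sq_sqrt (ν.nonneg x)]
    ring
  simp only [h, Finset.sum_add_distrib, μ.sum_mass, ν.sum_mass, ← Finset.mul_sum, bc]
  ring

theorem bc_le_one (μ ν : FiniteLaw Ω) : bc μ ν ≤ 1 := by
  have h := sum_sq_sqrt_sub μ ν
  have : 0 ≤ ∑ x, (√(μ.mass x) - √(ν.mass x)) ^ 2 := by positivity
  linarith

/-- Factor |μ - ν| = |√μ - √ν| (√μ + √ν) and apply Cauchy–Schwarz: `tv ^ 2 ≤ (1 - bc) * (1 + bc)`.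
-/
theorem tv_le_sqrt_bc (μ ν : FiniteLaw Ω) : tv μ ν ≤ √(2 * (1 - bc μ ν)) := by
  have h0 : tv μ ν = 1 / 2 * ∑ x, |√(μ.mass x) - √(ν.mass x)| * (√(μ.mass x) + √(ν.mass x)) := by
    unfold tv
    congr 1
    refine Finset.sum_congr rfl fun x _ => ?_
    have h1 : 0 ≤ √(μ.mass x) + √(ν.mass x) := by positivity
    conv_rhs => rw [← abs_of_nonneg h1, ← abs_mul]
    congr 1
    nlinarith [Real.sq_sqrt (μ.nonneg x), Real.sq_sqrt (ν.nonneg x)]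
  refine Real.le_sqrt_of_sq_le ?_
  rw [h0, mul_pow]
  have h1 := Finset.sum_mul_sq_le_sq_mul_sq Finset.univ
    (fun x => |√(μ.mass x) - √(ν.mass x)|) (fun x => √(μ.mass x) + √(ν.mass x))
  simp only [sq_abs, sum_sq_sqrt_sub, sum_sq_sqrt_add] at h1
  nlinarith [bc_le_one μ ν, bc_nonneg μ ν]

end Distance

/-! ### Product laws -/

section Product

variable {ι : Type*} [Fintype ι] [DecidableEq ι] {Ω Ω' : ι → Type*} [∀ i, Fintype (Ω i)]
  [∀ i, Fintype (Ω' i)]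

theorem sum_prod_pi (f : ∀ i, Ω i → ℝ) : ∑ x : ∀ i, Ω i, ∏ i, f i (x i) = ∏ i, ∑ y, f i y := by
  rw [Finset.prod_univ_sum, Fintype.piFinset_univ]

/-- The product law. -/
noncomputable def pi (μ : ∀ i, FiniteLaw (Ω i)) : FiniteLaw (∀ i, Ω i) where
  mass x := ∏ i, (μ i).mass (x i)
  nonneg x := Finset.prod_nonneg fun i _ => (μ i).nonneg (x i)
  sum_mass := by
    rw [sum_prod_pi]
    simp [sum_mass]

theorem pi_mass (μ : ∀ i, FiniteLaw (Ω i)) (x : ∀ i, Ω i) :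
    (pi μ).mass x = ∏ i, (μ i).mass (x i) := rfl

theorem pi_bind (μ : ∀ i, FiniteLaw (Ω i)) (g : ∀ i, Ω i → FiniteLaw (Ω' i)) :
    (pi fun i => (μ i).bind (g i)) = (pi μ).bind fun x => pi fun i => g i (x i) := by
  ext y
  simp only [pi_mass, bind_mass, ← Finset.prod_mul_distrib]
  rw [sum_prod_pi fun i x => (μ i).mass x * (g i x).mass (y i)]

@[simp]
theorem pi_pure (x : ∀ i, Ω i) : (pi fun i => pure (x i)) = pure x := by
  classical
  ext y
  simp only [pi_mass, pure_mass]
  by_cases h : y = x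
  · simp [h]
  · obtain ⟨i, hi⟩ := Function.ne_iff.1 h
    rw [if_neg h]
    exact Finset.prod_eq_zero (Finset.mem_univ i) (if_neg hi)

theorem pi_map (μ : ∀ i, FiniteLaw (Ω i)) (g : ∀ i, Ω i → Ω' i) :
    (pi fun i => (μ i).bind fun a => pure (g i a)) = (pi μ).bind fun x =>
      pure fun i => g i (x i) := by
  rw [pi_bind]
  simp only [pi_pure]

/-- A product law on part of the coordinates can be sampled separately. -/
theorem pi_ite (P : ι → Prop) [DecidablePred P] (μ ν : ∀ i, FiniteLaw (Ω i)) :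
    (pi fun i => if P i then μ i else ν i) = (pi μ).bind fun a => (pi ν).bind fun b =>
      pure fun i => if P i then a i else b i := by
  have h : ∀ i, (if P i then μ i else ν i) = (μ i).bind fun a => (ν i).bind fun b =>
      pure (if P i then a else b) := by
    intro i
    split_ifs <;> simp
  simp only [h]
  rw [pi_bind]
  simp only [pi_map]

/-- The mass of a product law is linear in each factor. -/
theorem pi_update (μ : ∀ i, FiniteLaw (Ω i)) (v : ι) (ν : FiniteLaw (Ω v)) :
    pi (Function.update μ v ν) = ν.bind fun y => pi (Function.update μ v (pure y)) := by
  classical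
  ext x
  have h : ∀ ξ : FiniteLaw (Ω v), (pi (Function.update μ v ξ)).mass x
      = ξ.mass (x v) * ∏ i ∈ Finset.univ.erase v, (μ i).mass (x i) := by
    intro ξ
    rw [pi_mass, ← Finset.mul_prod_erase _ _ (Finset.mem_univ v), Function.update_self]
    congr 1
    refine Finset.prod_congr rfl fun i hi => ?_
    rw [Function.update_of_ne (Finset.ne_of_mem_erase hi)]
  rw [h, bind_mass]
  simp only [h, pure_mass]
  simp

/-- A coordinate of a product law can be sampled separately and replaced by a default value. -/
theorem pi_bind_update {Ξ : Type*} [Fintype Ξ] (μ : ∀ i, FiniteLaw (Ω i)) (v : ι) (d : Ω v)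
    (h : Ω v → (∀ i, Ω i) → FiniteLaw Ξ) :
    ((pi μ).bind fun f => h (f v) (Function.update f v d))
      = (μ v).bind fun y => (pi (Function.update μ v (pure d))).bind (h y) := by
  have key : ∀ y, pi (Function.update μ v (pure y)) = (pi (Function.update μ v (pure d))).bind
      fun f => pure (Function.update f v y) := by
    intro y
    have : Function.update μ v (pure y) = fun i => (Function.update μ v (pure d) i).bind
        fun a => pure (Function.update (β := fun i => Ω i → Ω i) (fun _ a => a) v (fun _ => y) i a)
        := by
      funext i
      rcases eq_or_ne i v with rfl | hi
      · simp
      · simp [Function.update_of_ne hi]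
    rw [this, pi_map]
    congr 1
    funext f
    congr 1
    funext i
    rcases eq_or_ne i v with rfl | hi
    · simp
    · simp [Function.update_of_ne hi]
  conv_lhs => rw [← Function.update_eq_self v μ, pi_update]
  rw [bind_assoc]
  congr 1
  funext y
  rw [key y, bind_assoc]
  conv_rhs => rw [key d]
  simp

/-- The marginal of a product law along an injection of index sets. -/
theorem pi_comp_injective {κ : Type*} [Fintype κ] [DecidableEq κ] {g : κ → ι}
    (hg : Function.Injective g) (μ : ∀ i, FiniteLaw (Ω i)) :
    ((pi μ).bind fun y => pure fun w => y (g w)) = pi fun w => μ (g w) := by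
  classical
  ext z
  simp only [bind_mass]
  -- The indicator that `z` is the pullback of `y` factorizes over the coordinates `i`; outside the
  -- range of `g` the condition is vacuous and the factor sums to 1.
  have h1 : ∀ y : ∀ i, Ω i, (pure fun w => y (g w)).mass z
      = ∏ i, if ∀ w, ∀ h : g w = i, h ▸ z w = y i then (1 : ℝ) else 0 := by
    intro y
    rw [Fintype.prod_boole]
    have e : (z = fun w => y (g w)) ↔ ∀ i w, ∀ h : g w = i, h ▸ z w = y i := by
      refine ⟨?_, fun h => funext fun w => h _ w rfl⟩
      rintro rfl _ w rfl
      rfl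
    by_cases h : z = fun w => y (g w)
    · rw [pure_mass, if_pos h, if_pos (e.1 h)]
    · rw [pure_mass, if_neg h, if_neg (mt e.2 h)]
  simp only [h1, pi_mass, ← Finset.prod_mul_distrib]
  rw [sum_prod_pi fun i a => (μ i).mass a * if ∀ w, ∀ h : g w = i, h ▸ z w = a then (1 : ℝ) else 0]
  symm
  refine Fintype.prod_of_injective g hg _ _ ?_ ?_
  · intro i hi
    have : ∀ w, g w ≠ i := fun w hw => hi ⟨w, hw⟩
    simp [this, sum_mass]
  · intro w
    rw [Finset.sum_eq_single (z w)]
    · rw [if_pos, mul_one]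
      intro w' hw'
      obtain rfl := hg hw'
      rfl
    · intro a _ ha
      rw [if_neg, mul_zero]
      intro h
      exact ha (h w rfl).symm
    · simp

theorem pi_curry {J K Ξ : Type*} [Fintype J] [DecidableEq J] [Fintype K] [DecidableEq K]
    [Fintype Ξ] (μ : FiniteLaw Ξ) :
    ((pi fun _ : J × K => μ).bind fun h => pure fun j k => h (j, k))
      = pi fun _ : J => pi fun _ : K => μ := by
  classical
  ext z
  simp only [bind_mass, pure_mass, pi_mass]
  rw [Finset.sum_eq_single fun e : J × K => z e.1 e.2]
  · simp [Fintype.prod_prod_type]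
  · intro h _ hh
    rw [if_neg, mul_zero]
    rintro rfl
    exact hh rfl
  · simp

theorem pi_fin_succ {Ξ Ξ' : Type*} [Fintype Ξ] [Fintype Ξ'] (n : ℕ) (μ : FiniteLaw Ξ)
    (g : (Fin (n + 1) → Ξ) → FiniteLaw Ξ') :
    (pi fun _ : Fin (n + 1) => μ).bind g
      = μ.bind fun a => (pi fun _ : Fin n => μ).bind fun f => g (Fin.cons a f) := by
  ext y
  simp only [bind_mass, Finset.mul_sum]
  rw [← (Fin.consEquiv fun _ => Ξ).sum_comp, Fintype.sum_prod_type]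
  refine Finset.sum_congr rfl fun a _ => Finset.sum_congr rfl fun f _ => ?_
  simp [Fin.consEquiv, pi_mass, Fin.prod_univ_succ, mul_assoc]

theorem expect_pi_prod (μ : ∀ i, FiniteLaw (Ω i)) (f : ∀ i, Ω i → ℝ) :
    ((pi μ).expect fun x => ∏ i, f i (x i)) = ∏ i, (μ i).expect (f i) := by
  simp only [expect, pi_mass, ← Finset.prod_mul_distrib]
  rw [sum_prod_pi fun i y => (μ i).mass y * f i y]

theorem bc_pi (μ ν : ∀ i, FiniteLaw (Ω i)) : bc (pi μ) (pi ν) = ∏ i, bc (μ i) (ν i) := by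
  simp only [bc, pi_mass, ← Finset.prod_mul_distrib]
  rw [← sum_prod_pi fun i y => √((μ i).mass y * (ν i).mass y)]
  refine Finset.sum_congr rfl fun x _ => ?_
  rw [Real.sqrt_prod]
  exact fun i _ => mul_nonneg ((μ i).nonneg _) ((ν i).nonneg _)

theorem one_sub_prod_le_sum {κ : Type*} (s : Finset κ) (f : κ → ℝ) (h0 : ∀ i, 0 ≤ f i)
    (h1 : ∀ i, f i ≤ 1) : 1 - ∏ i ∈ s, f i ≤ ∑ i ∈ s, (1 - f i) := by
  classical
  induction s using Finset.induction_on with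
  | empty => simp
  | insert v s hv ih =>
    rw [Finset.sum_insert hv, Finset.prod_insert hv]
    have h2 : ∏ i ∈ s, f i ≤ 1 := Finset.prod_le_one (fun i _ => h0 i) fun i _ => h1 i
    nlinarith [h0 v, h1 v]

/-- Affinities multiply, so the defects `1 - bc` add. With n coordinates of defect O(n⁻²) this gives
O(n^{-1/2}), whereas adding total variations of order 1/n would give nothing. -/
theorem tv_pi_le_sqrt (μ ν : ∀ i, FiniteLaw (Ω i)) :
    tv (pi μ) (pi ν) ≤ √(2 * ∑ i, (1 - bc (μ i) (ν i))) := by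
  refine (tv_le_sqrt_bc _ _).trans (Real.sqrt_le_sqrt ?_)
  rw [bc_pi]
  have := one_sub_prod_le_sum Finset.univ (fun i => bc (μ i) (ν i))
    (fun i => bc_nonneg _ _) fun i => bc_le_one _ _
  linarith

/-- Hybrid argument: the factors are replaced one at a time, and two product laws that differ in one
factor are images of that factor under the same kernel. -/
theorem tv_pi_le_sum (μ ν : ∀ i, FiniteLaw (Ω i)) :
    tv (pi μ) (pi ν) ≤ ∑ i, tv (μ i) (ν i) := by
  have key : ∀ C : Finset ι, tv (pi μ) (pi fun i => if i ∈ C then ν i else μ i)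
      ≤ ∑ i ∈ C, tv (μ i) (ν i) := by
    intro C
    induction C using Finset.induction_on with
    | empty => simp [tv_self]
    | insert v C hv ih =>
      rw [Finset.sum_insert hv, add_comm]
      refine (tv_triangle _ _ _).trans (add_le_add ih ?_)
      set ξ : ∀ i, FiniteLaw (Ω i) := fun i => if i ∈ C then ν i else μ i
      have h1 : ξ = Function.update ξ v (μ v) := by
        conv_lhs => rw [← Function.update_eq_self v ξ]
        congr 1
        simp [ξ, hv]
      have h2 : (fun i => if i ∈ insert v C then ν i else μ i) = Function.update ξ v (ν v) := by
        funext i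
        rcases eq_or_ne i v with rfl | hi
        · simp
        · simp [hi, ξ]
      rw [h2]
      conv_lhs => rw [h1]
      rw [pi_update ξ v (μ v), pi_update (Function.update ξ v (μ v)) v (ν v)]
      simp only [Function.update_idem]
      exact tv_bind_left _ _ _
  simpa using key Finset.univ

end Product

/-! ### The harmonic mean of two laws and its behaviour under products -/

section Divergence

variable {Ω Ω' : Type*} [Fintype Ω] [Fintype Ω']

/-- The total harmonic mean of two laws. -/
noncomputable def harm (μ ν : FiniteLaw Ω) : ℝ :=
  ∑ x, 2 * μ.mass x * ν.mass x / (μ.mass x + ν.mass x)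

/-- The third moment that measures the asymmetry of a binary experiment. -/
noncomputable def skew (μ ν : FiniteLaw Ω) : ℝ :=
  ∑ x, 2 * μ.mass x * ν.mass x * (μ.mass x - ν.mass x) / (μ.mass x + ν.mass x) ^ 2

theorem harm_term (x y : ℝ) (hx : 0 ≤ x) (hy : 0 ≤ y) :
    2 * x * y / (x + y) = (x + y) / 2 - (x - y) ^ 2 / (2 * (x + y)) := by
  rcases eq_or_lt_of_le (add_nonneg hx hy) with h | h
  · simp [← h]
  · field_simp
    ring

theorem sum_half_add (μ ν : FiniteLaw Ω) : ∑ x, (μ.mass x + ν.mass x) / 2 = 1 := by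
  rw [← Finset.sum_div, Finset.sum_add_distrib, μ.sum_mass, ν.sum_mass]
  norm_num

/-- With uniform prior, x has probability (μ + ν)/2 and posterior bias (μ - ν)/(μ + ν), so the
right-hand side is the second moment of the bias. -/
theorem one_sub_harm (μ ν : FiniteLaw Ω) :
    1 - harm μ ν = ∑ x, (μ.mass x - ν.mass x) ^ 2 / (2 * (μ.mass x + ν.mass x)) := by
  rw [harm, ← sum_half_add μ ν, ← Finset.sum_sub_distrib]
  refine Finset.sum_congr rfl fun x _ => ?_
  rw [harm_term _ _ (μ.nonneg x) (ν.nonneg x)]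
  ring

theorem sum_sq_div_add (μ ν : FiniteLaw Ω) :
    ∑ x, (μ.mass x - ν.mass x) ^ 2 / (μ.mass x + ν.mass x) = 2 * (1 - harm μ ν) := by
  rw [one_sub_harm, Finset.mul_sum]
  refine Finset.sum_congr rfl fun x _ => ?_
  rw [← mul_div_assoc, mul_div_mul_left _ _ two_ne_zero]

theorem harm_nonneg (μ ν : FiniteLaw Ω) : 0 ≤ harm μ ν := by
  refine Finset.sum_nonneg fun x _ => ?_
  have := μ.nonneg x
  have := ν.nonneg x
  positivity

theorem harm_le_one (μ ν : FiniteLaw Ω) : harm μ ν ≤ 1 := by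
  have h : 0 ≤ 1 - harm μ ν := by
    rw [one_sub_harm]
    refine Finset.sum_nonneg fun x _ => ?_
    have := μ.nonneg x
    have := ν.nonneg x
    positivity
  linarith

/-- The total variation is the first absolute moment of the posterior bias and `1 - harm` its second
moment. -/
theorem tv_sq_le_one_sub_harm (μ ν : FiniteLaw Ω) : tv μ ν ^ 2 ≤ 1 - harm μ ν := by
  have h := Finset.sum_sq_le_sum_mul_sum_of_sq_le_mul Finset.univ
    (r := fun x => |μ.mass x - ν.mass x|)
    (f := fun x => (μ.mass x - ν.mass x) ^ 2 / (2 * (μ.mass x + ν.mass x)))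
    (g := fun x => 4 * ((μ.mass x + ν.mass x) / 2))
    (fun x _ => by
      have := μ.nonneg x
      have := ν.nonneg x
      positivity)
    (fun x _ => by
      have := μ.nonneg x
      have := ν.nonneg x
      positivity)
    (fun x _ => by
      have h1 := μ.nonneg x
      have h2 := ν.nonneg x
      rw [sq_abs]
      refine le_of_eq ?_
      rcases eq_or_lt_of_le (add_nonneg h1 h2) with h | h
      · have h3 : μ.mass x = 0 := by linarith
        have h4 : ν.mass x = 0 := by linarith
        simp [h3, h4]
      · field_simp
        ring)
  rw [← one_sub_harm, ← Finset.mul_sum, sum_half_add] at h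
  rw [tv, mul_pow]
  linarith

/-- For positive entries, put u = (x-y)/(x+y) and v = (z-w)/(z+w). After division by a common
positive factor the claim is 1 - uv ≤ 1/(1 + uv); the two terms on the left are the 1 and the uv. -/
theorem harm_mul_term (x y z w : ℝ) (hx : 0 ≤ x) (hy : 0 ≤ y) (hz : 0 ≤ z) (hw : 0 ≤ w) :
    2 * x * y / (x + y) * (2 * z * w / (z + w))
      - 2 * x * y * (x - y) / (x + y) ^ 2 * (2 * z * w * (z - w) / (z + w) ^ 2)
      ≤ 2 * (x * z) * (y * w) / (x * z + y * w) := by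
  rcases eq_or_lt_of_le (mul_nonneg (mul_nonneg hx hy) (mul_nonneg hz hw)) with h | h
  · have h1 : 0 ≤ 2 * (x * z) * (y * w) / (x * z + y * w) := by positivity
    have h2 : x * y = 0 ∨ z * w = 0 := mul_eq_zero.1 h.symm
    rcases h2 with h2 | h2
    · have e1 : 2 * x * y = 0 := by linarith
      simpa [e1] using h1
    · have e1 : 2 * z * w = 0 := by linarith
      simpa [e1] using h1
  · have hx' : 0 < x := lt_of_le_of_ne hx fun e => by simp [← e] at h
    have hy' : 0 < y := lt_of_le_of_ne hy fun e => by simp [← e] at h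
    have hz' : 0 < z := lt_of_le_of_ne hz fun e => by simp [← e] at h
    have hw' : 0 < w := lt_of_le_of_ne hw fun e => by simp [← e] at h
    have hs : 0 < x + y := by positivity
    have ht : 0 < z + w := by positivity
    have hm : 0 < x * z + y * w := by positivity
    have key : 2 * (x * z) * (y * w) / (x * z + y * w)
        - (2 * x * y / (x + y) * (2 * z * w / (z + w))
          - 2 * x * y * (x - y) / (x + y) ^ 2 * (2 * z * w * (z - w) / (z + w) ^ 2))
        = 2 * x * y * z * w * ((x - y) * (z - w)) ^ 2
          / ((x * z + y * w) * (x + y) ^ 2 * (z + w) ^ 2) := by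
      field_simp
      ring
    have : 0 ≤ 2 * x * y * z * w * ((x - y) * (z - w)) ^ 2
          / ((x * z + y * w) * (x + y) ^ 2 * (z + w) ^ 2) := by positivity
    linarith

theorem harm_mul_sub_skew_mul_le (μ ν : FiniteLaw Ω) (μ' ν' : FiniteLaw Ω') :
    harm μ ν * harm μ' ν' - skew μ ν * skew μ' ν'
      ≤ ∑ x, ∑ y, 2 * (μ.mass x * μ'.mass y) * (ν.mass x * ν'.mass y)
        / (μ.mass x * μ'.mass y + ν.mass x * ν'.mass y) := by
  simp only [harm, skew, Finset.sum_mul_sum, ← Finset.sum_sub_distrib]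
  exact Finset.sum_le_sum fun x _ => Finset.sum_le_sum fun y _ =>
    harm_mul_term _ _ _ _ (μ.nonneg x) (ν.nonneg x) (μ'.nonneg y) (ν'.nonneg y)

/-- Only the factor split off in each step has to be symmetric, so the skewness of the remaining
product never enters. -/
theorem harm_pow_le_harm_pi (μ ν : FiniteLaw Ω) (h : skew μ ν = 0) (n : ℕ) :
    harm μ ν ^ n ≤ harm (pi fun _ : Fin n => μ) (pi fun _ => ν) := by
  induction n with
  | zero => norm_num [harm, pi_mass]
  | succ n ih =>
    have h1 := harm_mul_sub_skew_mul_le μ ν (pi fun _ : Fin n => μ) (pi fun _ => ν)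
    rw [h, zero_mul, sub_zero] at h1
    rw [pow_succ']
    refine (mul_le_mul_of_nonneg_left ih (harm_nonneg _ _)).trans (h1.trans_eq ?_)
    rw [harm, ← (Fin.consEquiv fun _ => Ω).sum_comp, Fintype.sum_prod_type]
    simp [Fin.consEquiv, pi_mass, Fin.prod_univ_succ]

theorem skew_eq_zero (μ ν : FiniteLaw Ω) (e : Equiv.Perm Ω) (h : ∀ x, μ.mass (e x) = ν.mass x)
    (h' : ∀ x, ν.mass (e x) = μ.mass x) : skew μ ν = 0 := by
  have h1 : skew μ ν = - skew μ ν := by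
    rw [skew, ← Finset.sum_neg_distrib]
    refine (Equiv.sum_comp e _).symm.trans ?_
    refine Finset.sum_congr rfl fun x _ => ?_
    rw [h, h', ← neg_div, add_comm (ν.mass x)]
    congr 1
    ring
  linarith

end Divergence

/-! ### Comparing the losses of different divergences under garbling -/

section Sublinear

/-- A positively homogeneous subadditive function of two nonnegative variables. -/
structure Sublinear (Ψ : ℝ → ℝ → ℝ) : Prop where
  smul : ∀ t x y, 0 ≤ t → 0 ≤ x → 0 ≤ y → Ψ (t * x) (t * y) = t * Ψ x y
  add : ∀ x y x' y', 0 ≤ x → 0 ≤ y → 0 ≤ x' → 0 ≤ y' → Ψ (x + x') (y + y') ≤ Ψ x y + Ψ x' y'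

theorem Sublinear.sum_le {Ψ : ℝ → ℝ → ℝ} (hΨ : Sublinear Ψ) {κ : Type*} (s : Finset κ)
    (t x y : κ → ℝ) (ht : ∀ i, 0 ≤ t i) (hx : ∀ i, 0 ≤ x i) (hy : ∀ i, 0 ≤ y i) :
    Ψ (∑ i ∈ s, t i * x i) (∑ i ∈ s, t i * y i) ≤ ∑ i ∈ s, t i * Ψ (x i) (y i) := by
  classical
  induction s using Finset.induction_on with
  | empty =>
    have := hΨ.smul 0 0 0 le_rfl le_rfl le_rfl
    simp only [zero_mul] at this
    simp [this]
  | insert v s hv ih =>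
    rw [Finset.sum_insert hv, Finset.sum_insert hv, Finset.sum_insert hv,
      ← hΨ.smul _ _ _ (ht v) (hx v) (hy v)]
    refine (hΨ.add _ _ _ _ (mul_nonneg (ht v) (hx v)) (mul_nonneg (ht v) (hy v))
      (Finset.sum_nonneg fun i _ => mul_nonneg (ht i) (hx i))
      (Finset.sum_nonneg fun i _ => mul_nonneg (ht i) (hy i))).trans ?_
    linarith

/-- Data processing in its general form. Applied to a difference of two divergences it compares the
amounts that they lose under the same garbling. -/
theorem Sublinear.sum_bind_le {Ψ : ℝ → ℝ → ℝ} (hΨ : Sublinear Ψ) {Ω Ω' : Type*} [Fintype Ω]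
    [Fintype Ω'] (μ ν : FiniteLaw Ω) (g : Ω → FiniteLaw Ω') :
    ∑ y, Ψ ((μ.bind g).mass y) ((ν.bind g).mass y) ≤ ∑ x, Ψ (μ.mass x) (ν.mass x) := by
  calc _ ≤ ∑ y, ∑ x, (g x).mass y * Ψ (μ.mass x) (ν.mass x) := by
        refine Finset.sum_le_sum fun y _ => ?_
        simp only [bind_mass, mul_comm _ ((g _).mass y)]
        exact hΨ.sum_le _ _ _ _ (fun x => (g x).nonneg y) μ.nonneg ν.nonneg
    _ = _ := by
        rw [Finset.sum_comm]
        simp [← Finset.sum_mul, sum_mass]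

theorem sqrt_mul_superadditive {x y x' y' : ℝ} (hx : 0 ≤ x) (hy : 0 ≤ y) (hx' : 0 ≤ x')
    (hy' : 0 ≤ y') : √(x * y) + √(x' * y') ≤ √((x + x') * (y + y')) := by
  refine Real.le_sqrt_of_sq_le ?_
  have h1 := Real.sq_sqrt (mul_nonneg hx hy)
  have h2 := Real.sq_sqrt (mul_nonneg hx' hy')
  have h3 : √(x * y) * √(x' * y') = √(x * y') * √(x' * y) := by
    rw [← Real.sqrt_mul (by positivity), ← Real.sqrt_mul (by positivity)]
    congr 1
    ring
  have h4 := Real.sq_sqrt (mul_nonneg hx hy')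
  have h5 := Real.sq_sqrt (mul_nonneg hx' hy)
  nlinarith [sq_nonneg (√(x * y') - √(x' * y))]

/-- With m = (x+y)/2 and δ = (x-y)/2 one has √(xy) = √(m² - δ²), and noise of correlation θ turns it
into √(m² - τδ²) with τ = θ². Rationalizing twice writes the defect of additivity as a fraction
whose numerator depends on τ only through the factor τ. -/
theorem lorentz_defect {τ m δ m' δ' A A₁ A₂ : ℝ} (hA : A ^ 2 = (m + m') ^ 2 - τ * (δ + δ') ^ 2)
    (hA₁ : A₁ ^ 2 = m ^ 2 - τ * δ ^ 2) (hA₂ : A₂ ^ 2 = m' ^ 2 - τ * δ' ^ 2) :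
    (A - A₁ - A₂) * ((A + A₁ + A₂) * (m * m' - τ * (δ * δ') + A₁ * A₂))
      = 2 * τ * (m * δ' - m' * δ) ^ 2 := by
  have h1 : (A - A₁ - A₂) * (A + A₁ + A₂) = 2 * (m * m' - τ * (δ * δ') - A₁ * A₂) := by
    linear_combination hA - hA₁ - hA₂
  rw [← mul_assoc, h1]
  linear_combination (-2 * A₂ ^ 2) * hA₁ - 2 * (m ^ 2 - τ * δ ^ 2) * hA₂

theorem abs_mul_add_mul_le {a b c d m m' : ℝ} (hm : 0 ≤ m) (hm' : 0 ≤ m')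
    (h : a ^ 2 + b ^ 2 ≤ m ^ 2) (h' : c ^ 2 + d ^ 2 ≤ m' ^ 2) : |a * c| + |b * d| ≤ m * m' := by
  refine abs_le_of_sq_le_sq' ?_ (by positivity) |>.2
  rw [abs_mul, abs_mul]
  have h1 : (|a| * |c| + |b| * |d|) ^ 2 ≤ (a ^ 2 + b ^ 2) * (c ^ 2 + d ^ 2) := by
    rw [← sq_abs a, ← sq_abs b, ← sq_abs c, ← sq_abs d]
    nlinarith [sq_nonneg (|a| * |d| - |b| * |c|)]
  refine h1.trans ?_
  rw [mul_pow]
  exact mul_le_mul h h' (by positivity) (by positivity)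

/-- The comparison of the concavity defects of two Lorentzian norms. -/
theorem lorentz_defect_le {τ m δ m' δ' A A₁ A₂ g g₁ g₂ : ℝ} (hτ : 0 ≤ τ) (hτ' : τ ≤ 1)
    (hm : 0 ≤ m) (hm' : 0 ≤ m') (h0 : 0 ≤ A) (h1 : 0 ≤ A₁) (h2 : 0 ≤ A₂)
    (h4 : 0 ≤ g₁) (h5 : 0 ≤ g₂) (hgg : g₁ + g₂ ≤ g)
    (hA : A ^ 2 = (m + m') ^ 2 - τ * (δ + δ') ^ 2)
    (hA₁ : A₁ ^ 2 = m ^ 2 - τ * δ ^ 2) (hA₂ : A₂ ^ 2 = m' ^ 2 - τ * δ' ^ 2)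
    (hg : g ^ 2 = (m + m') ^ 2 - (δ + δ') ^ 2)
    (hg₁ : g₁ ^ 2 = m ^ 2 - δ ^ 2) (hg₂ : g₂ ^ 2 = m' ^ 2 - δ' ^ 2) :
    A - A₁ - A₂ ≤ τ * (g - g₁ - g₂) := by
  have hκ : 0 ≤ 1 - τ := by linarith
  have e1 := lorentz_defect hA hA₁ hA₂
  have e2 := lorentz_defect (τ := 1) (by linarith) (by linarith [hg₁]) (by linarith [hg₂])
    (A := g) (A₁ := g₁) (A₂ := g₂) (m := m) (m' := m') (δ := δ) (δ' := δ')
  have l0 : g ≤ A := abs_le_of_sq_le_sq' (by linarith [mul_nonneg hκ (sq_nonneg (δ + δ'))]) h0 |>.2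
  have l1 : g₁ ≤ A₁ := abs_le_of_sq_le_sq' (by linarith [mul_nonneg hκ (sq_nonneg δ)]) h1 |>.2
  have l2 : g₂ ≤ A₂ := abs_le_of_sq_le_sq' (by linarith [mul_nonneg hκ (sq_nonneg δ')]) h2 |>.2
  have hs := Real.sq_sqrt hκ
  have l3 := abs_mul_add_mul_le (a := g₁) (b := √(1 - τ) * δ) (c := g₂) (d := √(1 - τ) * δ') h1 h2
    (by rw [mul_pow, hs]; linarith) (by rw [mul_pow, hs]; linarith)
  -- By Cauchy–Schwarz, since A₁² = g₁² + (1-τ)δ² and A₂² = g₂² + (1-τ)δ'².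
  have l4 : g₁ * g₂ - (1 - τ) * (δ * δ') ≤ A₁ * A₂ := by
    have e3 : √(1 - τ) * δ * (√(1 - τ) * δ') = (1 - τ) * (δ * δ') := by
      linear_combination (δ * δ') * hs
    rw [e3] at l3
    linarith [le_abs_self (g₁ * g₂), neg_abs_le ((1 - τ) * (δ * δ'))]
  have hP : 0 ≤ m * m' - δ * δ' := by
    have := abs_mul_add_mul_le (a := g₁) (b := δ) (c := g₂) (d := δ') hm hm' (by linarith)
      (by linarith)
    linarith [abs_nonneg (g₁ * g₂), le_abs_self (δ * δ')]
  -- The numerators of the two defects differ by the factor τ, so it remains to compare the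
  -- denominators.
  have hD : (g + g₁ + g₂) * (m * m' - 1 * (δ * δ') + g₁ * g₂)
      ≤ (A + A₁ + A₂) * (m * m' - τ * (δ * δ') + A₁ * A₂) := by
    refine mul_le_mul (by linarith) (by linarith) ?_ (by positivity)
    have := mul_nonneg h4 h5
    linarith
  have hdg : 0 ≤ τ * (g - g₁ - g₂) := mul_nonneg hτ (by linarith)
  -- The denominators may vanish; if the claim fails, the defect on the left is positive, which
  -- forces its denominator to be positive and allows cancellation.
  by_contra hcon
  push Not at hcon
  have hpos : 0 < A - A₁ - A₂ := lt_of_le_of_lt hdg hcon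
  have hS : 0 < A + A₁ + A₂ := by linarith
  have hP' : 0 < m * m' - τ * (δ * δ') + A₁ * A₂ := by
    have e3 : (A - A₁ - A₂) * (A + A₁ + A₂) = 2 * (m * m' - τ * (δ * δ') - A₁ * A₂) := by
      linear_combination hA - hA₁ - hA₂
    have := mul_pos hpos hS
    have := mul_nonneg h1 h2
    linarith
  have hDpos := mul_pos hS hP'
  have h6 : (A - A₁ - A₂) * ((A + A₁ + A₂) * (m * m' - τ * (δ * δ') + A₁ * A₂))
      ≤ τ * (g - g₁ - g₂) * ((A + A₁ + A₂) * (m * m' - τ * (δ * δ') + A₁ * A₂)) := by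
    rw [e1]
    calc 2 * τ * (m * δ' - m' * δ) ^ 2
        = τ * (g - g₁ - g₂) * ((g + g₁ + g₂) * (m * m' - 1 * (δ * δ') + g₁ * g₂)) := by
          rw [mul_assoc τ, e2]
          ring
      _ ≤ _ := mul_le_mul_of_nonneg_left hD hdg
  exact absurd (le_of_mul_le_mul_right h6 hDpos) (not_le.2 hcon)

/-- In the variables m, δ the harmonic mean is m - δ²/m, with defect (mδ' - m'δ)²/(mm'(m+m')). The
defect of the square root has twice this numerator, by `lorentz_defect` with τ = 1, and a
denominator of at most 4mm'(m+m'). -/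
theorem harm_defect_le {x y x' y' : ℝ} (hx : 0 ≤ x) (hy : 0 ≤ y) (hx' : 0 ≤ x') (hy' : 0 ≤ y') :
    2 * (x + x') * (y + y') / ((x + x') + (y + y')) - 2 * x * y / (x + y)
      - 2 * x' * y' / (x' + y')
      ≤ 2 * (√((x + x') * (y + y')) - √(x * y) - √(x' * y')) := by
  rcases eq_or_lt_of_le (add_nonneg hx hy) with h | h
  · obtain rfl : x = 0 := by linarith
    obtain rfl : y = 0 := by linarith
    simp
  rcases eq_or_lt_of_le (add_nonneg hx' hy') with h' | h'
  · obtain rfl : x' = 0 := by linarith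
    obtain rfl : y' = 0 := by linarith
    simp
  have hg := Real.sq_sqrt (mul_nonneg (add_nonneg hx hx') (add_nonneg hy hy'))
  have hg₁ := Real.sq_sqrt (mul_nonneg hx hy)
  have hg₂ := Real.sq_sqrt (mul_nonneg hx' hy')
  have hle := sqrt_mul_superadditive hx hy hx' hy'
  have p1 := Real.sqrt_nonneg (x * y)
  have p2 := Real.sqrt_nonneg (x' * y')
  set g := √((x + x') * (y + y'))
  set g₁ := √(x * y)
  set g₂ := √(x' * y')
  have e := lorentz_defect (τ := 1) (A := g) (A₁ := g₁) (A₂ := g₂) (m := (x + y) / 2)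
    (m' := (x' + y') / 2) (δ := (x - y) / 2) (δ' := (x' - y') / 2) (by rw [hg]; ring)
    (by rw [hg₁]; ring) (by rw [hg₂]; ring)
  have b0 : g ≤ (x + y) / 2 + (x' + y') / 2 :=
    abs_le_of_sq_le_sq' (by rw [hg]; nlinarith [sq_nonneg (x + x' - y - y')]) (by positivity) |>.2
  have b1 := abs_mul_add_mul_le (a := g₁) (b := (x - y) / 2) (c := g₂) (d := (x' - y') / 2)
    (m := (x + y) / 2) (m' := (x' + y') / 2) (by positivity) (by positivity)
    (by rw [hg₁]; apply le_of_eq; ring) (by rw [hg₂]; apply le_of_eq; ring)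
  have b2 : (x + y) / 2 * ((x' + y') / 2) - 1 * ((x - y) / 2 * ((x' - y') / 2)) + g₁ * g₂
      ≤ 2 * ((x + y) / 2 * ((x' + y') / 2)) := by
    linarith [le_abs_self (g₁ * g₂), neg_abs_le ((x - y) / 2 * ((x' - y') / 2))]
  have b3 : 0 ≤ (x + y) / 2 * ((x' + y') / 2) - 1 * ((x - y) / 2 * ((x' - y') / 2)) + g₁ * g₂ := by
    linarith [mul_nonneg p1 p2, le_abs_self ((x - y) / 2 * ((x' - y') / 2)), abs_nonneg (g₁ * g₂)]
  set E := (x + y) / 2 * ((x' + y') / 2) * ((x + y) / 2 + (x' + y') / 2) with hE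
  have hEpos : 0 < E := by positivity
  have b4 : (g + g₁ + g₂) *
      ((x + y) / 2 * ((x' + y') / 2) - 1 * ((x - y) / 2 * ((x' - y') / 2)) + g₁ * g₂)
      ≤ 4 * E := by
    calc _ ≤ (2 * ((x + y) / 2 + (x' + y') / 2)) * (2 * ((x + y) / 2 * ((x' + y') / 2))) :=
          mul_le_mul (by linarith) b2 b3 (by positivity)
      _ = 4 * E := by rw [hE]; ring
  have e' : (2 * (x + x') * (y + y') / ((x + x') + (y + y')) - 2 * x * y / (x + y)
      - 2 * x' * y' / (x' + y')) * E
      = ((x + y) / 2 * ((x' - y') / 2) - (x' + y') / 2 * ((x - y) / 2)) ^ 2 := by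
    have h'' : x + x' + (y + y') ≠ 0 := ne_of_gt (by linarith)
    rw [hE]
    field_simp
    ring
  refine le_of_mul_le_mul_right ?_ hEpos
  rw [e']
  have := mul_le_mul_of_nonneg_left b4 (sub_nonneg.2 (show g₁ + g₂ ≤ g from hle))
  nlinarith

theorem sublinear_harm_sub :
    Sublinear fun x y => 2 * x * y / (x + y) - 2 * √(x * y) where
  smul t x y ht hx hy := by
    rw [show t * x * (t * y) = t ^ 2 * (x * y) by ring, Real.sqrt_mul (by positivity),
      Real.sqrt_sq ht]
    rcases eq_or_lt_of_le ht with rfl | ht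
    · simp
    rcases eq_or_lt_of_le (add_nonneg hx hy) with h | h
    · obtain rfl : x = 0 := by linarith
      obtain rfl : y = 0 := by linarith
      simp
    have : t * x + t * y ≠ 0 := by rw [← mul_add]; positivity
    field_simp
  add x y x' y' hx hy hx' hy' := by
    have := harm_defect_le hx hy hx' hy'
    linarith

theorem sublinear_sqrt_noise {c : ℝ} (hc : 0 ≤ c) (hc' : c ≤ 1) :
    Sublinear fun x y => √((c * x + (1 - c) * y) * (c * y + (1 - c) * x))
      - (2 * c - 1) ^ 2 * √(x * y) where
  smul t x y ht hx hy := by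
    rw [show t * x * (t * y) = t ^ 2 * (x * y) by ring, Real.sqrt_mul (sq_nonneg t),
      show (c * (t * x) + (1 - c) * (t * y)) * (c * (t * y) + (1 - c) * (t * x))
        = t ^ 2 * ((c * x + (1 - c) * y) * (c * y + (1 - c) * x)) by ring,
      Real.sqrt_mul (sq_nonneg t), Real.sqrt_sq ht]
    ring
  add x y x' y' hx hy hx' hy' := by
    have hd : 0 ≤ 1 - c := by linarith
    have sq : ∀ u v : ℝ, 0 ≤ u → 0 ≤ v →
        √((c * u + (1 - c) * v) * (c * v + (1 - c) * u)) ^ 2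
          = ((u + v) / 2) ^ 2 - (2 * c - 1) ^ 2 * ((u - v) / 2) ^ 2 := by
      intro u v hu hv
      rw [Real.sq_sqrt (by positivity)]
      ring
    have sq' : ∀ u v : ℝ, 0 ≤ u → 0 ≤ v →
        √(u * v) ^ 2 = ((u + v) / 2) ^ 2 - ((u - v) / 2) ^ 2 := by
      intro u v hu hv
      rw [Real.sq_sqrt (by positivity)]
      ring
    have := lorentz_defect_le (τ := (2 * c - 1) ^ 2) (m := (x + y) / 2) (m' := (x' + y') / 2)
      (δ := (x - y) / 2) (δ' := (x' - y') / 2) (by positivity) (by nlinarith) (by positivity)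
      (by positivity) (Real.sqrt_nonneg _) (Real.sqrt_nonneg _) (Real.sqrt_nonneg _)
      (Real.sqrt_nonneg _) (Real.sqrt_nonneg _)
      (sqrt_mul_superadditive hx hy hx' hy')
      (by rw [sq _ _ (add_nonneg hx hx') (add_nonneg hy hy')]; ring) (sq _ _ hx hy) (sq _ _ hx' hy')
      (by rw [sq' _ _ (add_nonneg hx hx') (add_nonneg hy hy')]; ring) (sq' _ _ hx hy)
      (sq' _ _ hx' hy')
    linarith

theorem harm_bind_sub_harm_le {Ω Ω' : Type*} [Fintype Ω] [Fintype Ω'] (μ ν : FiniteLaw Ω)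
    (g : Ω → FiniteLaw Ω') :
    harm (μ.bind g) (ν.bind g) - harm μ ν ≤ 2 * (bc (μ.bind g) (ν.bind g) - bc μ ν) := by
  have := sublinear_harm_sub.sum_bind_le μ ν g
  simp only [Finset.sum_sub_distrib, ← Finset.mul_sum] at this
  unfold harm bc
  linarith

/-- Garbling an experiment costs little total variation if it costs little affinity. -/
theorem tv_le_tv_bind_add {Ω Ω' : Type*} [Fintype Ω] [Fintype Ω'] (μ ν : FiniteLaw Ω)
    (g : Ω → FiniteLaw Ω') {η : ℝ} (hη : 0 < η) :
    tv μ ν ≤ tv (μ.bind g) (ν.bind g) + η / 2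
      + (harm (μ.bind g) (ν.bind g) - harm μ ν) / (2 * η) := by
  set a : Ω' → ℝ := (μ.bind g).mass with ha
  set b : Ω' → ℝ := (ν.bind g).mass with hb
  have ha0 : ∀ y, 0 ≤ a y := (μ.bind g).nonneg
  have hb0 : ∀ y, 0 ≤ b y := (ν.bind g).nonneg
  -- The posterior bias given the garbled outcome `y`.
  set m : Ω' → ℝ := fun y => (a y - b y) / (a y + b y) with hm
  have hab : ∀ y, m y * (a y + b y) = a y - b y := by
    intro y
    rcases eq_or_lt_of_le (add_nonneg (ha0 y) (hb0 y)) with h | h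
    · have h1 : a y = 0 := by linarith [ha0 y, hb0 y]
      have h2 : b y = 0 := by linarith [ha0 y, hb0 y]
      rw [h1, h2]
      simp
    · exact div_mul_cancel₀ _ h.ne'
  -- Triangle inequality around the coarse bias, then AM–GM with parameter `η` on the deviation. The
  -- square is left expanded so that averaging over `g` turns it into a difference of second
  -- moments, that is, of values of `harm`.
  have pt : ∀ x y, |μ.mass x - ν.mass x| ≤ |m y| * (μ.mass x + ν.mass x)
      + (η / 2 * (μ.mass x + ν.mass x)
        + ((μ.mass x - ν.mass x) ^ 2 / (μ.mass x + ν.mass x)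
          - 2 * m y * (μ.mass x - ν.mass x) + m y ^ 2 * (μ.mass x + ν.mass x)) / (2 * η)) := by
    intro x y
    have h1 := μ.nonneg x
    have h2 := ν.nonneg x
    rcases eq_or_lt_of_le (add_nonneg h1 h2) with h | h
    · have h3 : μ.mass x = 0 := by linarith
      have h4 : ν.mass x = 0 := by linarith
      simp [h3, h4]
    set s := μ.mass x + ν.mass x
    set d := μ.mass x - ν.mass x
    have h3 : |d| ≤ |m y| * s + |d - m y * s| := by
      have : |m y| * s = |m y * s| := by rw [abs_mul, abs_of_pos h]
      rw [this]
      calc |d| = |m y * s + (d - m y * s)| := by congr 1; ring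
        _ ≤ _ := abs_add_le _ _
    have h4 : d ^ 2 / s - 2 * m y * d + m y ^ 2 * s = (d - m y * s) ^ 2 / s := by
      field_simp
      ring
    rw [h4]
    have h5 : η / 2 * s + (d - m y * s) ^ 2 / s / (2 * η) - |d - m y * s|
        = (|d - m y * s| - η * s) ^ 2 / (2 * η * s) := by
      rw [← sq_abs (d - m y * s)]
      field_simp
      ring
    have h6 : 0 ≤ (|d - m y * s| - η * s) ^ 2 / (2 * η * s) := by positivity
    linarith
  have wsum : ∑ x, |μ.mass x - ν.mass x| ≤ ∑ y, ∑ x, (g x).mass y * (|m y| * (μ.mass x + ν.mass x)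
      + (η / 2 * (μ.mass x + ν.mass x)
        + ((μ.mass x - ν.mass x) ^ 2 / (μ.mass x + ν.mass x)
          - 2 * m y * (μ.mass x - ν.mass x) + m y ^ 2 * (μ.mass x + ν.mass x)) / (2 * η))) := by
    rw [Finset.sum_comm]
    refine Finset.sum_le_sum fun x _ => ?_
    calc |μ.mass x - ν.mass x| = ∑ y, (g x).mass y * |μ.mass x - ν.mass x| := by
          rw [← Finset.sum_mul, sum_mass, one_mul]
      _ ≤ _ := Finset.sum_le_sum fun y _ => mul_le_mul_of_nonneg_left (pt x y) ((g x).nonneg y)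
  have hA : ∀ y, ∑ x, (g x).mass y * (μ.mass x + ν.mass x) = a y + b y := by
    intro y
    rw [ha, hb, bind_mass, bind_mass, ← Finset.sum_add_distrib]
    exact Finset.sum_congr rfl fun _ _ => by ring
  have hB : ∀ y, ∑ x, (g x).mass y * (μ.mass x - ν.mass x) = a y - b y := by
    intro y
    rw [ha, hb, bind_mass, bind_mass, ← Finset.sum_sub_distrib]
    exact Finset.sum_congr rfl fun _ _ => by ring
  have inner : ∀ y, ∑ x, (g x).mass y * (|m y| * (μ.mass x + ν.mass x)
      + (η / 2 * (μ.mass x + ν.mass x)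
        + ((μ.mass x - ν.mass x) ^ 2 / (μ.mass x + ν.mass x)
          - 2 * m y * (μ.mass x - ν.mass x) + m y ^ 2 * (μ.mass x + ν.mass x)) / (2 * η)))
      = |a y - b y| + η / 2 * (a y + b y)
        + (∑ x, (g x).mass y * ((μ.mass x - ν.mass x) ^ 2 / (μ.mass x + ν.mass x))
          - (a y - b y) ^ 2 / (a y + b y)) / (2 * η) := by
    intro y
    have e1 : ∀ x, (g x).mass y * (|m y| * (μ.mass x + ν.mass x)
      + (η / 2 * (μ.mass x + ν.mass x)
        + ((μ.mass x - ν.mass x) ^ 2 / (μ.mass x + ν.mass x)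
          - 2 * m y * (μ.mass x - ν.mass x) + m y ^ 2 * (μ.mass x + ν.mass x)) / (2 * η)))
        = (|m y| + η / 2 + m y ^ 2 / (2 * η)) * ((g x).mass y * (μ.mass x + ν.mass x))
          + (1 / (2 * η)) * ((g x).mass y * ((μ.mass x - ν.mass x) ^ 2 / (μ.mass x + ν.mass x)))
          - (m y / η) * ((g x).mass y * (μ.mass x - ν.mass x)) := by
      intro x
      generalize (μ.mass x - ν.mass x) ^ 2 / (μ.mass x + ν.mass x) = D
      field_simp
      ring
    simp only [e1, Finset.sum_add_distrib, Finset.sum_sub_distrib, ← Finset.mul_sum, hA, hB]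
    have e2 : (a y - b y) ^ 2 / (a y + b y) = m y * (a y - b y) := by
      rw [hm]
      ring
    have e3 : |a y - b y| = |m y| * (a y + b y) := by
      rw [← hab y, abs_mul, abs_of_nonneg (add_nonneg (ha0 y) (hb0 y))]
    rw [e2, e3]
    have e4 := hab y
    rw [← e4]
    field_simp
    ring
  rw [Finset.sum_congr rfl fun y _ => inner y, Finset.sum_add_distrib, Finset.sum_add_distrib,
    ← Finset.mul_sum, ← Finset.sum_div, Finset.sum_sub_distrib, Finset.sum_comm] at wsum
  simp only [← Finset.sum_mul, sum_mass, one_mul] at wsum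
  have hs : ∑ y, (a y + b y) = 2 := by
    rw [Finset.sum_add_distrib, ha, hb, sum_mass, sum_mass]
    norm_num
  rw [sum_sq_div_add μ ν, hs, ha, hb, sum_sq_div_add (μ.bind g) (ν.bind g)] at wsum
  unfold tv
  have e1 : (2 * (1 - harm μ ν) - 2 * (1 - harm (μ.bind g) (ν.bind g))) / (2 * η)
      = 2 * ((harm (μ.bind g) (ν.bind g) - harm μ ν) / (2 * η)) := by ring
  rw [e1] at wsum
  linarith

end Sublinear

/-! ### Building blocks of the tree: revealing, symmetric channel, random slot -/

section Building

variable {Ω Ω' : Type*} [Fintype Ω] [Fintype Ω']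

/-- A label seen with probability `p`. -/
noncomputable def reveal (p : unitInterval) (s : Fin 2) : FiniteLaw (Option (Fin 2)) :=
  (bern p).bind fun e => pure (if e then some s else none)

/-- The binary symmetric channel that keeps the label with probability `c`. -/
noncomputable def symChannel (c : unitInterval) (s : Fin 2) : FiniteLaw (Fin 2) :=
  (bern c).bind fun e => pure (if e then s else s.rev)

/-- A sample from `μ` that is present with probability `q`. -/
noncomputable def slot (q : unitInterval) (μ : FiniteLaw Ω) : FiniteLaw (Option Ω) :=
  (bern q).bind fun e => μ.bind fun d => pure (if e then some d else none)

theorem slot_some (q : unitInterval) (μ : FiniteLaw Ω) (d : Ω) :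
    (slot q μ).mass (some d) = q * μ.mass d := by
  classical
  simp [slot, bind_mass, pure_mass]

theorem slot_none (q : unitInterval) (μ : FiniteLaw Ω) : (slot q μ).mass none = 1 - q := by
  classical
  simp [slot, bind_mass, pure_mass, sum_mass]

theorem reveal_some (p : unitInterval) (s t : Fin 2) :
    (reveal p s).mass (some t) = if t = s then (p : ℝ) else 0 := by
  classical
  simp [reveal, bern_bind_mass, pure_mass]

theorem reveal_none (p : unitInterval) (s : Fin 2) : (reveal p s).mass none = 1 - p := by
  classical
  simp [reveal, bern_bind_mass, pure_mass]

theorem symChannel_bind_mass (c : unitInterval) (W : Fin 2 → FiniteLaw Ω) (s : Fin 2) (x : Ω) :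
    ((symChannel c s).bind W).mass x = c * (W s).mass x + (1 - c) * (W s.rev).mass x := by
  simp [symChannel, bern_bind_mass]

theorem prod_mass (μ : FiniteLaw Ω) (ν : FiniteLaw Ω') (x : Ω × Ω') :
    (μ.bind fun a => ν.bind fun b => pure (a, b)).mass x = μ.mass x.1 * ν.mass x.2 := by
  classical
  obtain ⟨a, b⟩ := x
  simp only [bind_mass, pure_mass, Prod.mk.injEq]
  rw [Finset.sum_eq_single a]
  · rw [Finset.sum_eq_single b]
    · simp
    · intro b' _ hb
      simp [hb.symm]
    · simp
  · intro a' _ ha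
    simp [ha.symm]
  · simp

theorem slot_bind (q : unitInterval) (μ : FiniteLaw Ω) (g : Ω → FiniteLaw Ω') :
    slot q (μ.bind g) = (slot q μ).bind fun o =>
      o.elim (pure none) fun d => (g d).bind fun d' => pure (some d') := by
  simp only [slot, bind_assoc, pure_bind]
  congr 1
  funext e
  cases e
  · simp
  · simp

theorem bc_prod (μ ν : FiniteLaw Ω) (μ' ν' : FiniteLaw Ω') :
    bc (μ.bind fun a => μ'.bind fun b => pure (a, b)) (ν.bind fun a => ν'.bind fun b => pure (a, b))
      = bc μ ν * bc μ' ν' := by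
  simp only [bc, prod_mass, Fintype.sum_prod_type, Finset.sum_mul_sum]
  refine Finset.sum_congr rfl fun x _ => Finset.sum_congr rfl fun y _ => ?_
  rw [← Real.sqrt_mul (mul_nonneg (μ.nonneg _) (ν.nonneg _))]
  congr 1
  ring

theorem bc_slot (q : unitInterval) (μ ν : FiniteLaw Ω) :
    bc (slot q μ) (slot q ν) = q * bc μ ν + (1 - q) := by
  have h1 : (0 : ℝ) ≤ 1 - q := by linarith [q.2.2]
  simp only [bc, Fintype.sum_option, slot_some, slot_none, Real.sqrt_mul_self h1, Finset.mul_sum]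
  rw [add_comm]
  congr 1
  refine Finset.sum_congr rfl fun x _ => ?_
  rw [show (q : ℝ) * μ.mass x * (q * ν.mass x) = q ^ 2 * (μ.mass x * ν.mass x) by ring,
    Real.sqrt_mul (sq_nonneg _), Real.sqrt_sq q.2.1]

theorem bc_reveal (p : unitInterval) : bc (reveal p 0) (reveal p 1) = 1 - p := by
  have h1 : (0 : ℝ) ≤ 1 - p := by linarith [p.2.2]
  simp [bc, Fintype.sum_option, reveal_some, reveal_none, Real.sqrt_mul_self h1]

theorem harm_prod_le (μ ν : FiniteLaw Ω) (μ' ν' : FiniteLaw Ω') (h : skew μ ν = 0) :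
    harm μ ν * harm μ' ν' ≤ harm (μ.bind fun a => μ'.bind fun b => pure (a, b))
      (ν.bind fun a => ν'.bind fun b => pure (a, b)) := by
  have := harm_mul_sub_skew_mul_le μ ν μ' ν'
  rw [h, zero_mul, sub_zero] at this
  refine this.trans_eq ?_
  simp only [harm, prod_mass, Fintype.sum_prod_type]

theorem harm_slot (q : unitInterval) (μ ν : FiniteLaw Ω) :
    harm (slot q μ) (slot q ν) = q * harm μ ν + (1 - q) := by
  simp only [harm, Fintype.sum_option, slot_some, slot_none, Finset.mul_sum]
  rw [add_comm]
  congr 1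
  · refine Finset.sum_congr rfl fun x _ => ?_
    rcases eq_or_ne (q : ℝ) 0 with h | h
    · simp [h]
    · rw [← mul_add, show 2 * (q * μ.mass x) * (q * ν.mass x)
        = q * (q * (2 * μ.mass x * ν.mass x)) by ring, mul_div_assoc, mul_div_mul_left _ _ h]
  · rcases eq_or_ne (1 - q : ℝ) 0 with h | h
    · simp [h]
    · field_simp
      ring

theorem skew_slot (q : unitInterval) (μ ν : FiniteLaw Ω) (h : skew μ ν = 0) :
    skew (slot q μ) (slot q ν) = 0 := by
  have e : skew (slot q μ) (slot q ν) = q * skew μ ν := by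
    simp only [skew, Fintype.sum_option, slot_some, slot_none, Finset.mul_sum, sub_self, mul_zero,
      zero_div, zero_add]
    refine Finset.sum_congr rfl fun x _ => ?_
    rcases eq_or_ne (q : ℝ) 0 with h | h
    · simp [h]
    · rw [← mul_add, ← mul_sub, mul_pow, show 2 * (q * μ.mass x) * (q * ν.mass x)
          * (q * (μ.mass x - ν.mass x))
        = q ^ 2 * (q * (2 * μ.mass x * ν.mass x * (μ.mass x - ν.mass x))) by ring,
        mul_div_mul_left _ _ (pow_ne_zero 2 h), mul_div_assoc]
  rw [e, h, mul_zero]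

theorem harm_reveal (p : unitInterval) : harm (reveal p 0) (reveal p 1) = 1 - p := by
  simp only [harm, Fintype.sum_option, reveal_some, reveal_none, Fin.sum_univ_two]
  rcases eq_or_ne (1 - p : ℝ) 0 with h | h
  · simp [h]
  · norm_num
    field_simp
    ring

theorem skew_reveal (p : unitInterval) : skew (reveal p 0) (reveal p 1) = 0 := by
  simp [skew, Fintype.sum_option, reveal_some, reveal_none]

/-- The channel preserves the sum of the two masses and multiplies their difference by 2c - 1. -/
theorem one_sub_harm_symChannel (c : unitInterval) (W : Fin 2 → FiniteLaw Ω) :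
    1 - harm ((symChannel c 0).bind W) ((symChannel c 1).bind W)
      = (2 * c - 1) ^ 2 * (1 - harm (W 0) (W 1)) := by
  rw [one_sub_harm, one_sub_harm, Finset.mul_sum]
  refine Finset.sum_congr rfl fun x _ => ?_
  rw [symChannel_bind_mass, symChannel_bind_mass,
    show (0 : Fin 2).rev = 1 from rfl, show (1 : Fin 2).rev = 0 from rfl, ← mul_div_assoc,
    ← mul_pow]
  congr 2 <;> ring

/-- Strong data processing of the symmetric channel for the affinity. -/
theorem bc_symChannel_sub_le (c : unitInterval) (W : Fin 2 → FiniteLaw Ω) (g : Ω → FiniteLaw Ω') :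
    bc ((symChannel c 0).bind fun s => (W s).bind g) ((symChannel c 1).bind fun s => (W s).bind g)
      - bc ((symChannel c 0).bind W) ((symChannel c 1).bind W)
      ≤ (2 * c - 1) ^ 2 * (bc ((W 0).bind g) ((W 1).bind g) - bc (W 0) (W 1)) := by
  have h := (sublinear_sqrt_noise c.2.1 c.2.2).sum_bind_le (W 0) (W 1) g
  simp only [Finset.sum_sub_distrib, ← Finset.mul_sum] at h
  have e0 : (0 : Fin 2).rev = 1 := rfl
  have e1 : (1 : Fin 2).rev = 0 := rfl
  simp only [bc, symChannel_bind_mass, e0, e1]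
  linarith

end Building

/-! ### Broadcasting trees below the Kesten–Stigum threshold -/

section Tree

/-- The data carried by a labelled tree of depth `r` whose vertices have children slots `V`. -/
def TreeData (V : Type) : ℕ → Type
  | 0 => Fin 2
  | r + 1 => Option (Fin 2) × (V → Option (TreeData V r))

namespace TreeData

variable {V : Type} {r : ℕ}

/-- The tree with the given data at the root and in the child slots. -/
def mk (o : Option (Fin 2)) (h : V → Option (TreeData V r)) : TreeData V (r + 1) := (o, h)

/-- The data at the root. -/
def root (x : TreeData V (r + 1)) : Option (Fin 2) := x.1

/-- The data in the child slots. -/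
def children (x : TreeData V (r + 1)) : V → Option (TreeData V r) := x.2

@[simp]
theorem root_mk (o : Option (Fin 2)) (h : V → Option (TreeData V r)) : (mk o h).root = o := rfl

@[simp]
theorem children_mk (o : Option (Fin 2)) (h : V → Option (TreeData V r)) :
    (mk o h).children = h := rfl

end TreeData

variable (V : Type) [Fintype V] [DecidableEq V]

noncomputable instance TreeData.fintype : ∀ r, Fintype (TreeData V r)
  | 0 => inferInstanceAs (Fintype (Fin 2))
  | r + 1 =>
    have := TreeData.fintype r
    inferInstanceAs (Fintype (Option (Fin 2) × (V → Option (TreeData V r))))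

/-- A default value. -/
def TreeData.dflt (V : Type) : ∀ r, TreeData V r
  | 0 => (0 : Fin 2)
  | _ + 1 => (none, fun _ => none)

/-- The law of the data of a broadcasting tree of depth `r` with root label `s`. Each vertex is
revealed with probability `p`, each child slot is occupied with probability `q`, and a child has the
label of its parent with probability `c`; the leaves carry the data `base`. -/
noncomputable def tree (p q c : unitInterval) (base : Fin 2 → FiniteLaw (Fin 2)) :
    ∀ r, Fin 2 → FiniteLaw (TreeData V r)
  | 0, s => base s
  | r + 1, s => (reveal p s).bind fun o =>
      (pi fun _ : V => slot q ((symChannel c s).bind (tree p q c base r))).bind fun h =>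
        pure (TreeData.mk o h)

variable {V} (p q c : unitInterval)

/-- Forgetting the labels of the leaves is a garbling. -/
theorem exists_tree_garbling (r : ℕ) : ∃ g : TreeData V r → FiniteLaw (TreeData V r), ∀ s,
    tree V p q c (fun _ => pure 0) r s = (tree V p q c pure r s).bind g := by
  induction r with
  | zero => exact ⟨fun _ => pure (0 : Fin 2), fun s => (bind_const _ _).symm⟩
  | succ r ih =>
    obtain ⟨g, hg⟩ := ih
    refine ⟨fun x => (pi fun w => (x.children w).elim (pure none) fun d => (g d).bind fun d' =>
      pure (some d')).bind fun h => pure (TreeData.mk x.root h), fun s => ?_⟩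
    have h1 : tree V p q c (fun _ => pure 0) r = fun s => (tree V p q c pure r s).bind g :=
      funext hg
    rw [tree, tree, bind_assoc]
    congr 1
    funext o
    rw [bind_assoc, h1, ← bind_assoc, slot_bind, pi_bind, bind_assoc]
    simp only [pure_bind, TreeData.root_mk, TreeData.children_mk]

variable (base : Fin 2 → FiniteLaw (Fin 2))

theorem bc_tree_succ (r : ℕ) :
    bc (tree V p q c base (r + 1) 0) (tree V p q c base (r + 1) 1)
      = (1 - p) * (q * bc ((symChannel c 0).bind (tree V p q c base r))
        ((symChannel c 1).bind (tree V p q c base r)) + (1 - q)) ^ Fintype.card V := by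
  have := bc_prod (reveal p 0) (reveal p 1)
    (pi fun _ : V => slot q ((symChannel c 0).bind (tree V p q c base r)))
    (pi fun _ : V => slot q ((symChannel c 1).bind (tree V p q c base r)))
  refine this.trans ?_
  rw [bc_reveal, bc_pi]
  simp only [bc_slot, Finset.prod_const, Finset.card_univ]

/-- Below the Kesten–Stigum threshold the labels of the leaves add little affinity. -/
theorem bc_tree_sub_le {l : ℝ} (hl : (Fintype.card V * q * (2 * c - 1) ^ 2 : ℝ) ≤ l) (r : ℕ) :
    bc (tree V p q c (fun _ => pure 0) r 0) (tree V p q c (fun _ => pure 0) r 1)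
      - bc (tree V p q c pure r 0) (tree V p q c pure r 1) ≤ l ^ r := by
  have hl0 : 0 ≤ l := le_trans (mul_nonneg (mul_nonneg (Nat.cast_nonneg _) q.2.1) (sq_nonneg _)) hl
  induction r with
  | zero =>
    rw [pow_zero]
    linarith [bc_le_one (tree V p q c (fun _ => pure 0) 0 0) (tree V p q c (fun _ => pure 0) 0 1),
      bc_nonneg (tree V p q c pure 0 0) (tree V p q c pure 0 1)]
  | succ r ih =>
    obtain ⟨g, hg⟩ := exists_tree_garbling (V := V) p q c r
    have h1 := bc_symChannel_sub_le c (tree V p q c pure r) g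
    have h2 : tree V p q c (fun _ => pure 0) r = fun s => (tree V p q c pure r s).bind g :=
      funext hg
    rw [← h2, ← hg, ← hg] at h1
    rw [bc_tree_succ, bc_tree_succ]
    set x := bc ((symChannel c 0).bind (tree V p q c (fun _ => pure 0) r))
      ((symChannel c 1).bind (tree V p q c (fun _ => pure 0) r))
    set y := bc ((symChannel c 0).bind (tree V p q c pure r))
      ((symChannel c 1).bind (tree V p q c pure r))
    have hx1 : x ≤ 1 := bc_le_one _ _
    have hx0 : 0 ≤ x := bc_nonneg _ _
    have hy1 : y ≤ 1 := bc_le_one _ _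
    have hy0 : 0 ≤ y := bc_nonneg _ _
    have hq0 := q.2.1
    have hq1 := q.2.2
    have hp0 := p.2.1
    have hp1 := p.2.2
    -- Telescoping with both bases in [0,1]. The positive part spares a discussion of the sign of `x
    -- - y`.
    have hpow : ∀ n : ℕ, (q * x + (1 - q) : ℝ) ^ n - (q * y + (1 - q)) ^ n
        ≤ n * q * max (x - y) 0 := by
      intro n
      have ha : (q * x + (1 - q) : ℝ) ≤ 1 := by nlinarith
      have ha0 : (0 : ℝ) ≤ q * x + (1 - q) := by nlinarith
      have hb : (q * y + (1 - q) : ℝ) ≤ 1 := by nlinarith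
      have hb0 : (0 : ℝ) ≤ q * y + (1 - q) := by nlinarith
      induction n with
      | zero => simp
      | succ n ihn =>
        have e : (q * x + (1 - q) : ℝ) ^ (n + 1) - (q * y + (1 - q)) ^ (n + 1)
            = (q * x + (1 - q)) * ((q * x + (1 - q) : ℝ) ^ n - (q * y + (1 - q)) ^ n)
              + q * (x - y) * (q * y + (1 - q)) ^ n := by ring
        rw [e]
        have hm : (0 : ℝ) ≤ n * q * max (x - y) 0 := by positivity
        have t1 : (q * x + (1 - q)) * ((q * x + (1 - q) : ℝ) ^ n - (q * y + (1 - q)) ^ n)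
            ≤ n * q * max (x - y) 0 := by
          refine (mul_le_mul_of_nonneg_left ihn ha0).trans ?_
          exact mul_le_of_le_one_left hm ha
        have t2 : q * (x - y) * (q * y + (1 - q)) ^ n ≤ q * max (x - y) 0 := by
          refine (mul_le_mul_of_nonneg_right (mul_le_mul_of_nonneg_left (le_max_left _ 0) hq0)
            (pow_nonneg hb0 n)).trans ?_
          exact mul_le_of_le_one_right (by positivity) (pow_le_one₀ hb0 hb)
        push_cast
        linarith
    have h3 := hpow (Fintype.card V)
    have h4 : max (x - y) 0 ≤ (2 * c - 1 : ℝ) ^ 2 * l ^ r := by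
      refine max_le (h1.trans (mul_le_mul_of_nonneg_left ih (sq_nonneg _))) ?_
      positivity
    have h5 : (Fintype.card V * q * max (x - y) 0 : ℝ) ≤ l ^ (r + 1) := by
      refine (mul_le_mul_of_nonneg_left h4 (by positivity)).trans ?_
      rw [← mul_assoc, pow_succ' l]
      exact mul_le_mul_of_nonneg_right hl (by positivity)
    rw [← mul_sub]
    have h6 : (0 : ℝ) ≤ l ^ (r + 1) := by positivity
    calc _ ≤ (1 - p : ℝ) * l ^ (r + 1) := mul_le_mul_of_nonneg_left (h3.trans h5) (by linarith)
      _ ≤ l ^ (r + 1) := mul_le_of_le_one_left h6 (by linarith)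

/-- The affinity lost is at most l^r, so the `harm` lost is at most 2 l^r. The parameter `η` stays
free: it is fixed first, and then `r` is taken large. -/
theorem tv_tree_pure_le {l η : ℝ} (hl : (Fintype.card V * q * (2 * c - 1) ^ 2 : ℝ) ≤ l) (hη : 0 < η)
    (r : ℕ) :
    tv (tree V p q c pure r 0) (tree V p q c pure r 1)
      ≤ tv (tree V p q c (fun _ => pure 0) r 0) (tree V p q c (fun _ => pure 0) r 1) + η / 2
        + l ^ r / η := by
  obtain ⟨g, hg⟩ := exists_tree_garbling (V := V) p q c r
  have h1 := tv_le_tv_bind_add (tree V p q c pure r 0) (tree V p q c pure r 1) g hη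
  have h2 := harm_bind_sub_harm_le (tree V p q c pure r 0) (tree V p q c pure r 1) g
  have h3 := bc_tree_sub_le p q c hl r
  rw [← hg, ← hg] at h1 h2
  refine h1.trans (add_le_add_right ?_ _)
  rw [div_le_div_iff₀ (by positivity) hη]
  nlinarith

/-- Exchanging the two labels in the data of a tree. -/
def TreeData.swap (V : Type) : ∀ r, Equiv.Perm (TreeData V r)
  | 0 => Fin.revPerm
  | r + 1 => Equiv.prodCongr (Equiv.optionCongr Fin.revPerm)
      (Equiv.arrowCongr (Equiv.refl V) (Equiv.optionCongr (TreeData.swap V r)))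

/-- Revealing, the channel and the visible leaves all commute with exchanging the labels. This
symmetry makes the skewness vanish. -/
theorem tree_pure_swap (r : ℕ) (s : Fin 2) (x : TreeData V r) :
    (tree V p q c pure r s).mass (TreeData.swap V r x) = (tree V p q c pure r s.rev).mass x := by
  induction r generalizing s with
  | zero =>
    change Fin 2 at x
    change (pure s : FiniteLaw (Fin 2)).mass (Fin.rev x) = (pure s.rev : FiniteLaw (Fin 2)).mass x
    have e : Fin.rev x = s ↔ x = s.rev := Fin.rev_eq_iff
    by_cases h : x = s.rev
    · rw [pure_mass, pure_mass, if_pos h, if_pos (e.2 h)]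
    · rw [pure_mass, pure_mass, if_neg h, if_neg (mt e.1 h)]
  | succ r ih =>
    obtain ⟨o, h⟩ := x
    have e : ∀ s, (tree V p q c pure (r + 1) s).mass = fun x => (reveal p s).mass x.1 *
        (pi fun _ : V => slot q ((symChannel c s).bind (tree V p q c pure r))).mass x.2 :=
      fun s => funext fun x => prod_mass (reveal p s) _ x
    rw [e, e]
    change (reveal p s).mass (o.map Fin.rev) * (pi fun _ : V => slot q
      ((symChannel c s).bind (tree V p q c pure r))).mass
        (fun w => (h w).map (TreeData.swap V r)) = _
    congr 1
    · cases o with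
      | none => simp [reveal_none]
      | some t => simp [reveal_some, Fin.rev_eq_iff]
    · rw [pi_mass, pi_mass]
      refine Finset.prod_congr rfl fun w _ => ?_
      dsimp only
      cases h w with
      | none => simp [slot_none]
      | some d => simp [slot_some, symChannel_bind_mass, ih]

theorem skew_symChannel_tree (r : ℕ) :
    skew ((symChannel c 0).bind (tree V p q c pure r)) ((symChannel c 1).bind (tree V p q c pure r))
      = 0 := by
  have e0 : (0 : Fin 2).rev = 1 := rfl
  have e1 : (1 : Fin 2).rev = 0 := rfl
  refine skew_eq_zero _ _ (TreeData.swap V r) (fun x => ?_) fun x => ?_ <;>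
    simp only [symChannel_bind_mass, tree_pure_swap, e0, e1]

/-- Iteration of V ↦ p + l V, with fixed point p/(1-l): the root contributes the factor 1 - p to
`harm`, and the n slots together lose at most l V. -/
theorem one_sub_harm_tree_le (n : ℕ) {l : ℝ} (hl : (n * q * (2 * c - 1) ^ 2 : ℝ) ≤ l) (hl1 : l < 1)
    (r : ℕ) :
    1 - harm (tree (Fin n) p q c pure r 0) (tree (Fin n) p q c pure r 1) ≤ p / (1 - l) + l ^ r := by
  have hl0 : 0 ≤ l := le_trans (mul_nonneg (mul_nonneg (Nat.cast_nonneg _) q.2.1) (sq_nonneg _)) hl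
  have hp0 := p.2.1
  have hp1 := p.2.2
  have hq0 := q.2.1
  have hq1 := q.2.2
  have hl2 : 0 < 1 - l := by linarith
  induction r with
  | zero =>
    have : 0 ≤ (p : ℝ) / (1 - l) := by positivity
    rw [pow_zero]
    linarith [harm_nonneg (tree (Fin n) p q c pure 0 0) (tree (Fin n) p q c pure 0 1)]
  | succ r ih =>
    set a := (symChannel c 0).bind (tree (Fin n) p q c pure r)
    set b := (symChannel c 1).bind (tree (Fin n) p q c pure r)
    have h1 : harm (reveal p 0) (reveal p 1) * harm (pi fun _ : Fin n => slot q a)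
        (pi fun _ : Fin n => slot q b)
        ≤ harm (tree (Fin n) p q c pure (r + 1) 0) (tree (Fin n) p q c pure (r + 1) 1) :=
      harm_prod_le _ _ _ _ (skew_reveal p)
    have h2 := harm_pow_le_harm_pi (slot q a) (slot q b)
      (skew_slot q a b (skew_symChannel_tree p q c r)) n
    have h3 : 1 - harm a b = _ := one_sub_harm_symChannel c (tree (Fin n) p q c pure r)
    rw [harm_slot] at h2
    rw [harm_reveal] at h1
    set V := 1 - harm (tree (Fin n) p q c pure r 0) (tree (Fin n) p q c pure r 1)
    have hV1 : V ≤ 1 := by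
      linarith [harm_nonneg (tree (Fin n) p q c pure r 0)
        (tree (Fin n) p q c pure r 1)]
    have hV0 : 0 ≤ V := by
      linarith [harm_le_one (tree (Fin n) p q c pure r 0)
        (tree (Fin n) p q c pure r 1)]
    have h4 : (q * harm a b + (1 - q) : ℝ) = 1 + -(q * ((2 * c - 1) ^ 2 * V)) := by
      rw [← h3]
      ring
    -- Bernoulli's inequality for the product over the slots.
    have h5 : (1 + n * -(q * ((2 * c - 1) ^ 2 * V)) : ℝ) ≤ (q * harm a b + (1 - q) : ℝ) ^ n := by
      rw [h4]
      refine one_add_mul_le_pow ?_ n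
      rw [← h3]
      nlinarith [harm_nonneg a b]
    have h6 : (n * (q * ((2 * c - 1) ^ 2 * V)) : ℝ) ≤ l * (p / (1 - l) + l ^ r) := by
      calc _ = (n * q * (2 * c - 1) ^ 2 * V : ℝ) := by ring
        _ ≤ l * V := mul_le_mul_of_nonneg_right hl hV0
        _ ≤ _ := mul_le_mul_of_nonneg_left ih hl0
    have h7 : (p : ℝ) + l * (p / (1 - l) + l ^ r) = p / (1 - l) + l ^ (r + 1) := by
      field_simp
      ring
    have h8 : (1 - p : ℝ) * (1 - l * (p / (1 - l) + l ^ r)) ≤ (1 - p)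
        * harm (pi fun _ : Fin n => slot q a) (pi fun _ : Fin n => slot q b) :=
      mul_le_mul_of_nonneg_left (by linarith) (by linarith)
    have h9 : 0 ≤ l * (p / (1 - l) + l ^ r) := by positivity
    nlinarith

theorem tv_tree_pure_le_sqrt (n : ℕ) {l : ℝ} (hl : (n * q * (2 * c - 1) ^ 2 : ℝ) ≤ l) (hl1 : l < 1)
    (r : ℕ) :
    tv (tree (Fin n) p q c pure r 0) (tree (Fin n) p q c pure r 1) ≤ √(p / (1 - l) + l ^ r) :=
  Real.le_sqrt_of_sq_le
    ((tv_sq_le_one_sub_harm _ _).trans (one_sub_harm_tree_le p q c n hl hl1 r))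

end Tree

/-! ### Grouping child slots in blocks -/

section Coarsen

variable {Ω : Type*} [Fintype Ω]

/-- The first value that is present. -/
def firstSome {α : Type*} : ∀ n, (Fin n → Option α) → Option α
  | 0, _ => none
  | n + 1, h => (h 0).elim (firstSome n fun i => h i.succ) some

/-- The probability that at least one of `n` slots is occupied. -/
noncomputable def blockProb (q : unitInterval) (n : ℕ) : unitInterval :=
  unitInterval.symm (unitInterval.symm q ^ n)

theorem coe_blockProb (q : unitInterval) (n : ℕ) :
    (blockProb q n : ℝ) = 1 - (1 - (q : ℝ)) ^ n := by
  simp [blockProb, unitInterval.coe_symm_eq]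

/-- The contents of the slots are independent of which slots are occupied, so the first content
present is again a sample from `μ`. Further occupied slots of a block are discarded; they are rare
when blocks are rarely occupied. -/
theorem pi_slot_firstSome (q : unitInterval) (μ : FiniteLaw Ω) (n : ℕ) :
    ((pi fun _ : Fin n => slot q μ).bind fun h => pure (firstSome n h)) = slot (blockProb q n) μ := by
  induction n with
  | zero =>
    have h0 : blockProb q 0 = 0 := by
      ext
      simp [coe_blockProb]
    have h1 : ∀ h : Fin 0 → Option Ω, firstSome 0 h = none := fun _ => rfl
    simp only [h1, bind_const, slot, h0, bern_zero]
    simp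
  | succ n ih =>
    have h1 : ∀ (a : Option Ω) (f : Fin n → Option Ω),
        firstSome (n + 1) (Fin.cons a f : Fin (n + 1) → Option Ω) = a.elim (firstSome n f) some :=
      fun _ _ => rfl
    have h2 : ∀ a : Option Ω, ((pi fun _ : Fin n => slot q μ).bind fun f =>
        (pure (a.elim (firstSome n f) some) : FiniteLaw (Option Ω)))
          = a.elim (slot (blockProb q n) μ) fun d => (pure (some d) : FiniteLaw (Option Ω)) := by
      intro a
      cases a with
      | none => exact ih
      | some d => exact bind_const (pi fun _ : Fin n => slot q μ) (pure (some d))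
    rw [pi_fin_succ]
    simp only [h1, h2]
    classical
    ext x
    rw [bind_mass, Fintype.sum_option]
    cases x with
    | none =>
      simp only [slot_none, slot_some, Option.elim, pure_mass, coe_blockProb]
      simp
      ring
    | some d =>
      simp only [slot_none, slot_some, Option.elim, pure_mass, coe_blockProb]
      simp
      ring

theorem tv_bern (q q' : unitInterval) : tv (bern q) (bern q') = |(q : ℝ) - q'| := by
  simp only [tv, Fintype.sum_bool, bern_true, bern_false]
  rw [show (1 - q - (1 - q') : ℝ) = -(q - q') by ring, abs_neg]
  ring

theorem tv_slot_le (q q' : unitInterval) (μ ν : FiniteLaw Ω) :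
    tv (slot q μ) (slot q' ν) ≤ |(q : ℝ) - q'| + q' * tv μ ν := by
  refine (tv_triangle _ (slot q' μ) _).trans (add_le_add ?_ ?_)
  · exact (tv_bind_left _ _ _).trans_eq (tv_bern q q')
  · refine (tv_bind_right _ _ _).trans ?_
    simp only [expect, Fintype.sum_bool, bern_true, bern_false, if_true, Bool.false_eq_true,
      if_false, bind_const, tv_self, mul_zero, add_zero]
    exact mul_le_mul_of_nonneg_left (tv_bind_left _ _ _) q'.2.1

variable {V V' : Type} [Fintype V] [DecidableEq V] [Fintype V'] [DecidableEq V']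

/-- The error of the coarsening of a tree of depth `r`. -/
noncomputable def coarsenError (d η : ℝ) : ℕ → ℝ
  | 0 => 0
  | r + 1 => η + d * coarsenError d η r

/-- Grouping the child slots in blocks turns a tree with many slots into one with few slots. -/
theorem exists_tree_coarsening (p q q' c : unitInterval) (base : Fin 2 → FiniteLaw (Fin 2)) {m : ℕ}
    {e : V' × Fin m → V} (he : Function.Injective e) (r : ℕ) :
    ∃ g : TreeData V r → FiniteLaw (TreeData V' r), ∀ s,
      tv ((tree V p q c base r s).bind g) (tree V' p q' c base r s)
        ≤ coarsenError (Fintype.card V' * q') (Fintype.card V' * |(blockProb q m : ℝ) - q'|) r := by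
  induction r with
  | zero =>
    have h : ∀ s, tv ((base s).bind pure) (base s) ≤ 0 := fun s => by rw [bind_pure, tv_self]
    exact ⟨fun x => pure (Ω := Fin 2) x, h⟩
  | succ r ih =>
    obtain ⟨g, hg⟩ := ih
    refine ⟨fun x => (pi fun j : V' => (firstSome m fun k => x.children (e (j, k))).elim (pure none)
      fun d => (g d).bind fun d' => pure (some d')).bind fun h => pure (TreeData.mk x.root h),
      fun s => ?_⟩
    set μ := (symChannel c s).bind (tree V p q c base r)
    have h1 : ((pi fun _ : V => slot q μ).bind fun h => pure fun j : V' =>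
        firstSome m fun k => h (e (j, k))) = pi fun _ : V' => slot (blockProb q m) μ := by
      rw [← pi_slot_firstSome, pi_map (fun _ : V' => pi fun _ : Fin m => slot q μ), ← pi_curry,
        ← pi_comp_injective he fun _ => slot q μ]
      simp only [bind_assoc, pure_bind]
    have h0 : tree V p q c base (r + 1) s = (reveal p s).bind fun o =>
      (pi fun _ : V => slot q μ).bind fun h => pure (TreeData.mk o h) := rfl
    have h2 : (tree V p q c base (r + 1) s).bind (fun x => (pi fun j : V' =>
        (firstSome m fun k => x.children (e (j, k))).elim (pure none)
        fun d => (g d).bind fun d' => pure (some d')).bind fun h => pure (TreeData.mk x.root h))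
        = (reveal p s).bind fun o => (pi fun _ : V' => slot (blockProb q m) (μ.bind g)).bind
          fun h => pure (TreeData.mk o h) := by
      rw [h0, bind_assoc]
      congr 1
      funext o
      rw [slot_bind _ μ, pi_bind, bind_assoc, ← h1, bind_assoc, bind_assoc]
      simp only [pure_bind, TreeData.root_mk, TreeData.children_mk]
    rw [h2, tree]
    -- Each block costs the mismatch of occupation probabilities plus, when occupied, the error of
    -- the subtree; this is the recursion of `coarsenError`.
    refine tv_bind_right_le _ _ _ fun o => (tv_bind_left _ _ _).trans ((tv_pi_le_sum _ _).trans ?_)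
    rw [Finset.sum_const, Finset.card_univ, nsmul_eq_mul, coarsenError, mul_assoc, ← mul_add]
    refine mul_le_mul_of_nonneg_left ((tv_slot_le _ _ _ _).trans (add_le_add_right ?_ _))
      (Nat.cast_nonneg _)
    refine mul_le_mul_of_nonneg_left ?_ q'.2.1
    rw [bind_assoc]
    exact tv_bind_right_le _ _ _ hg

theorem coarsenError_le {d η : ℝ} (hd : 0 ≤ d) (hη : 0 ≤ η) (r : ℕ) :
    coarsenError d η r ≤ η * (2 + d) ^ r := by
  induction r with
  | zero => simpa [coarsenError] using hη
  | succ r ih =>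
    have h1 : 1 ≤ (2 + d) ^ r := one_le_pow₀ (by linarith)
    have h2 := mul_le_mul_of_nonneg_left ih hd
    rw [coarsenError, pow_succ]
    nlinarith [mul_le_mul_of_nonneg_left h1 hη]

end Coarsen

/-! ### Separating coordinates of product laws -/

section Product

variable {ι : Type*} [Fintype ι] [DecidableEq ι] {Ω : ι → Type*} [∀ i, Fintype (Ω i)]

/-- In contrast to `pi_bind_update` the other coordinates keep the law `pi μ`; its coordinate `v` is
a dummy, overwritten by `d`. -/
theorem pi_bind_indep {Ξ : Type*} [Fintype Ξ] (μ : ∀ i, FiniteLaw (Ω i)) (v : ι) (d : Ω v)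
    (h : Ω v → (∀ i, Ω i) → FiniteLaw Ξ) :
    ((pi μ).bind fun f => h (f v) (Function.update f v d))
      = (μ v).bind fun y => (pi μ).bind fun f => h y (Function.update f v d) := by
  rw [pi_bind_update]
  congr 1
  funext y
  have := pi_bind_update μ v d fun _ f => h y f
  rw [this, bind_const]

theorem pi_pair {Ω' : ι → Type*} [∀ i, Fintype (Ω' i)] {Ξ : Type*} [Fintype Ξ]
    (μ : ∀ i, FiniteLaw (Ω i)) (k : ∀ i, Ω i → FiniteLaw (Ω' i))
    (H : (∀ i, Ω i) → (∀ i, Ω' i) → FiniteLaw Ξ) :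
    ((pi fun i => (μ i).bind fun t => (k i t).bind fun b => pure (t, b)).bind fun y =>
      H (fun i => (y i).1) fun i => (y i).2)
      = (pi μ).bind fun τ => (pi fun i => k i (τ i)).bind fun z => H τ z := by
  rw [pi_bind]
  simp only [pi_map, bind_assoc, pure_bind]

end Product

/-- The uniform law on the two labels. -/
noncomputable def unif : FiniteLaw (Fin 2) where
  mass _ := 1 / 2
  nonneg _ := by norm_num
  sum_mass := by simp

theorem unif_mass (t : Fin 2) : unif.mass t = 1 / 2 := rfl

/-! ### The observation inside a vertex set, and the removal of one vertex -/

section Graph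

variable {n : ℕ}

/-- What is observed: the indicators of the edges `(u, w)` with `u < w`, and the revealed labels. -/
abbrev Obs (n : ℕ) := (Fin n × Fin n → Bool) × (Fin n → Option (Fin 2))

variable (p α β : unitInterval)

/-- The law of the indicator of the edge `e` given the labels `σ`. -/
noncomputable def edgeLaw (σ : Fin n → Fin 2) (e : Fin n × Fin n) : FiniteLaw Bool :=
  if e.1 < e.2 then bern (if σ e.1 = σ e.2 then α else β) else pure false

/-- The edges within `A`. -/
def maskEdges (A : Finset (Fin n)) (x : Fin n × Fin n → Bool) (e : Fin n × Fin n) : Bool :=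
  x e && decide (e.1 ∈ A ∧ e.2 ∈ A ∧ e.1 < e.2)

/-- The revealed labels within `A`. -/
def maskLabels (A : Finset (Fin n)) (o : Fin n → Option (Fin 2)) (u : Fin n) : Option (Fin 2) :=
  if u ∈ A then o u else none

/-- The restriction of an observation to `A`. -/
def maskObs (A : Finset (Fin n)) (y : Obs n) : Obs n := (maskEdges A y.1, maskLabels A y.2)

/-- The law of the observation within `A` given the labels. -/
noncomputable def obsLaw (A : Finset (Fin n)) (σ : Fin n → Fin 2) : FiniteLaw (Obs n) :=
  (pi (edgeLaw α β σ)).bind fun x => (pi fun u => reveal p (σ u)).bind fun o =>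
    pure (maskObs A (x, o))

/-- The observation within `A` when the labels of `F` are uniform and those of the other vertices
are given. -/
noncomputable def freshLaw (A F : Finset (Fin n)) (s : Fin n → Fin 2) : FiniteLaw (Obs n) :=
  (pi fun _ : Fin n => unif).bind fun τ => obsLaw p α β A fun w => if w ∈ F then τ w else s w

theorem maskObs_maskObs (A : Finset (Fin n)) (y : Obs n) : maskObs A (maskObs A y) = maskObs A y := by
  unfold maskObs
  congr 1
  · funext e
    simp only [maskEdges, Bool.and_assoc, Bool.and_self]
  · funext u
    simp only [maskLabels]
    split_ifs <;> rfl

theorem freshLaw_bind_maskObs {Ξ : Type*} [Fintype Ξ] (A F : Finset (Fin n)) (s : Fin n → Fin 2)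
    (g : Obs n → FiniteLaw Ξ) :
    ((freshLaw p α β A F s).bind fun y => g (maskObs A y)) = (freshLaw p α β A F s).bind g := by
  simp only [freshLaw, obsLaw, bind_assoc, pure_bind, maskObs_maskObs]

theorem obsLaw_congr (A : Finset (Fin n)) {σ σ' : Fin n → Fin 2} (h : ∀ u ∈ A, σ u = σ' u) :
    obsLaw p α β A σ = obsLaw p α β A σ' := by
  have key : ∀ σ, obsLaw p α β A σ = (pi fun e => (edgeLaw α β σ e).bind fun b =>
      pure (b && decide (e.1 ∈ A ∧ e.2 ∈ A ∧ e.1 < e.2))).bind fun x =>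
        (pi fun u => (reveal p (σ u)).bind fun o => pure (if u ∈ A then o else none)).bind fun o =>
          pure (x, o) := by
    intro σ
    rw [pi_map, pi_map]
    simp only [bind_assoc, pure_bind]
    rfl
  rw [key, key]
  have h1 : (fun e => (edgeLaw α β σ e).bind fun b =>
      pure (b && decide (e.1 ∈ A ∧ e.2 ∈ A ∧ e.1 < e.2))) = fun e => (edgeLaw α β σ' e).bind fun b =>
      pure (b && decide (e.1 ∈ A ∧ e.2 ∈ A ∧ e.1 < e.2)) := by
    funext e
    by_cases he : e.1 ∈ A ∧ e.2 ∈ A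
    · simp only [edgeLaw, h _ he.1, h _ he.2]
    · have : ¬ (e.1 ∈ A ∧ e.2 ∈ A ∧ e.1 < e.2) := fun h' => he ⟨h'.1, h'.2.1⟩
      simp [this]
  have h2 : (fun u => (reveal p (σ u)).bind fun o => pure (if u ∈ A then o else none))
      = fun u => (reveal p (σ' u)).bind fun o => pure (if u ∈ A then o else none) := by
    funext u
    by_cases hu : u ∈ A
    · simp only [h _ hu]
    · simp [hu]
  rw [h1, h2]

theorem freshLaw_congr (A F : Finset (Fin n)) {s s' : Fin n → Fin 2}
    (h : ∀ u ∈ A, u ∉ F → s u = s' u) : freshLaw p α β A F s = freshLaw p α β A F s' := by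
  unfold freshLaw
  congr 1
  funext τ
  refine obsLaw_congr p α β A fun u hu => ?_
  split_ifs with hF
  · rfl
  · exact h u hu hF

/-- The pair of `v` and `w` in increasing order. -/
def orderedPair (v w : Fin n) : Fin n × Fin n := if v < w then (v, w) else (w, v)

theorem orderedPair_injective (v : Fin n) : Function.Injective (orderedPair v) := by
  intro w w' h
  unfold orderedPair at h
  split_ifs at h <;> simp only [Prod.mk.injEq] at h
  · exact h.2
  · exact absurd h.2 (by rintro rfl; simp_all)
  · exact absurd h.2 (by rintro rfl; simp_all)
  · exact h.1

/-- Adding the vertex `v` with revealed label `o` and neighbours `C` to an observation. -/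
def addVertex (v : Fin n) (o : Option (Fin 2)) (C : Finset (Fin n)) (y : Obs n) : Obs n :=
  (fun e => if e.1 = v then decide (e.1 < e.2 ∧ e.2 ∈ C) else
    if e.2 = v then decide (e.1 < e.2 ∧ e.1 ∈ C) else y.1 e, Function.update y.2 v o)

theorem addVertex_orderedPair {v w : Fin n} (hw : w ≠ v) (o : Option (Fin 2)) (C : Finset (Fin n))
    (y : Obs n) : (addVertex v o C y).1 (orderedPair v w) = decide (w ∈ C) := by
  unfold addVertex orderedPair
  rcases lt_or_gt_of_ne hw with h | h
  · simp [not_lt.2 h.le, hw, h]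
  · simp [h]

theorem maskObs_addVertex {v : Fin n} {A : Finset (Fin n)} (hv : v ∉ A) (o : Option (Fin 2))
    (C : Finset (Fin n)) (y : Obs n) : maskObs A (addVertex v o C y) = maskObs A y := by
  unfold maskObs addVertex
  congr 1
  · funext e
    simp only [maskEdges]
    by_cases h1 : e.1 = v
    · simp [h1, hv]
    · by_cases h2 : e.2 = v
      · simp [h2, hv]
      · simp [h1, h2]
  · funext u
    simp only [maskLabels]
    by_cases h : u = v
    · simp [h, hv]
    · simp [Function.update_of_ne h]

theorem maskObs_eq_addVertex {v : Fin n} {A : Finset (Fin n)} (hv : v ∈ A)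
    (a b : Fin n × Fin n → Bool) (o : Fin n → Option (Fin 2)) :
    maskObs A (fun e => if e.1 = v ∨ e.2 = v then a e else b e, o)
      = addVertex v (o v) (Finset.univ.filter fun w =>
          (if w ∈ A.erase v then a (orderedPair v w) else false) = true)
          (maskObs (A.erase v) (b, Function.update o v none)) := by
  unfold maskObs addVertex
  congr 1
  · funext ⟨x, y⟩
    simp only [maskEdges, orderedPair, Finset.mem_erase, Finset.mem_filter, Finset.mem_univ,
      true_and]
    rcases lt_or_ge x y with hxy | hxy
    · by_cases hx : x = v
      · subst hx
        simp [hxy, hv, hxy.ne']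
        by_cases hy : y ∈ A <;> simp [hy]
      · by_cases hy : y = v
        · subst hy
          simp [hxy, hv, hxy.ne, not_lt.2 hxy.le]
          by_cases hy : x ∈ A <;> simp [hy]
        · simp [hx, hy]
    · simp [not_lt.2 hxy]
  · funext u
    by_cases h : u = v
    · simp [h, hv, maskLabels]
    · simp [h, maskLabels]

/-- The law of the indicators of the edges from `v` to the vertices of `A`. -/
noncomputable def starLaw (A : Finset (Fin n)) (t : Fin 2) (σ : Fin n → Fin 2) (w : Fin n) :
    FiniteLaw Bool :=
  if w ∈ A then bern (if t = σ w then α else β) else pure false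

/-- Given all labels, the data at `v`, the edges at `v` and the rest of the observation are
independent. -/
theorem obsLaw_eq_bind_addVertex {v : Fin n} {A : Finset (Fin n)} (hv : v ∈ A)
    (σ : Fin n → Fin 2) :
    obsLaw p α β A σ = (reveal p (σ v)).bind fun o =>
      (pi (starLaw α β (A.erase v) (σ v) σ)).bind fun z => (obsLaw p α β (A.erase v) σ).bind
        fun y => pure (addVertex v o (Finset.univ.filter fun w => z w = true) y) := by
  -- Two independent copies of the edge array: one used for the pairs containing `v`, the other for
  -- the remaining pairs.
  have h1 : pi (edgeLaw α β σ) = (pi (edgeLaw α β σ)).bind fun a => (pi (edgeLaw α β σ)).bind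
      fun b => pure fun e => if e.1 = v ∨ e.2 = v then a e else b e := by
    have := pi_ite (fun e : Fin n × Fin n => e.1 = v ∨ e.2 = v) (edgeLaw α β σ) (edgeLaw α β σ)
    simpa only [ite_self] using this
  have h2 : starLaw α β (A.erase v) (σ v) σ = fun w => (edgeLaw α β σ (orderedPair v w)).bind
      fun b => pure (if w ∈ A.erase v then b else false) := by
    funext w
    unfold starLaw
    by_cases hw : w ∈ A.erase v
    · have hwv := Finset.ne_of_mem_erase hw
      simp only [hw, if_true, bind_pure]
      unfold edgeLaw orderedPair
      rcases lt_or_gt_of_ne hwv with h | h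
      · simp [not_lt.2 h.le, h, eq_comm]
      · simp [h]
    · simp [hw]
  have h3 : pi (starLaw α β (A.erase v) (σ v) σ) = (pi (edgeLaw α β σ)).bind fun a =>
      pure fun w => if w ∈ A.erase v then a (orderedPair v w) else false := by
    rw [h2, pi_map, ← pi_comp_injective (orderedPair_injective v) (edgeLaw α β σ)]
    simp only [bind_assoc, pure_bind]
  conv_lhs => rw [obsLaw, h1]
  rw [h3]
  simp only [bind_assoc, pure_bind, maskObs_eq_addVertex hv]
  have h4 : ∀ b o, maskObs (A.erase v) (b, Function.update o v none) = maskObs (A.erase v) (b, o) := by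
    intro b o
    unfold maskObs
    congr 1
    funext u
    by_cases h : u = v
    · simp [h, maskLabels]
    · simp [h, maskLabels]
  have h5 : ∀ (C : Finset (Fin n)) b, ((pi fun u => reveal p (σ u)).bind fun o =>
      pure (addVertex v (o v) C (maskObs (A.erase v) (b, Function.update o v none))))
      = (reveal p (σ v)).bind fun y => (pi fun u => reveal p (σ u)).bind fun o =>
        pure (addVertex v y C (maskObs (A.erase v) (b, o))) := by
    intro C b
    rw [pi_bind_indep (fun u => reveal p (σ u)) v none fun y f =>
      pure (addVertex v y C (maskObs (A.erase v) (b, f)))]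
    simp only [h4]
  simp only [h5, obsLaw, bind_assoc, pure_bind]
  rw [bind_comm (reveal p (σ v))]
  congr 1
  funext a
  rw [bind_comm]

end Graph

theorem bind_congr {Ω Ω' : Type*} [Fintype Ω] [Fintype Ω'] (μ : FiniteLaw Ω)
    {g h : Ω → FiniteLaw Ω'} (H : ∀ x, g x = h x) : μ.bind g = μ.bind h := by
  rw [funext H]

/-! ### Exploring the neighbours of one vertex -/

section Explore

variable {n : ℕ} (p q c α β : unitInterval)

/-- The vertices of `F` selected by `e`. -/
def selected (F : Finset (Fin n)) (e : Fin n → Bool) : Finset (Fin n) := F.filter fun w => e w = true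

theorem mem_selected {F : Finset (Fin n)} {e : Fin n → Bool} {w : Fin n} :
    w ∈ selected F e ↔ w ∈ F ∧ e w = true := Finset.mem_filter

theorem selected_subset (F : Finset (Fin n)) (e : Fin n → Bool) : selected F e ⊆ F :=
  Finset.filter_subset _ _

/-- The law of the observation when the neighbours of `v` in `F` are selected independently of the
label of `v`, and then receive their labels through a symmetric channel. -/
noncomputable def exploreLaw (A F : Finset (Fin n)) (v : Fin n) (s : Fin n → Fin 2) :
    FiniteLaw (Obs n) :=
  (reveal p (s v)).bind fun o => (pi fun _ : Fin n => bern q).bind fun e =>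
    (pi fun _ : Fin n => symChannel c (s v)).bind fun lab =>
      (freshLaw p α β (A.erase v) (F \ selected F e)
        fun w => if w ∈ selected F e then lab w else s w).bind fun y =>
          pure (addVertex v o (selected F e) y)

/-- The joint law of the label of `w` and the indicator of its edge to a vertex with label `t`. -/
noncomputable def neighbourLaw (A F : Finset (Fin n)) (t : Fin 2) (s : Fin n → Fin 2) (w : Fin n) :
    FiniteLaw (Fin 2 × Bool) :=
  unif.bind fun l => (if w ∈ A then bern (if t = (if w ∈ F then l else s w) then α else β)
    else pure false).bind fun b => pure (l, b)

/-- The approximation of `neighbourLaw` in which the edge is sampled before the label. -/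
noncomputable def childLaw (F : Finset (Fin n)) (t : Fin 2) (w : Fin n) :
    FiniteLaw (Fin 2 × Bool) :=
  (bern q).bind fun e => (symChannel c t).bind fun l => unif.bind fun u =>
    pure (if w ∈ F ∧ e = true then l else u, decide (w ∈ F ∧ e = true))

/-- The rest of the observation, given the labels and the edges at `v`. -/
noncomputable def restLaw (A F : Finset (Fin n)) (v : Fin n) (s : Fin n → Fin 2)
    (o : Option (Fin 2)) (y : Fin n → Fin 2 × Bool) : FiniteLaw (Obs n) :=
  (obsLaw p α β (A.erase v) fun w => if w ∈ F then (y w).1 else s w).bind fun x =>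
    pure (addVertex v o (Finset.univ.filter fun w => (y w).2 = true) x)

/-- With `exploreLaw_eq_bind_restLaw`, both laws become the image under one kernel of a product over
the vertices `w`, so only `neighbourLaw` and `childLaw` have to be compared, one coordinate at a
time. -/
theorem freshLaw_eq_bind_restLaw {A F : Finset (Fin n)} {v : Fin n} (hv : v ∈ A) (hvF : v ∉ F)
    (s : Fin n → Fin 2) :
    freshLaw p α β A F s = (reveal p (s v)).bind fun o =>
      (pi (neighbourLaw α β (A.erase v) F (s v) s)).bind (restLaw p α β A F v s o) := by
  have h := fun o => pi_pair (fun _ : Fin n => unif)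
    (fun w l => if w ∈ A.erase v then bern (if s v = (if w ∈ F then l else s w) then α else β)
      else pure false)
    (fun τ z => (obsLaw p α β (A.erase v) fun w => if w ∈ F then τ w else s w).bind fun x =>
      pure (addVertex v o (Finset.univ.filter fun w => z w = true) x))
  have h' : ∀ o, (pi (neighbourLaw α β (A.erase v) F (s v) s)).bind (restLaw p α β A F v s o) = _ :=
    h
  simp only [h']
  rw [bind_comm, freshLaw]
  congr 1
  funext τ
  rw [obsLaw_eq_bind_addVertex p α β hv]
  simp only [hvF, if_false]
  rfl

theorem exploreLaw_eq_bind_restLaw (A F : Finset (Fin n)) (v : Fin n) (s : Fin n → Fin 2) :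
    exploreLaw p q c α β A F v s = (reveal p (s v)).bind fun o =>
      (pi (childLaw q c F (s v))).bind (restLaw p α β A F v s o) := by
  have h : pi (childLaw q c F (s v)) = (pi fun _ : Fin n => bern q).bind fun e =>
      (pi fun _ : Fin n => symChannel c (s v)).bind fun lab => (pi fun _ : Fin n => unif).bind
        fun τ => pure fun w => (if w ∈ F ∧ e w = true then lab w else τ w,
          decide (w ∈ F ∧ e w = true)) := by
    unfold childLaw
    rw [pi_bind]
    refine bind_congr _ fun e => ?_
    rw [pi_bind]
    refine bind_congr _ fun lab => ?_
    rw [pi_map]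
  rw [h, exploreLaw]
  simp only [bind_assoc, pure_bind]
  refine bind_congr _ fun o => bind_congr _ fun e => bind_congr _ fun lab => ?_
  rw [freshLaw, bind_assoc]
  refine bind_congr _ fun τ => ?_
  unfold restLaw
  have h1 : (fun w => if w ∈ F \ selected F e then τ w else
      if w ∈ selected F e then lab w else s w) = fun w => if w ∈ F then
        (if w ∈ F ∧ e w = true then lab w else τ w) else s w := by
    funext w
    by_cases hw : w ∈ F <;> by_cases he : e w = true <;> simp [mem_selected, hw, he]
  have h2 : selected F e = Finset.univ.filter fun w => decide (w ∈ F ∧ e w = true) = true := by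
    ext w
    simp [mem_selected]
  rw [h1, h2]

theorem neighbourLaw_mass (A F : Finset (Fin n)) (t : Fin 2) (s : Fin n → Fin 2) (w : Fin n)
    (x : Fin 2 × Bool) : (neighbourLaw α β A F t s w).mass x = 1 / 2 * (if w ∈ A then
      bern (if t = (if w ∈ F then x.1 else s w) then α else β) else pure false).mass x.2 := by
  classical
  obtain ⟨l, b⟩ := x
  rw [neighbourLaw, bind_mass, Finset.sum_eq_single l]
  · rw [unif_mass, bind_mass, Finset.sum_eq_single b]
    · simp [pure_mass]
    · intro b' _ hb
      simp [pure_mass, hb.symm]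
    · simp
  · intro l' _ hl
    rw [bind_mass, Finset.sum_eq_zero, mul_zero]
    intro b' _
    simp [pure_mass, hl.symm]
  · simp

theorem childLaw_mass_of_mem {F : Finset (Fin n)} {w : Fin n} (hw : w ∈ F) (t l : Fin 2) :
    (childLaw q c F t w).mass (l, true) = q * (symChannel c t).mass l
      ∧ (childLaw q c F t w).mass (l, false) = (1 - q) * (1 / 2) := by
  classical
  have h : ∀ e, ((symChannel c t).bind fun l => unif.bind fun u =>
      pure (if w ∈ F ∧ e = true then l else u, decide (w ∈ F ∧ e = true)))
      = if e = true then (symChannel c t).bind fun l => pure (l, true)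
        else unif.bind fun u => pure (u, false) := by
    intro e
    cases e <;> simp [hw]
  simp only [childLaw, h, bern_bind_mass]
  constructor <;> fin_cases l <;> simp [bind_mass, pure_mass, unif_mass]

theorem childLaw_of_notMem {F : Finset (Fin n)} {w : Fin n} (hw : w ∉ F) (t : Fin 2) :
    childLaw q c F t w = unif.bind fun l => pure (l, false) := by
  simp [childLaw, hw]

/-- Used at δ and at -δ: the linear terms cancel in the sum, and only the quadratic error remains.
-/
theorem le_sqrt_mul_self_add {m δ : ℝ} (hm : 3 / 4 ≤ m) (hδ : |δ| ≤ 1 / 4) :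
    m + δ / 2 - δ ^ 2 ≤ √((m + δ) * m) := by
  have h := abs_le.1 hδ
  refine Real.le_sqrt_of_sq_le ?_
  have e : (m + δ) * m - (m + δ / 2 - δ ^ 2) ^ 2 = δ ^ 2 * (2 * m - (δ - 1 / 2) ^ 2) := by ring
  have : 0 ≤ δ ^ 2 * (2 * m - (δ - 1 / 2) ^ 2) := by
    refine mul_nonneg (sq_nonneg δ) ?_
    nlinarith
  linarith

variable {p q c α β}

/-- On present edges the two laws agree exactly, since α/2 = qc and β/2 = q(1-c). On absent edges
their masses differ by ∓δ/2 for the two labels, where δ = q(2c-1), and the affinity sees this only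
to second order. -/
theorem one_sub_bc_le_of_mem {A F : Finset (Fin n)} {w : Fin n} (hw : w ∈ F) (hwA : w ∈ A)
    (hα : (α : ℝ) = 2 * q * c) (hβ : (β : ℝ) = 2 * q * (1 - c)) (hq : (q : ℝ) ≤ 1 / 4) (t : Fin 2)
    (s : Fin n → Fin 2) :
    1 - bc (neighbourLaw α β A F t s w) (childLaw q c F t w) ≤ q ^ 2 := by
  have hq0 := q.2.1
  have hc0 := c.2.1
  have hc1 := c.2.2
  set δ : ℝ := q * (2 * c - 1) with hδ
  have hδ1 : |δ| ≤ q := by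
    rw [hδ, abs_mul, abs_of_nonneg hq0]
    refine mul_le_of_le_one_right hq0 ?_
    rw [abs_le]
    constructor <;> linarith
  have hδ2 : δ ^ 2 ≤ q ^ 2 := by
    rw [← sq_abs δ]
    exact pow_le_pow_left₀ (abs_nonneg _) hδ1 2
  have a1 := le_sqrt_mul_self_add (m := 1 - q) (δ := δ) (by linarith) (hδ1.trans hq)
  have a2 := le_sqrt_mul_self_add (m := 1 - q) (δ := -δ) (by linarith)
    (by rw [abs_neg]; exact hδ1.trans hq)
  have key : bc (neighbourLaw α β A F t s w) (childLaw q c F t w)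
      = q + 1 / 2 * √((1 - q + -δ) * (1 - q)) + 1 / 2 * √((1 - q + δ) * (1 - q)) := by
    have hs : ∀ x : ℝ, 0 ≤ x → √(1 / 2 * (2 * x) * x) = x := by
      intro x hx
      rw [show 1 / 2 * (2 * x) * x = x ^ 2 by ring, Real.sqrt_sq hx]
    have hr : ∀ x y : ℝ, √(1 / 2 * x * (y * (1 / 2))) = 1 / 2 * √(x * y) := by
      intro x y
      rw [show 1 / 2 * x * (y * (1 / 2)) = (1 / 2) ^ 2 * (x * y) by ring,
        Real.sqrt_mul (by norm_num), Real.sqrt_sq (by norm_num)]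
    have eα : (1 - α : ℝ) = 1 - q + -δ := by rw [hα, hδ]; ring
    have eβ : (1 - β : ℝ) = 1 - q + δ := by rw [hβ, hδ]; ring
    have b1 : √(1 / 2 * (α : ℝ) * (q * c)) = q * c := by
      rw [hα, mul_assoc 2, hs _ (by positivity)]
    have b2 : √(1 / 2 * (β : ℝ) * (q * (1 - c))) = q * (1 - c) := by
      rw [hβ, mul_assoc 2, hs _ (mul_nonneg hq0 (by linarith))]
    have c0 : (symChannel c 0).mass 0 = c ∧ (symChannel c 0).mass 1 = 1 - c
        ∧ (symChannel c 1).mass 0 = 1 - c ∧ (symChannel c 1).mass 1 = c := by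
      classical
      simp [symChannel, bern_bind_mass, pure_mass]
    rw [bc]
    simp only [Fintype.sum_prod_type, Fintype.sum_bool, Fin.sum_univ_two, neighbourLaw_mass, hw,
      hwA, if_true, (childLaw_mass_of_mem q c hw t _).1, (childLaw_mass_of_mem q c hw t _).2]
    have h01 : ¬ (0 : Fin 2) = 1 := by decide
    have h10 : ¬ (1 : Fin 2) = 0 := by decide
    obtain rfl | rfl : t = 0 ∨ t = 1 := by
      fin_cases t <;> simp
    all_goals
      simp only [c0, h01, h10, bern_true, bern_false, if_true, if_false, hr, b1, b2, eα, eβ]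
      ring
  rw [key]
  have : (-δ) ^ 2 = δ ^ 2 := by ring
  linarith

/-- Here `w` already has a prescribed label, so an edge to it would close a cycle or join two trees.
The tree approximation omits this edge, at the price of its probability. -/
theorem one_sub_bc_le_of_notMem {A F : Finset (Fin n)} {w : Fin n} (hw : w ∉ F) (hwA : w ∈ A)
    (hα : (α : ℝ) ≤ 2 * q) (hβ : (β : ℝ) ≤ 2 * q) (t : Fin 2) (s : Fin n → Fin 2) :
    1 - bc (neighbourLaw α β A F t s w) (childLaw q c F t w) ≤ 2 * q := by
  classical
  set a : unitInterval := if t = s w then α else β with ha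
  have ha2 : (a : ℝ) ≤ 2 * q := by
    rw [ha]
    split_ifs
    · exact hα
    · exact hβ
  have ha0 : (0 : ℝ) ≤ 1 - a := by linarith [a.2.2]
  have hr : √(1 / 2 * (1 - a : ℝ) * (1 / 2)) = 1 / 2 * √(1 - a) := by
    rw [show 1 / 2 * (1 - a : ℝ) * (1 / 2) = (1 / 2) ^ 2 * (1 - a) by ring,
        Real.sqrt_mul (by norm_num), Real.sqrt_sq (by norm_num)]
  have key : bc (neighbourLaw α β A F t s w) (childLaw q c F t w) = √(1 - a) := by
    have e1 : ∀ l, (childLaw q c F t w).mass (l, true) = 0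
        ∧ (childLaw q c F t w).mass (l, false) = 1 / 2 := by
      intro l
      rw [childLaw_of_notMem q c hw]
      simp [bind_mass, pure_mass, unif_mass]
    rw [bc]
    simp only [Fintype.sum_prod_type, Fintype.sum_bool, Fin.sum_univ_two, neighbourLaw_mass, hw,
      hwA, if_true, if_false, (e1 _).1, (e1 _).2, ← ha, bern_false, hr, mul_zero, Real.sqrt_zero]
    ring
  have : 1 - (a : ℝ) ≤ √(1 - a) := Real.le_sqrt_of_sq_le (by nlinarith [a.2.1])
  rw [key]
  linarith

theorem one_sub_bc_eq_zero {A F : Finset (Fin n)} {w : Fin n} (hw : w ∉ F) (hwA : w ∉ A)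
    (t : Fin 2) (s : Fin n → Fin 2) :
    1 - bc (neighbourLaw α β A F t s w) (childLaw q c F t w) = 0 := by
  rw [childLaw_of_notMem q c hw]
  simp [neighbourLaw, hwA, bc_self]

theorem sqrt_natCast_le (k : ℕ) : √(k : ℝ) ≤ k := by
  rw [Real.sqrt_le_left (Nat.cast_nonneg k)]
  exact_mod_cast Nat.le_self_pow two_ne_zero k

/-- The exploration of one vertex costs little. -/
theorem tv_freshLaw_exploreLaw_le {A F : Finset (Fin n)} {v : Fin n} (hv : v ∈ A) (hvF : v ∉ F)
    (hFA : F ⊆ A) (hα : (α : ℝ) = 2 * q * c) (hβ : (β : ℝ) = 2 * q * (1 - c))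
    (hq : (q : ℝ) ≤ 1 / 4) {d : ℝ} (hd : 1 ≤ d) (hnd : n * (q : ℝ) ≤ d) (s : Fin n → Fin 2) :
    tv (freshLaw p α β A F s) (exploreLaw p q c α β A F v s) ≤ √(4 * d * q) * (A \ F).card := by
  have hq0 := q.2.1
  rw [freshLaw_eq_bind_restLaw p α β hv hvF, exploreLaw_eq_bind_restLaw]
  refine tv_bind_right_le _ _ _ fun o => (tv_bind_left _ _ _).trans ((tv_pi_le_sqrt _ _).trans ?_)
  -- Fresh vertices cost q² each, the other vertices with prescribed labels 2q each, and vertices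
  -- outside the set nothing. As nq ≤ d, the sum is at most 2dq times the number of prescribed
  -- vertices.
  have h1 : ∀ w, 1 - bc (neighbourLaw α β (A.erase v) F (s v) s w) (childLaw q c F (s v) w)
      ≤ q ^ 2 + if w ∈ (A \ F).erase v then 2 * (q : ℝ) else 0 := by
    intro w
    have hsq : (0 : ℝ) ≤ (q : ℝ) ^ 2 := sq_nonneg _
    by_cases hwF : w ∈ F
    · have hwv : w ≠ v := fun h => hvF (h ▸ hwF)
      have := one_sub_bc_le_of_mem hwF (Finset.mem_erase.2 ⟨hwv, hFA hwF⟩) hα hβ hq (s v) s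
      refine this.trans (le_add_of_nonneg_right ?_)
      split_ifs <;> positivity
    · by_cases hwA : w ∈ A.erase v
      · have hm : w ∈ (A \ F).erase v := by
          rw [Finset.mem_erase] at hwA ⊢
          exact ⟨hwA.1, Finset.mem_sdiff.2 ⟨hwA.2, hwF⟩⟩
        rw [if_pos hm]
        have := one_sub_bc_le_of_notMem (c := c) (α := α) (β := β) (q := q) hwF hwA
          (by rw [hα]; nlinarith [c.2.2]) (by rw [hβ]; nlinarith [c.2.1]) (s v) s
        linarith
      · rw [one_sub_bc_eq_zero hwF hwA]
        split_ifs <;> positivity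
  have hvm : v ∈ A \ F := Finset.mem_sdiff.2 ⟨hv, hvF⟩
  have h2 : ∑ w, (1 - bc (neighbourLaw α β (A.erase v) F (s v) s w) (childLaw q c F (s v) w))
      ≤ 2 * d * q * (A \ F).card := by
    refine (Finset.sum_le_sum fun w _ => h1 w).trans ?_
    rw [Finset.sum_add_distrib, Finset.sum_const, Finset.card_univ, Fintype.card_fin, nsmul_eq_mul,
      Finset.sum_ite_mem, Finset.univ_inter, Finset.sum_const, nsmul_eq_mul,
      Finset.card_erase_of_mem hvm, Nat.cast_sub (Finset.card_pos.2 ⟨v, hvm⟩), Nat.cast_one]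
    have h3 : (1 : ℝ) ≤ (A \ F).card := by exact_mod_cast Finset.card_pos.2 ⟨v, hvm⟩
    have h4 : (n * q ^ 2 : ℝ) ≤ d * q := by
      rw [sq, ← mul_assoc]
      exact mul_le_mul_of_nonneg_right hnd hq0
    have h5 : (0 : ℝ) ≤ ((A \ F).card - 1) * q := mul_nonneg (by linarith) hq0
    have h6 : (0 : ℝ) ≤ (d - 1) * (((A \ F).card - 1) * q) := mul_nonneg (by linarith) h5
    have h7 : (0 : ℝ) ≤ d * q := by positivity
    nlinarith
  calc √(2 * ∑ w, (1 - bc (neighbourLaw α β (A.erase v) F (s v) s w) (childLaw q c F (s v) w)))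
      ≤ √(4 * d * q * (A \ F).card) := Real.sqrt_le_sqrt (by linarith)
    _ = √(4 * d * q) * √((A \ F).card : ℝ) := Real.sqrt_mul (by positivity) _
    _ ≤ _ := mul_le_mul_of_nonneg_left (sqrt_natCast_le _) (Real.sqrt_nonneg _)

end Explore

/-! ### Independent trees at several roots -/

section Roots

variable {n : ℕ} {X : Type*} [Fintype X]

/-- Independent samples of the experiment `W` at the vertices of `T`. -/
noncomputable def rootLaw (W : Fin 2 → FiniteLaw X) (d : X) (T : Finset (Fin n))
    (s : Fin n → Fin 2) : FiniteLaw (Fin n → X) :=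
  pi fun w => if w ∈ T then W (s w) else pure d

variable (W : Fin 2 → FiniteLaw X) (d : X)

theorem rootLaw_empty (s : Fin n → Fin 2) : rootLaw W d ∅ s = pure fun _ => d := by
  simp [rootLaw]

theorem rootLaw_congr {T : Finset (Fin n)} {s s' : Fin n → Fin 2} (h : ∀ u ∈ T, s u = s' u) :
    rootLaw W d T s = rootLaw W d T s' := by
  unfold rootLaw
  congr 1
  funext w
  by_cases hw : w ∈ T
  · simp [hw, h w hw]
  · simp [hw]

theorem rootLaw_insert_bind {Ξ : Type*} [Fintype Ξ] {T : Finset (Fin n)} {v : Fin n} (hv : v ∉ T)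
    (s : Fin n → Fin 2) (h : X → (Fin n → X) → FiniteLaw Ξ) :
    ((rootLaw W d (insert v T) s).bind fun f => h (f v) (Function.update f v d))
      = (W (s v)).bind fun y => (rootLaw W d T s).bind (h y) := by
  rw [rootLaw, pi_bind_update]
  have h1 : Function.update (fun w => if w ∈ insert v T then W (s w) else pure d) v (pure d)
      = fun w => if w ∈ T then W (s w) else pure d := by
    funext w
    rcases eq_or_ne w v with rfl | hw
    · simp [hv]
    · simp [hw]
  rw [h1, if_pos (Finset.mem_insert_self v T)]
  rfl

theorem rootLaw_union {T C : Finset (Fin n)} (s lab : Fin n → Fin 2) :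
    rootLaw W d (T ∪ C) (fun w => if w ∈ C then lab w else s w)
      = (pi fun w => W (lab w)).bind fun x => (rootLaw W d T s).bind fun g =>
        pure fun w => if w ∈ C then x w else g w := by
  unfold rootLaw
  rw [← pi_ite (fun w => w ∈ C)]
  congr 1
  funext w
  by_cases hw : w ∈ C <;> simp [hw]

/-- Coordinates outside `T` already carry the default, so resetting them changes nothing. -/
theorem rootLaw_bind_ite {Ξ : Type*} [Fintype Ξ] {T C : Finset (Fin n)} (h : Disjoint T C)
    (s : Fin n → Fin 2) (k : (Fin n → X) → FiniteLaw Ξ) :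
    ((rootLaw W d T s).bind fun g => k fun w => if w ∈ C then d else g w)
      = (rootLaw W d T s).bind k := by
  have h1 : rootLaw W d T s = (rootLaw W d T s).bind fun g =>
      pure fun w => if w ∈ C then d else g w := by
    unfold rootLaw
    rw [← pi_map (g := fun w a => if w ∈ C then d else a)]
    congr 1
    funext w
    by_cases hw : w ∈ C
    · simp [Finset.disjoint_right.1 h hw]
    · simp [hw]
  conv_rhs => rw [h1]
  simp only [bind_assoc, pure_bind]

/-- Sampling the occupied slots of `F`, the labels of the children, and the data of the children. -/
theorem pi_slot_eq (q c : unitInterval) (F : Finset (Fin n)) (t : Fin 2) :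
    (pi fun w => if w ∈ F then slot q ((symChannel c t).bind W) else pure none)
      = (pi fun _ : Fin n => bern q).bind fun e => (pi fun _ : Fin n => symChannel c t).bind
        fun lab => (pi fun w => W (lab w)).bind fun x =>
          pure fun w => if w ∈ selected F e then some (x w) else none := by
  have h : (fun w => if w ∈ F then slot q ((symChannel c t).bind W) else pure none)
      = fun w => (bern q).bind fun e => (symChannel c t).bind fun l => (W l).bind fun x =>
        pure (if w ∈ F ∧ e = true then some x else none) := by
    funext w
    by_cases hw : w ∈ F
    · simp [hw, slot]
    · simp [hw]
  rw [h, pi_bind]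
  refine bind_congr _ fun e => ?_
  rw [pi_bind]
  refine bind_congr _ fun lab => ?_
  rw [pi_map]
  simp only [mem_selected]

end Roots

/-! ### Error bounds that survive averaging over the offspring -/

section Compare

variable {n : ℕ} {p q c α β : unitInterval}

/-- The growth rate of the error bound in the number of roots of depth `r`. -/
noncomputable def growth (d : ℝ) : ℕ → ℝ
  | 0 => 2
  | r + 1 => 4 * Real.exp (d * (growth d r - 1))

theorem two_le_growth {d : ℝ} (hd : 0 ≤ d) (r : ℕ) : 2 ≤ growth d r := by
  induction r with
  | zero => exact le_rfl
  | succ r ih =>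
    have : 1 ≤ Real.exp (d * (growth d r - 1)) := Real.one_le_exp (mul_nonneg hd (by linarith))
    rw [growth]
    linarith

/-- Generating function of a binomial number: each factor is at most 1 + q(W-1) ≤ exp(q(W-1)). -/
theorem expect_pow_selected_le {d W : ℝ} (hW : 1 ≤ W) (hnd : n * (q : ℝ) ≤ d)
    (F : Finset (Fin n)) :
    ((pi fun _ : Fin n => bern q).expect fun e => W ^ (selected F e).card)
      ≤ Real.exp (d * (W - 1)) := by
  have h1 : ∀ e : Fin n → Bool, W ^ (selected F e).card
      = ∏ w, if w ∈ F ∧ e w = true then W else 1 := by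
    intro e
    rw [← Finset.prod_filter, Finset.prod_const]
    congr 2
    ext w
    simp [mem_selected]
  simp only [h1]
  rw [expect_pi_prod (fun _ : Fin n => bern q) fun w b => if w ∈ F ∧ b = true then W else 1]
  have h2 : ∀ w, (bern q).expect (fun b => if w ∈ F ∧ b = true then W else 1)
      ≤ Real.exp (q * (W - 1)) := by
    intro w
    have h3 := Real.add_one_le_exp ((q : ℝ) * (W - 1))
    have h4 : 0 ≤ (q : ℝ) * (W - 1) := mul_nonneg q.2.1 (by linarith)
    by_cases hw : w ∈ F
    · simp [expect, hw]
      linarith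
    · simp [expect, hw]
      linarith
  refine (Finset.prod_le_prod (fun w _ => ?_) fun w _ => h2 w).trans ?_
  · refine Finset.sum_nonneg fun b _ => mul_nonneg ((bern q).nonneg b) ?_
    dsimp only
    split_ifs <;> linarith
  · rw [Finset.prod_const, Finset.card_univ, Fintype.card_fin, ← Real.exp_nat_mul]
    refine Real.exp_le_exp.2 ?_
    rw [← mul_assoc]
    exact mul_le_mul_of_nonneg_right hnd (by linarith)

/-- The average of the error bound over the neighbours of a root. -/
theorem expect_growth_le {d : ℝ} (hd : 0 ≤ d) (hnd : n * (q : ℝ) ≤ d) {F S' : Finset (Fin n)}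
    (h : Disjoint S' F) (k r : ℕ) :
    ((pi fun _ : Fin n => bern q).expect fun e => growth d (r + 1) ^ k
      * growth d r ^ (S' ∪ selected F e).card)
      ≤ 1 / 4 * (growth d (r + 1) ^ (k + 1) * growth d r ^ S'.card) := by
  have hg := two_le_growth hd r
  have hg' := two_le_growth hd (r + 1)
  have h1 : ∀ e : Fin n → Bool, growth d (r + 1) ^ k * growth d r ^ (S' ∪ selected F e).card
      = growth d (r + 1) ^ k * growth d r ^ S'.card * growth d r ^ (selected F e).card := by
    intro e
    rw [Finset.card_union_of_disjoint (h.mono_right (selected_subset F e)), pow_add, mul_assoc]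
  simp only [h1]
  rw [expect_mul_left]
  calc _ ≤ growth d (r + 1) ^ k * growth d r ^ S'.card * Real.exp (d * (growth d r - 1)) :=
        mul_le_mul_of_nonneg_left (expect_pow_selected_le (by linarith) hnd F) (by positivity)
    _ = 1 / 4 * (growth d (r + 1) ^ (k + 1) * growth d r ^ S'.card) := by
        rw [pow_succ (growth d (r + 1)) k]
        conv_rhs => rw [growth]
        rw [growth]
        ring

/-- The cost of one exploration is linear in the number of roots; bases of at least 2 absorb it into
the multiplicative bound. -/
theorem natCast_le_growth {d : ℝ} (hd : 0 ≤ d) (k l r r' : ℕ) :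
    ((k + l : ℕ) : ℝ) ≤ growth d r ^ k * growth d r' ^ l := by
  calc ((k + l : ℕ) : ℝ) ≤ (2 : ℝ) ^ (k + l) := by exact_mod_cast (Nat.lt_two_pow_self).le
    _ = 2 ^ k * 2 ^ l := pow_add _ _ _
    _ ≤ _ := mul_le_mul (pow_le_pow_left₀ (by norm_num) (two_le_growth hd r) k)
        (pow_le_pow_left₀ (by norm_num) (two_le_growth hd r') l) (by positivity)
        (pow_nonneg (by linarith [two_le_growth hd r]) k)

variable (p q c) in
/-- Decomposition of the tree data at the root `v` and at the other roots. -/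
theorem rootLaw_tree_bind {Ξ : Type*} [Fintype Ξ] (base : Fin 2 → FiniteLaw (Fin 2)) (r : ℕ)
    {S S' : Finset (Fin n)} {v : Fin n} (hv : v ∉ S) (s : Fin n → Fin 2)
    (G : Option (Fin 2) → (Fin n → Option (TreeData (Fin n) r)) →
      (Fin n → TreeData (Fin n) (r + 1)) → (Fin n → TreeData (Fin n) r) → FiniteLaw Ξ) :
    ((rootLaw (tree (Fin n) p q c base (r + 1)) (TreeData.dflt (Fin n) (r + 1)) (insert v S) s).bind
      fun f => (rootLaw (tree (Fin n) p q c base r) (TreeData.dflt (Fin n) r) S' s).bind fun g =>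
        G (f v).root (f v).children (Function.update f v (TreeData.dflt (Fin n) (r + 1))) g)
      = (reveal p (s v)).bind fun o =>
        (pi fun _ : Fin n => slot q ((symChannel c (s v)).bind (tree (Fin n) p q c base r))).bind
        fun h =>
        (rootLaw (tree (Fin n) p q c base (r + 1)) (TreeData.dflt (Fin n) (r + 1)) S s).bind fun f =>
        (rootLaw (tree (Fin n) p q c base r) (TreeData.dflt (Fin n) r) S' s).bind fun g =>
          G o h f g := by
  rw [rootLaw_insert_bind (tree (Fin n) p q c base (r + 1)) (TreeData.dflt (Fin n) (r + 1)) hv s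
    fun x f => (rootLaw (tree (Fin n) p q c base r) (TreeData.dflt (Fin n) r) S' s).bind fun g =>
        G x.root x.children f g]
  rw [tree]
  simp only [bind_assoc, pure_bind, TreeData.root_mk, TreeData.children_mk]

end Compare

/-! ### Simulating the observation from trees with visible leaves -/

section Upper

variable {n : ℕ} (p q c α β : unitInterval)

/-- The observation started from `S` and `S'` is approximated by a garbling of broadcasting trees
of depth `r + 1` at the vertices of `S` and of depth `r` at the vertices of `S'`, whose leaves
carry their labels. -/
def ExploredByTrees (d : ℝ) (r : ℕ) (S S' F : Finset (Fin n)) : Prop :=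
  ∃ Γ : (Fin n → TreeData (Fin n) (r + 1)) → (Fin n → TreeData (Fin n) r) → FiniteLaw (Obs n),
    ∀ s, tv (freshLaw p α β (S ∪ S' ∪ F) F s)
      ((rootLaw (tree (Fin n) p q c pure (r + 1)) (TreeData.dflt (Fin n) (r + 1)) S s).bind fun f =>
        (rootLaw (tree (Fin n) p q c pure r) (TreeData.dflt (Fin n) r) S' s).bind fun g => Γ f g)
      ≤ 2 * √(4 * d * q) * (growth d (r + 1) ^ S.card * growth d r ^ S'.card)

variable {p q c α β}

theorem erase_insert_union {S S' F C : Finset (Fin n)} {v : Fin n} (hv : v ∉ S) (hv' : v ∉ S')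
    (hvF : v ∉ F) (hC : C ⊆ F) :
    (insert v S ∪ S' ∪ F).erase v = S ∪ (S' ∪ C) ∪ (F \ C) := by
  ext w
  have := @hC w
  simp only [Finset.mem_erase, Finset.mem_union, Finset.mem_insert, Finset.mem_sdiff]
  rcases eq_or_ne w v with rfl | hw
  · tauto
  · tauto

theorem card_insert_union_sdiff {S S' F : Finset (Fin n)} {v : Fin n} (hv : v ∉ S)
    (hSF : Disjoint (insert v S) F) (hS'F : Disjoint S' F) (hSS' : Disjoint (insert v S) S') :
    ((insert v S ∪ S' ∪ F) \ F).card = S.card + 1 + S'.card := by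
  rw [Finset.union_sdiff_right, Finset.sdiff_eq_self_of_disjoint (Finset.disjoint_union_left.2
    ⟨hSF, hS'F⟩), Finset.card_union_of_disjoint hSS', Finset.card_insert_of_notMem hv]

/-- The root `v` is explored; its neighbours C in `F` become roots of depth r. Write ε for the
square root and X for the product of powers in the claim. The exploration costs at most εX, and the
induction hypothesis averaged over C costs at most 2ε·X/4, which leaves room below 2εX. -/
theorem ExploredByTrees.insert (hα : (α : ℝ) = 2 * q * c) (hβ : (β : ℝ) = 2 * q * (1 - c))
    (hq : (q : ℝ) ≤ 1 / 4) {d : ℝ} (hd : 1 ≤ d) (hnd : n * (q : ℝ) ≤ d) {r : ℕ}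
    {S S' F : Finset (Fin n)} {v : Fin n} (hv : v ∉ S) (hSS' : Disjoint (insert v S) S')
    (hSF : Disjoint (insert v S) F) (hS'F : Disjoint S' F)
    (ih : ∀ C ⊆ F, ExploredByTrees p q c α β d r S (S' ∪ C) (F \ C)) :
    ExploredByTrees p q c α β d r (insert v S) S' F := by
  have hd0 : 0 ≤ d := by linarith
  have hv' : v ∉ S' := Finset.disjoint_left.1 hSS' (Finset.mem_insert_self v S)
  have hvF : v ∉ F := Finset.disjoint_left.1 hSF (Finset.mem_insert_self v S)
  -- A kernel is supplied for every C, arbitrary unless C ⊆ F, so that one choice function serves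
  -- all neighbour sets.
  have key : ∀ C : Finset (Fin n), ∃ Γ : (Fin n → TreeData (Fin n) (r + 1)) →
      (Fin n → TreeData (Fin n) r) → FiniteLaw (Obs n), C ⊆ F →
      ∀ s, tv (freshLaw p α β (S ∪ (S' ∪ C) ∪ (F \ C)) (F \ C) s)
      ((rootLaw (tree (Fin n) p q c pure (r + 1)) (TreeData.dflt (Fin n) (r + 1)) S s).bind fun f =>
        (rootLaw (tree (Fin n) p q c pure r) (TreeData.dflt (Fin n) r) (S' ∪ C) s).bind fun g =>
          Γ f g)
      ≤ 2 * √(4 * d * q) * (growth d (r + 1) ^ S.card * growth d r ^ (S' ∪ C).card) := by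
    intro C
    by_cases hC : C ⊆ F
    · obtain ⟨Γ, hΓ⟩ := ih C hC
      exact ⟨Γ, fun _ => hΓ⟩
    · exact ⟨fun _ _ => pure (fun _ => false, fun _ => none), fun h => absurd h hC⟩
  choose Γ hΓ using key
  -- The occupied child slots of `v` lying in `F` are read as its neighbours, and their contents as
  -- trees at these vertices. Slots outside `F` are discarded, which costs nothing in this
  -- direction.
  let G : Option (Fin 2) → (Fin n → Option (TreeData (Fin n) r)) →
      (Fin n → TreeData (Fin n) (r + 1)) → (Fin n → TreeData (Fin n) r) → FiniteLaw (Obs n) :=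
    fun o h f g => (Γ (selected F fun w => (h w).isSome) f fun w =>
      if w ∈ selected F fun w => (h w).isSome then (h w).getD (TreeData.dflt (Fin n) r)
      else g w).bind fun y => pure (addVertex v o (selected F fun w => (h w).isSome) y)
  refine ⟨fun f g => G (f v).root (f v).children
    (Function.update f v (TreeData.dflt (Fin n) (r + 1))) g, fun s => ?_⟩
  rw [rootLaw_tree_bind p q c pure r hv s G]
  have h2 : ((reveal p (s v)).bind fun o =>
      (pi fun _ : Fin n => slot q ((symChannel c (s v)).bind (tree (Fin n) p q c pure r))).bind
      fun h =>
      (rootLaw (tree (Fin n) p q c pure (r + 1)) (TreeData.dflt (Fin n) (r + 1)) S s).bind fun f =>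
      (rootLaw (tree (Fin n) p q c pure r) (TreeData.dflt (Fin n) r) S' s).bind fun g => G o h f g)
      = (reveal p (s v)).bind fun o => (pi fun _ : Fin n => bern q).bind fun e =>
        (pi fun _ : Fin n => symChannel c (s v)).bind fun lab =>
        ((rootLaw (tree (Fin n) p q c pure (r + 1)) (TreeData.dflt (Fin n) (r + 1)) S
          fun w => if w ∈ selected F e then lab w else s w).bind fun f =>
        (rootLaw (tree (Fin n) p q c pure r) (TreeData.dflt (Fin n) r) (S' ∪ selected F e)
          fun w => if w ∈ selected F e then lab w else s w).bind fun g =>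
            Γ (selected F e) f g).bind fun y => pure (addVertex v o (selected F e) y) := by
    refine bind_congr _ fun o => ?_
    have h3 := pi_slot_eq (n := n) (tree (Fin n) p q c pure r) q c Finset.univ (s v)
    simp only [Finset.mem_univ, if_true] at h3
    rw [h3]
    simp only [bind_assoc, pure_bind]
    refine bind_congr _ fun e => bind_congr _ fun lab => ?_
    have h4 : rootLaw (tree (Fin n) p q c pure (r + 1)) (TreeData.dflt (Fin n) (r + 1)) S
        (fun w => if w ∈ selected F e then lab w else s w)
        = rootLaw (tree (Fin n) p q c pure (r + 1)) (TreeData.dflt (Fin n) (r + 1)) S s := by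
      refine rootLaw_congr _ _ fun u hu => if_neg fun hu' => ?_
      exact Finset.disjoint_left.1 hSF (Finset.mem_insert_of_mem hu) (selected_subset F e hu')
    rw [h4, rootLaw_union]
    simp only [bind_assoc, pure_bind]
    rw [bind_comm]
    refine bind_congr _ fun f => bind_congr _ fun x => bind_congr _ fun g => ?_
    have h5 : (selected F fun w => (if w ∈ selected Finset.univ e then some (x w) else none).isSome)
        = selected F e := by
      ext w
      by_cases he : e w = true <;> simp [mem_selected, he]
    simp only [G, h5]
    congr 2
    funext w
    by_cases hw : w ∈ selected F e
    · have : w ∈ selected Finset.univ e := mem_selected.2 ⟨Finset.mem_univ _, (mem_selected.1 hw).2⟩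
      simp [hw, this]
    · simp [hw]
  rw [h2]
  refine (tv_triangle _ (exploreLaw p q c α β (Insert.insert v S ∪ S' ∪ F) F v s) _).trans ?_
  have h3 := tv_freshLaw_exploreLaw_le (p := p) (A := Insert.insert v S ∪ S' ∪ F) (F := F) (v := v)
    (by simp) hvF Finset.subset_union_right hα hβ hq hd hnd s
  rw [card_insert_union_sdiff hv hSF hS'F hSS'] at h3
  have h4 := natCast_le_growth hd0 (S.card + 1) S'.card (r + 1) r
  have h5 := mul_le_mul_of_nonneg_left h4 (Real.sqrt_nonneg (4 * d * q))
  have h6 : tv (exploreLaw p q c α β (Insert.insert v S ∪ S' ∪ F) F v s) _ ≤ _ :=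
    tv_bind_right_le _ _ _ fun o => (tv_bind_right _ _ _).trans <| (expect_mono _ fun e =>
      tv_bind_right_le _ _ _ fun lab => (tv_bind_left _ _ _).trans <|
        (erase_insert_union hv hv' hvF (selected_subset F e)) ▸
          hΓ (selected F e) (selected_subset F e)
            fun w => if w ∈ selected F e then lab w else s w)
  refine (add_le_add h3 h6).trans ?_
  rw [expect_mul_left]
  have h7 := mul_le_mul_of_nonneg_left (expect_growth_le hd0 hnd hS'F S.card r)
    (mul_nonneg zero_le_two (Real.sqrt_nonneg (4 * d * q)))
  rw [Finset.card_insert_of_notMem hv]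
  have h8 : 0 ≤ √(4 * d * q) * (growth d (r + 1) ^ (S.card + 1) * growth d r ^ S'.card) := by
    have := two_le_growth hd0 r
    have := two_le_growth hd0 (r + 1)
    positivity
  linarith

/-- Induction on the depth, and at each depth on the roots `S` of the current generation. Once `S`
is exhausted, `S'` takes its place one level lower. -/
theorem exploredByTrees (hα : (α : ℝ) = 2 * q * c) (hβ : (β : ℝ) = 2 * q * (1 - c))
    (hq : (q : ℝ) ≤ 1 / 4) {d : ℝ} (hd : 1 ≤ d) (hnd : n * (q : ℝ) ≤ d) (r : ℕ) :
    ∀ S S' F : Finset (Fin n), Disjoint S S' → Disjoint S F → Disjoint S' F →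
      ExploredByTrees p q c α β d r S S' F := by
  have hd0 : 0 ≤ d := by linarith
  have step : ∀ r, (∀ S' F : Finset (Fin n), Disjoint S' F →
      ExploredByTrees p q c α β d r ∅ S' F) → ∀ S S' F : Finset (Fin n), Disjoint S S' →
      Disjoint S F → Disjoint S' F → ExploredByTrees p q c α β d r S S' F := by
    intro r h0 S
    induction S using Finset.induction_on with
    | empty => exact fun S' F _ _ h => h0 S' F h
    | insert v S hv ih =>
      intro S' F hSS' hSF hS'F
      refine ExploredByTrees.insert hα hβ hq hd hnd hv hSS' hSF hS'F fun C hC => ih _ _ ?_ ?_ ?_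
      · exact Finset.disjoint_union_right.2 ⟨hSS'.mono_left (Finset.subset_insert v S),
          hSF.mono (Finset.subset_insert v S) hC⟩
      · exact hSF.mono (Finset.subset_insert v S) Finset.sdiff_subset
      · exact Finset.disjoint_union_left.2 ⟨hS'F.mono_right Finset.sdiff_subset,
          Finset.disjoint_sdiff⟩
  induction r with
  | zero =>
    -- Trees of depth 0 show their labels, so the observation is simulated without error.
    refine step 0 fun S' F hS'F => ⟨fun _ g => freshLaw p α β (∅ ∪ S' ∪ F) F g, fun s => ?_⟩
    have h1 : rootLaw (tree (Fin n) p q c pure 0) (TreeData.dflt (Fin n) 0) S' s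
        = pure (Ω := Fin n → TreeData (Fin n) 0) (fun w => if w ∈ S' then s w else (0 : Fin 2)) := by
      unfold rootLaw
      rw [← pi_pure]
      congr 1
      funext w
      by_cases hw : w ∈ S'
      · simp only [hw, if_true]
        rfl
      · simp only [hw, if_false]
        rfl
    rw [rootLaw_empty, pure_bind, h1, pure_bind]
    rw [freshLaw_congr p α β (∅ ∪ S' ∪ F) F (s' := fun w => if w ∈ S' then s w else (0 : Fin 2))]
    · refine (tv_self _).trans_le ?_
      have := two_le_growth hd0 0
      have := two_le_growth hd0 1
      positivity
    · intro u hu huF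
      simp only [Finset.empty_union, Finset.mem_union] at hu
      simp [hu.resolve_right huF]
  | succ r ih =>
    refine step (r + 1) fun S' F hS'F => ?_
    obtain ⟨Γ, hΓ⟩ := ih S' ∅ F (Finset.disjoint_empty_right _) hS'F (Finset.disjoint_empty_left _)
    refine ⟨fun _ g => Γ g fun _ => TreeData.dflt (Fin n) r, fun s => ?_⟩
    have := hΓ s
    simp only [rootLaw_empty, pure_bind, Finset.union_empty, Finset.empty_union, Finset.card_empty,
      pow_zero, mul_one, one_mul] at this ⊢
    exact this

end Upper

/-! ### Recovering trees with blank leaves from the observation -/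

section Lower

variable {n : ℕ} (p q c α β : unitInterval)

/-- Broadcasting trees of depth `r + 1` at the vertices of `S` and of depth `r` at the vertices of
`S'`, whose leaves carry no information, are approximated by a garbling of the observation started
from `S` and `S'`. -/
def TreesRecovered (d : ℝ) (r : ℕ) (S S' F : Finset (Fin n)) : Prop :=
  ∃ Λ : Obs n → FiniteLaw ((Fin n → TreeData (Fin n) (r + 1)) × (Fin n → TreeData (Fin n) r)),
    ∀ s, tv ((freshLaw p α β (S ∪ S' ∪ F) F s).bind Λ)
      ((rootLaw (tree (Fin n) p q c (fun _ => pure 0) (r + 1)) (TreeData.dflt (Fin n) (r + 1)) S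
        s).bind fun f => (rootLaw (tree (Fin n) p q c (fun _ => pure 0) r)
          (TreeData.dflt (Fin n) r) S' s).bind fun g => pure (f, g))
      ≤ 4 * √(4 * d * q) * (n - (S ∪ S' ∪ F).card + 1)
        * (growth d (r + 1) ^ S.card * growth d r ^ S'.card)

variable {p q c α β}

theorem tv_slot_pure_none_le {X : Type*} [Fintype X] (μ : FiniteLaw X) :
    tv (slot q μ) (pure none) ≤ q := by
  have h : (pure none : FiniteLaw (Option X)) = slot 0 μ := by
    simp [slot, bern_zero]
  rw [h, slot, slot]
  refine (tv_bind_left _ _ _).trans ?_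
  rw [tv_bern]
  simp [abs_of_nonneg q.2.1]

theorem tv_pi_slot_restrict_le {X : Type*} [Fintype X] {d : ℝ} (hd : 1 ≤ d) (F : Finset (Fin n))
    (μ : FiniteLaw X) :
    tv (pi fun w => if w ∈ F then slot q μ else pure none) (pi fun _ : Fin n => slot q μ)
      ≤ √(4 * d * q) * (n - F.card) := by
  have hq : (q : ℝ) ≤ √(4 * d * q) := by
    refine Real.le_sqrt_of_sq_le ?_
    nlinarith [q.2.1, q.2.2, mul_nonneg q.2.1 (sub_nonneg.2 hd)]
  have h1 : ∀ w, tv (if w ∈ F then slot q μ else pure none) (slot q μ)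
      ≤ if w ∈ Fᶜ then √(4 * d * q) else 0 := by
    intro w
    by_cases hw : w ∈ F
    · simp [hw, tv_self]
    · simp only [hw, if_false, Finset.mem_compl, not_false_eq_true, if_true]
      rw [tv_comm]
      exact (tv_slot_pure_none_le μ).trans hq
  refine (tv_pi_le_sum _ _).trans ((Finset.sum_le_sum fun w _ => h1 w).trans_eq ?_)
  rw [Finset.sum_ite_mem, Finset.univ_inter, Finset.sum_const, nsmul_eq_mul, Finset.card_compl,
    Fintype.card_fin, Nat.cast_sub (by simpa using Finset.card_le_univ F), mul_comm]

/-- Slots outside `F` cannot be read off the graph and are left empty, although the tree fills each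
with probability q. Since used vertices leave the set, this loss grows along the induction, whence
the factor n - |A| + 1 in the bound. -/
theorem TreesRecovered.insert (hα : (α : ℝ) = 2 * q * c) (hβ : (β : ℝ) = 2 * q * (1 - c))
    (hq : (q : ℝ) ≤ 1 / 4) {d : ℝ} (hd : 1 ≤ d) (hnd : n * (q : ℝ) ≤ d) {r : ℕ}
    {S S' F : Finset (Fin n)} {v : Fin n} (hv : v ∉ S) (hSS' : Disjoint (insert v S) S')
    (hSF : Disjoint (insert v S) F) (hS'F : Disjoint S' F)
    (ih : ∀ C ⊆ F, TreesRecovered p q c α β d r S (S' ∪ C) (F \ C)) :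
    TreesRecovered p q c α β d r (insert v S) S' F := by
  have hd0 : 0 ≤ d := by linarith
  have hv' : v ∉ S' := Finset.disjoint_left.1 hSS' (Finset.mem_insert_self v S)
  have hvF : v ∉ F := Finset.disjoint_left.1 hSF (Finset.mem_insert_self v S)
  have hvA : v ∈ Insert.insert v S ∪ S' ∪ F := by simp
  set A := Insert.insert v S ∪ S' ∪ F with hA
  have key : ∀ C : Finset (Fin n), ∃ Λ : Obs n →
      FiniteLaw ((Fin n → TreeData (Fin n) (r + 1)) × (Fin n → TreeData (Fin n) r)), C ⊆ F →
      ∀ s, tv ((freshLaw p α β (A.erase v) (F \ C) s).bind Λ)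
      ((rootLaw (tree (Fin n) p q c (fun _ => pure 0) (r + 1)) (TreeData.dflt (Fin n) (r + 1)) S
        s).bind fun f => (rootLaw (tree (Fin n) p q c (fun _ => pure 0) r)
          (TreeData.dflt (Fin n) r) (S' ∪ C) s).bind fun g => pure (f, g))
      ≤ 4 * √(4 * d * q) * (n - (A.erase v).card + 1)
        * (growth d (r + 1) ^ S.card * growth d r ^ (S' ∪ C).card) := by
    intro C
    by_cases hC : C ⊆ F
    · obtain ⟨Λ, hΛ⟩ := ih C hC
      rw [hA, erase_insert_union hv hv' hvF hC]
      exact ⟨Λ, fun _ => hΛ⟩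
    · exact ⟨fun _ => pure (fun _ => TreeData.dflt _ _, fun _ => TreeData.dflt _ _),
        fun h => absurd h hC⟩
  choose Λ hΛ using key
  -- The trees recovered at the neighbours C are hung below `v`, and their own coordinates are reset
  -- to the default.
  let post : Option (Fin 2) → Finset (Fin n) →
      (Fin n → TreeData (Fin n) (r + 1)) × (Fin n → TreeData (Fin n) r) →
      FiniteLaw ((Fin n → TreeData (Fin n) (r + 1)) × (Fin n → TreeData (Fin n) r)) :=
    fun o C z => pure (Function.update z.1 v
      (TreeData.mk o fun w => if w ∈ C then some (z.2 w) else none),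
      fun w => if w ∈ C then TreeData.dflt (Fin n) r else z.2 w)
  -- Unlike in the tree, the neighbour set is visible in the observation; on the explored law it is
  -- exactly the selected set.
  let nbrs : Obs n → Finset (Fin n) := fun y => selected F fun w => y.1 (orderedPair v w)
  have hnbrs : ∀ o e y, nbrs (addVertex v o (selected F e) y) = selected F e := by
    intro o e y
    ext w
    by_cases hw : w ∈ F
    · simp [nbrs, mem_selected, hw, addVertex_orderedPair (fun h => hvF (h ▸ hw) : w ≠ v)]
    · simp [nbrs, mem_selected, hw]
  refine ⟨fun y => (Λ (nbrs y) (maskObs (A.erase v) y)).bind (post (y.2 v) (nbrs y)), fun s => ?_⟩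
  let G : Option (Fin 2) → (Fin n → Option (TreeData (Fin n) r)) →
      (Fin n → TreeData (Fin n) (r + 1)) → (Fin n → TreeData (Fin n) r) →
      FiniteLaw ((Fin n → TreeData (Fin n) (r + 1)) × (Fin n → TreeData (Fin n) r)) :=
    fun o h f g => pure (Function.update f v (TreeData.mk o h), g)
  have hG : ∀ (f : Fin n → TreeData (Fin n) (r + 1)) (g : Fin n → TreeData (Fin n) r),
      pure (f, g) = G (f v).root (f v).children
        (Function.update f v (TreeData.dflt (Fin n) (r + 1))) g := by
    intro f g
    have : TreeData.mk (f v).root (f v).children = f v := rfl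
    simp only [G, this, Function.update_idem, Function.update_eq_self]
  have h1 : ((rootLaw (tree (Fin n) p q c (fun _ => pure 0) (r + 1))
      (TreeData.dflt (Fin n) (r + 1)) (Insert.insert v S) s).bind fun f =>
      (rootLaw (tree (Fin n) p q c (fun _ => pure 0) r) (TreeData.dflt (Fin n) r) S' s).bind
        fun g => pure (f, g)) = (reveal p (s v)).bind fun o =>
        (pi fun _ : Fin n => slot q ((symChannel c (s v)).bind
          (tree (Fin n) p q c (fun _ => pure 0) r))).bind fun h =>
        (rootLaw (tree (Fin n) p q c (fun _ => pure 0) (r + 1))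
          (TreeData.dflt (Fin n) (r + 1)) S s).bind fun f =>
        (rootLaw (tree (Fin n) p q c (fun _ => pure 0) r) (TreeData.dflt (Fin n) r) S' s).bind
          fun g => G o h f g := by
    rw [← rootLaw_tree_bind p q c (fun _ => pure 0) r hv s G]
    exact bind_congr _ fun f => bind_congr _ fun g => hG f g
  rw [h1]
  have h2 : (exploreLaw p q c α β A F v s).bind
      (fun y => (Λ (nbrs y) (maskObs (A.erase v) y)).bind (post (y.2 v) (nbrs y)))
      = (reveal p (s v)).bind fun o => (pi fun _ : Fin n => bern q).bind fun e =>
        (pi fun _ : Fin n => symChannel c (s v)).bind fun lab =>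
          ((freshLaw p α β (A.erase v) (F \ selected F e)
            fun w => if w ∈ selected F e then lab w else s w).bind (Λ (selected F e))).bind
              (post o (selected F e)) := by
    rw [exploreLaw]
    simp only [bind_assoc, pure_bind]
    refine bind_congr _ fun o => bind_congr _ fun e => bind_congr _ fun lab => ?_
    rw [← freshLaw_bind_maskObs p α β (A.erase v) _ _
      fun y => (Λ (selected F e) y).bind (post o (selected F e))]
    refine bind_congr _ fun y => ?_
    rw [hnbrs, maskObs_addVertex (Finset.notMem_erase v A)]
    simp [addVertex]
  -- Intermediate law: the tree at `v` with all slots outside `F` kept empty.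
  obtain ⟨M, hM⟩ : ∃ M, M = ((reveal p (s v)).bind fun o => (pi fun w => if w ∈ F then slot q
      ((symChannel c (s v)).bind (tree (Fin n) p q c (fun _ => pure 0) r)) else pure none).bind
      fun h => (rootLaw (tree (Fin n) p q c (fun _ => pure 0) (r + 1))
          (TreeData.dflt (Fin n) (r + 1)) S s).bind fun f =>
        (rootLaw (tree (Fin n) p q c (fun _ => pure 0) r) (TreeData.dflt (Fin n) r) S' s).bind
          fun g => G o h f g) := ⟨_, rfl⟩
  have h3 : M
      = (reveal p (s v)).bind fun o => (pi fun _ : Fin n => bern q).bind fun e =>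
        (pi fun _ : Fin n => symChannel c (s v)).bind fun lab =>
        ((rootLaw (tree (Fin n) p q c (fun _ => pure 0) (r + 1)) (TreeData.dflt (Fin n) (r + 1)) S
          fun w => if w ∈ selected F e then lab w else s w).bind fun f =>
        (rootLaw (tree (Fin n) p q c (fun _ => pure 0) r) (TreeData.dflt (Fin n) r)
          (S' ∪ selected F e) fun w => if w ∈ selected F e then lab w else s w).bind fun g =>
            pure (f, g)).bind (post o (selected F e)) := by
    rw [hM]
    refine bind_congr _ fun o => ?_
    rw [pi_slot_eq]
    simp only [bind_assoc, pure_bind]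
    refine bind_congr _ fun e => bind_congr _ fun lab => ?_
    have h4 : rootLaw (tree (Fin n) p q c (fun _ => pure 0) (r + 1))
        (TreeData.dflt (Fin n) (r + 1)) S (fun w => if w ∈ selected F e then lab w else s w)
        = rootLaw (tree (Fin n) p q c (fun _ => pure 0) (r + 1))
        (TreeData.dflt (Fin n) (r + 1)) S s := by
      refine rootLaw_congr _ _ fun u hu => if_neg fun hu' => ?_
      exact Finset.disjoint_left.1 hSF (Finset.mem_insert_of_mem hu) (selected_subset F e hu')
    rw [h4, rootLaw_union]
    simp only [bind_assoc, pure_bind]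
    rw [bind_comm]
    refine bind_congr _ fun f => bind_congr _ fun x => ?_
    rw [← rootLaw_bind_ite _ _ (hS'F.mono_right (selected_subset F e))]
    refine bind_congr _ fun g => ?_
    simp only [G, post]
    congr 3
    · congr 1
      funext w
      split_ifs <;> rfl
    · funext w
      split_ifs <;> rfl
  have h4 := tv_freshLaw_exploreLaw_le (p := p) (A := A) (F := F) (v := v)
    hvA hvF Finset.subset_union_right hα hβ hq hd hnd s
  rw [hA, card_insert_union_sdiff hv hSF hS'F hSS', ← hA] at h4
  have h5 : tv ((exploreLaw p q c α β A F v s).bind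
      (fun y => (Λ (nbrs y) (maskObs (A.erase v) y)).bind (post (y.2 v) (nbrs y)))) M
      ≤ 4 * √(4 * d * q) * (n - (A.erase v).card + 1) * ((pi fun _ : Fin n => bern q).expect fun e =>
        growth d (r + 1) ^ S.card * growth d r ^ (S' ∪ selected F e).card) := by
    rw [h2, h3, ← expect_mul_left]
    exact tv_bind_right_le _ _ _ fun o => (tv_bind_right _ _ _).trans <| expect_mono _ fun e =>
      tv_bind_right_le _ _ _ fun lab => (tv_bind_left _ _ _).trans <|
        hΛ (selected F e) (selected_subset F e)
          fun w => if w ∈ selected F e then lab w else s w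
  have h6 := tv_bind_right_le (reveal p (s v)) _ _ fun o => (tv_bind_left _ _ fun h =>
      (rootLaw (tree (Fin n) p q c (fun _ => pure 0) (r + 1))
          (TreeData.dflt (Fin n) (r + 1)) S s).bind fun f =>
        (rootLaw (tree (Fin n) p q c (fun _ => pure 0) r) (TreeData.dflt (Fin n) r) S' s).bind
          fun g => G o h f g).trans
      (tv_pi_slot_restrict_le (q := q) hd F ((symChannel c (s v)).bind
        (tree (Fin n) p q c (fun _ => pure 0) r)))
  rw [← hM] at h6
  have h7 := (tv_bind_left _ _
    fun y => (Λ (nbrs y) (maskObs (A.erase v) y)).bind (post (y.2 v) (nbrs y))).trans h4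
  refine (tv_triangle _ _ _).trans ((add_le_add h7 ((tv_triangle _ _ _).trans
    (add_le_add h5 h6))).trans ?_)
  have hcard : (F.card : ℝ) = A.card - ((S.card + 1 + S'.card : ℕ) : ℝ) := by
    have := Finset.card_sdiff_add_card_eq_card (Finset.subset_union_right : F ⊆ A)
    rw [card_insert_union_sdiff hv hSF hS'F hSS', ← hA] at this
    rw [← this]
    push_cast
    ring
  have hcard' : ((A.erase v).card : ℝ) = A.card - 1 := by
    rw [Finset.card_erase_of_mem hvA, Nat.cast_sub (Finset.card_pos.2 ⟨v, hvA⟩), Nat.cast_one]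
  have hm : (0 : ℝ) ≤ n - A.card := by
    have : A.card ≤ n := by simpa using Finset.card_le_univ A
    rw [sub_nonneg]
    exact_mod_cast this
  have h8 := expect_growth_le hd0 hnd hS'F S.card r
  have h9 := natCast_le_growth hd0 (S.card + 1) S'.card (r + 1) r
  rw [Finset.card_insert_of_notMem hv, hcard, hcard']
  set X := growth d (r + 1) ^ (S.card + 1) * growth d r ^ S'.card
  set ε := √(4 * d * q)
  set m : ℝ := n - A.card
  have hε : 0 ≤ ε := Real.sqrt_nonneg _
  set k : ℝ := ((S.card + 1 + S'.card : ℕ) : ℝ) with hk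
  have hk1 : 1 ≤ k := by
    rw [hk]
    exact_mod_cast (by omega : 1 ≤ S.card + 1 + S'.card)
  have e1 : (n : ℝ) - (A.card - 1) + 1 = m + 2 := by ring
  have e2 : (n : ℝ) - (A.card - k) = m + k := by ring
  rw [e1, e2]
  have h10 := mul_le_mul_of_nonneg_left h8 (mul_nonneg (mul_nonneg (by norm_num : (0 : ℝ) ≤ 4) hε)
    (by linarith : 0 ≤ m + 2))
  -- With k ≤ X and X ≥ 1 the three costs (exploration, induction, missing slots) sum to at most
  -- ε((m+4)X + m), below 4ε(m+1)X.
  have h11 : ε * k + (4 * ε * (m + 2) * (1 / 4 * X) + ε * (m + k)) ≤ 4 * ε * (m + 1) * X := by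
    have h12 : k + ((m + 2) * X + (m + k)) ≤ 4 * (m + 1) * X := by
      nlinarith [mul_nonneg hm (by linarith : 0 ≤ X - 1)]
    nlinarith [mul_le_mul_of_nonneg_left h12 hε]
  linarith

/-- The same double induction as `exploredByTrees`. At depth 0 the leaves are blank, so a constant
recovers them. -/
theorem treesRecovered (hα : (α : ℝ) = 2 * q * c) (hβ : (β : ℝ) = 2 * q * (1 - c))
    (hq : (q : ℝ) ≤ 1 / 4) {d : ℝ} (hd : 1 ≤ d) (hnd : n * (q : ℝ) ≤ d) (r : ℕ) :
    ∀ S S' F : Finset (Fin n), Disjoint S S' → Disjoint S F → Disjoint S' F →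
      TreesRecovered p q c α β d r S S' F := by
  have hd0 : 0 ≤ d := by linarith
  have step : ∀ r, (∀ S' F : Finset (Fin n), Disjoint S' F →
      TreesRecovered p q c α β d r ∅ S' F) → ∀ S S' F : Finset (Fin n), Disjoint S S' →
      Disjoint S F → Disjoint S' F → TreesRecovered p q c α β d r S S' F := by
    intro r h0 S
    induction S using Finset.induction_on with
    | empty => exact fun S' F _ _ h => h0 S' F h
    | insert v S hv ih =>
      intro S' F hSS' hSF hS'F
      refine TreesRecovered.insert hα hβ hq hd hnd hv hSS' hSF hS'F fun C hC => ih _ _ ?_ ?_ ?_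
      · exact Finset.disjoint_union_right.2 ⟨hSS'.mono_left (Finset.subset_insert v S),
          hSF.mono (Finset.subset_insert v S) hC⟩
      · exact hSF.mono (Finset.subset_insert v S) Finset.sdiff_subset
      · exact Finset.disjoint_union_left.2 ⟨hS'F.mono_right Finset.sdiff_subset,
          Finset.disjoint_sdiff⟩
  induction r with
  | zero =>
    refine step 0 fun S' F hS'F => ⟨fun _ => pure (fun _ => TreeData.dflt (Fin n) 1,
      fun _ => TreeData.dflt (Fin n) 0), fun s => ?_⟩
    have h1 : rootLaw (tree (Fin n) p q c (fun _ => pure 0) 0) (TreeData.dflt (Fin n) 0) S' s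
        = pure fun _ => TreeData.dflt (Fin n) 0 := by
      unfold rootLaw
      rw [← pi_pure]
      congr 1
      funext w
      by_cases hw : w ∈ S'
      · simp only [hw, if_true]
        rfl
      · simp only [hw, if_false]
    rw [rootLaw_empty, pure_bind, h1, pure_bind, bind_const]
    refine (tv_self _).trans_le ?_
    have := two_le_growth hd0 0
    have := two_le_growth hd0 1
    have : ((∅ ∪ S' ∪ F : Finset (Fin n)).card : ℝ) ≤ n := by
      have : (∅ ∪ S' ∪ F : Finset (Fin n)).card ≤ n := by
        simpa using Finset.card_le_univ (∅ ∪ S' ∪ F : Finset (Fin n))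
      exact_mod_cast this
    have : (0 : ℝ) ≤ n - (∅ ∪ S' ∪ F : Finset (Fin n)).card + 1 := by linarith
    positivity
  | succ r ih =>
    refine step (r + 1) fun S' F hS'F => ?_
    obtain ⟨Λ, hΛ⟩ := ih S' ∅ F (Finset.disjoint_empty_right _) hS'F (Finset.disjoint_empty_left _)
    refine ⟨fun y => (Λ y).bind fun z => pure (Ω := (Fin n → TreeData (Fin n) (r + 1 + 1)) ×
      (Fin n → TreeData (Fin n) (r + 1))) (fun _ => TreeData.dflt (Fin n) (r + 1 + 1), z.1),
      fun s => ?_⟩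
    have h1 := (tv_bind_left _ _ fun z => pure (Ω := (Fin n → TreeData (Fin n) (r + 1 + 1)) ×
      (Fin n → TreeData (Fin n) (r + 1))) (fun _ => TreeData.dflt (Fin n) (r + 1 + 1), z.1)).trans (hΛ s)
    simp only [rootLaw_empty, pure_bind, bind_assoc, Finset.union_empty, Finset.empty_union,
      Finset.card_empty, pow_zero, mul_one, one_mul] at h1 ⊢
    exact h1

end Lower

/-! ### One vertex against the tree rooted at it -/

section Vertex

variable {n : ℕ} (p q c α β : unitInterval)

/-- The law of the observation given that the vertex `v` has label `i`. -/
noncomputable def vertexLaw (v : Fin n) (i : Fin 2) : FiniteLaw (Obs n) :=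
  freshLaw p α β Finset.univ (Finset.univ.erase v) fun _ => i

theorem rootLaw_singleton_bind {X Ξ : Type*} [Fintype X] [Fintype Ξ] (W : Fin 2 → FiniteLaw X)
    (d : X) (v : Fin n) (s : Fin n → Fin 2) (k : (Fin n → X) → FiniteLaw Ξ) :
    (rootLaw W d {v} s).bind k
      = (W (s v)).bind fun y => k (Function.update (fun _ => d) v y) := by
  have h := rootLaw_insert_bind W d (Finset.notMem_empty v) s fun y f => k (Function.update f v y)
  simp only [Function.update_idem, Function.update_eq_self, rootLaw_empty, pure_bind] at h
  exact h

variable {p q c α β}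

/-- The kernel that simulates the observation does not depend on the root label, so data processing
applies between two approximations. -/
theorem tv_vertexLaw_le (hα : (α : ℝ) = 2 * q * c) (hβ : (β : ℝ) = 2 * q * (1 - c))
    (hq : (q : ℝ) ≤ 1 / 4) {d : ℝ} (hd : 1 ≤ d) (hnd : n * (q : ℝ) ≤ d) (r : ℕ) (v : Fin n)
    (i j : Fin 2) :
    tv (vertexLaw p α β v i) (vertexLaw p α β v j)
      ≤ tv (tree (Fin n) p q c pure (r + 1) i) (tree (Fin n) p q c pure (r + 1) j)
        + 4 * √(4 * d * q) * growth d (r + 1) := by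
  obtain ⟨Γ, hΓ⟩ := exploredByTrees (p := p) hα hβ hq hd hnd r {v} ∅ (Finset.univ.erase v)
    (Finset.disjoint_empty_right _) (by simp) (Finset.disjoint_empty_left _)
  have hA : ({v} ∪ ∅ ∪ Finset.univ.erase v : Finset (Fin n)) = Finset.univ := by
    ext w
    simp
  simp only [hA, rootLaw_empty, pure_bind, rootLaw_singleton_bind, Finset.card_singleton, pow_one,
    Finset.card_empty, pow_zero, mul_one] at hΓ
  have h1 := hΓ fun _ => i
  have h2 := hΓ fun _ => j
  rw [tv_comm] at h2
  have h3 := tv_bind_left (tree (Fin n) p q c pure (r + 1) i) (tree (Fin n) p q c pure (r + 1) j)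
    fun y => Γ (Function.update (fun _ => TreeData.dflt (Fin n) (r + 1)) v y)
      fun _ => TreeData.dflt (Fin n) r
  have h4 := (tv_triangle _ _ _).trans (add_le_add h1 ((tv_triangle _ _ _).trans (add_le_add h3 h2)))
  rw [vertexLaw, vertexLaw]
  linarith

theorem tv_tree_le_tv_vertexLaw (hα : (α : ℝ) = 2 * q * c) (hβ : (β : ℝ) = 2 * q * (1 - c))
    (hq : (q : ℝ) ≤ 1 / 4) {d : ℝ} (hd : 1 ≤ d) (hnd : n * (q : ℝ) ≤ d) (r : ℕ) (v : Fin n)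
    (i j : Fin 2) :
    tv (tree (Fin n) p q c (fun _ => pure 0) (r + 1) i)
        (tree (Fin n) p q c (fun _ => pure 0) (r + 1) j)
      ≤ tv (vertexLaw p α β v i) (vertexLaw p α β v j) + 8 * √(4 * d * q) * growth d (r + 1) := by
  obtain ⟨Λ, hΛ⟩ := treesRecovered (p := p) hα hβ hq hd hnd r {v} ∅ (Finset.univ.erase v)
    (Finset.disjoint_empty_right _) (by simp) (Finset.disjoint_empty_left _)
  have hA : ({v} ∪ ∅ ∪ Finset.univ.erase v : Finset (Fin n)) = Finset.univ := by
    ext w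
    simp
  simp only [hA, rootLaw_empty, pure_bind, rootLaw_singleton_bind, Finset.card_singleton, pow_one,
    Finset.card_empty, pow_zero, mul_one, Finset.card_univ, Fintype.card_fin, sub_self,
    zero_add] at hΛ
  have h1 : ∀ i, tv (((vertexLaw p α β v i).bind Λ).bind fun z => pure (z.1 v))
      (tree (Fin n) p q c (fun _ => pure 0) (r + 1) i) ≤ 4 * √(4 * d * q) * growth d (r + 1) := by
    intro i
    have h := (tv_bind_left _ _ fun z => pure (z.1 v)).trans (hΛ fun _ => i)
    simp only [bind_assoc, pure_bind, Function.update_self, bind_pure] at h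
    simp only [bind_assoc]
    exact h
  have h2 := h1 j
  have h3 := h1 i
  rw [tv_comm] at h3
  have h4 := ((tv_bind_left _ _ fun z => pure (z.1 v)).trans
    (tv_bind_left (vertexLaw p α β v i) (vertexLaw p α β v j) Λ))
  have h5 := (tv_triangle _ _ _).trans (add_le_add h3 ((tv_triangle _ _ _).trans (add_le_add h4 h2)))
  linarith

end Vertex

end FiniteLaw

namespace LabeledSBM

open FiniteLaw

/-! ### The block model in terms of finite laws -/

section Observation

variable {n : ℕ}

open Classical in
/-- The observed data of an outcome. -/
noncomputable def Outcome.obs (ω : Outcome n 2) : Obs n :=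
  (fun e => decide (e.1 < e.2 ∧ ω.graph.Adj e.1 e.2),
    fun u => if u ∈ ω.revealed then some (ω.label u) else none)

theorem obs_eq_iff {ω ω' : Outcome n 2} : ω'.obs = ω.obs ↔ ω' ∈ sameObservation ω := by
  constructor
  · intro h
    have h1 : ∀ e : Fin n × Fin n, e.1 < e.2 → (ω'.graph.Adj e.1 e.2 ↔ ω.graph.Adj e.1 e.2) := by
      intro e he
      have := congrFun (congrArg Prod.fst h) e
      simpa [Outcome.obs, he] using this
    have h2 : ∀ u, (if u ∈ ω'.revealed then some (ω'.label u) else none)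
        = if u ∈ ω.revealed then some (ω.label u) else none :=
      fun u => congrFun (congrArg Prod.snd h) u
    refine ⟨?_, ?_, fun u hu => ?_⟩
    · ext u w
      rcases lt_trichotomy u w with huw | rfl | huw
      · exact h1 (u, w) huw
      · simp
      · rw [SimpleGraph.adj_comm, h1 (w, u) huw, SimpleGraph.adj_comm]
    · ext u
      have := h2 u
      by_cases hu : u ∈ ω.revealed <;> by_cases hu' : u ∈ ω'.revealed <;> simp_all
    · have := h2 u
      by_cases hu' : u ∈ ω'.revealed <;> simp_all
  · rintro ⟨h1, h2, h3⟩
    unfold Outcome.obs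
    rw [h1, h2]
    congr 1
    funext u
    split_ifs with hu
    · rw [h3 u hu]
    · rfl

variable {a b : ℝ} {p α β : unitInterval}

/-- Graphs embed in edge arrays, and arrays outside the image have mass zero because `edgeLaw` is
`false` off the pairs in increasing order. -/
theorem expect_pi_edgeLaw (hα : (α : ℝ) = a / n) (hβ : (β : ℝ) = b / n) (σ : Fin n → Fin 2)
    (f : (Fin n × Fin n → Bool) → ℝ) :
    (FiniteLaw.pi (edgeLaw α β σ)).expect f = ∑ G : SimpleGraph (Fin n), graphMass a b σ G
      * f (Outcome.obs ⟨G, σ, ∅⟩).1 := by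
  classical
  symm
  refine Fintype.sum_of_injective (fun G : SimpleGraph (Fin n) => (Outcome.obs ⟨G, σ, ∅⟩).1)
    ?_ _ _ ?_ ?_
  · intro G G' h
    have h' : Outcome.obs ⟨G, σ, ∅⟩ = Outcome.obs ⟨G', σ, ∅⟩ := by
      refine Prod.ext h ?_
      simp [Outcome.obs]
    exact (obs_eq_iff.1 h').1
  · intro x hx
    by_contra hne
    have hx' : ∀ e : Fin n × Fin n, ¬ e.1 < e.2 → x e = false := by
      intro e he
      by_contra hxe
      refine hne ?_
      rw [pi_mass, Finset.prod_eq_zero (Finset.mem_univ e), zero_mul]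
      simp [edgeLaw, he, pure_mass, hxe]
    refine hx ⟨SimpleGraph.fromRel fun u v => u < v ∧ x (u, v) = true, ?_⟩
    funext ⟨u, v⟩
    by_cases huv : u < v
    · simp [Outcome.obs, huv, huv.ne, not_lt.2 huv.le]
    · simp [Outcome.obs, huv, hx' (u, v) huv]
  · intro G
    congr 1
    rw [graphMass, pi_mass, Finset.prod_filter]
    refine Finset.prod_congr rfl fun e _ => ?_
    by_cases he : e.1 < e.2
    · by_cases hG : G.Adj e.1 e.2 <;> by_cases hσ : σ e.1 = σ e.2 <;>
        simp [edgeLaw, Outcome.obs, he, hG, hσ, edgeProb, hα, hβ]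
    · simp [edgeLaw, Outcome.obs, he, pure_mass]

theorem expect_pi_reveal (σ : Fin n → Fin 2) (f : (Fin n → Option (Fin 2)) → ℝ) :
    (FiniteLaw.pi fun u => reveal p (σ u)).expect f = ∑ R : Finset (Fin n), revealMass p R
      * f (Outcome.obs ⟨⊥, σ, R⟩).2 := by
  classical
  symm
  refine Fintype.sum_of_injective (fun R : Finset (Fin n) => (Outcome.obs ⟨⊥, σ, R⟩).2)
    ?_ _ _ ?_ ?_
  · intro R R' h
    have h' : Outcome.obs ⟨⊥, σ, R⟩ = Outcome.obs ⟨⊥, σ, R'⟩ := by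
      refine Prod.ext ?_ h
      simp [Outcome.obs]
    exact (obs_eq_iff.1 h').2.1
  · intro o ho
    by_contra hne
    have ho' : ∀ u t, o u = some t → t = σ u := by
      intro u t hu
      by_contra ht
      refine hne ?_
      rw [pi_mass, Finset.prod_eq_zero (Finset.mem_univ u), zero_mul]
      rw [hu, reveal_some, if_neg ht]
    refine ho ⟨Finset.univ.filter fun u => (o u).isSome, ?_⟩
    funext u
    rcases hu : o u with _ | t
    · simp [Outcome.obs, hu]
    · simp [Outcome.obs, hu, ho' u t hu]
  · intro R
    congr 1
    rw [revealMass, pi_mass]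
    refine Finset.prod_congr rfl fun u _ => ?_
    by_cases hu : u ∈ R
    · simp [Outcome.obs, hu, reveal_some]
    · simp [Outcome.obs, hu, reveal_none]

theorem expect_obsLaw (hα : (α : ℝ) = a / n) (hβ : (β : ℝ) = b / n) (σ : Fin n → Fin 2)
    (f : Obs n → ℝ) :
    (obsLaw p α β Finset.univ σ).expect f = ∑ G : SimpleGraph (Fin n), ∑ R : Finset (Fin n),
      graphMass a b σ G * revealMass p R * f (Outcome.obs ⟨G, σ, R⟩) := by
  rw [obsLaw, expect_bind, expect_pi_edgeLaw hα hβ]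
  refine Finset.sum_congr rfl fun G _ => ?_
  rw [expect_bind, expect_pi_reveal, Finset.mul_sum]
  refine Finset.sum_congr rfl fun R _ => ?_
  have h : maskObs Finset.univ ((Outcome.obs ⟨G, σ, ∅⟩).1, (Outcome.obs ⟨⊥, σ, R⟩).2)
      = Outcome.obs ⟨G, σ, R⟩ := by
    refine Prod.ext (funext fun e => ?_) (funext fun u => ?_)
    · by_cases he : e.1 < e.2 <;> simp [Outcome.obs, maskObs, maskEdges, he]
    · simp [Outcome.obs, maskObs, maskLabels]
  rw [expect_pure, mul_assoc, h]

/-- Averages over the outcomes in terms of the laws of the observation given the label of `v`. -/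
theorem sum_mass_mul (hα : (α : ℝ) = a / n) (hβ : (β : ℝ) = b / n) (v : Fin n)
    (f : Fin 2 → Obs n → ℝ) :
    ∑ ω : Outcome n 2, mass a b p ω * f (ω.label v) ω.obs
      = ∑ l, 1 / 2 * (vertexLaw p α β v l).expect (f l) := by
  classical
  have h1 : ∑ ω : Outcome n 2, mass a b p ω * f (ω.label v) ω.obs
      = ∑ σ : Fin n → Fin 2, (∏ _u : Fin n, 1 / ((2 : ℕ) : ℝ))
        * (obsLaw p α β Finset.univ σ).expect (f (σ v)) := by
    rw [← (outcomeEquiv n 2).symm.sum_comp, Fintype.sum_prod_type]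
    simp only [Fintype.sum_prod_type]
    rw [Finset.sum_comm]
    refine Finset.sum_congr rfl fun σ _ => ?_
    rw [expect_obsLaw hα hβ, Finset.mul_sum]
    refine Finset.sum_congr rfl fun G _ => ?_
    rw [Finset.mul_sum]
    refine Finset.sum_congr rfl fun R _ => ?_
    simp only [outcomeEquiv, Equiv.coe_fn_symm_mk, mass]
    ring
  -- The label of `v` is sampled first, the other labels independently of it.
  have h2 := pi_bind_indep (fun _ : Fin n => unif) v (0 : Fin 2) fun l σ =>
    (obsLaw p α β Finset.univ (Function.update σ v l)).bind fun y => pure (l, y)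
  simp only [Function.update_idem, Function.update_eq_self] at h2
  have h3 := congrArg (fun μ => μ.expect fun z => f z.1 z.2) h2
  simp only [expect_bind, expect_pure] at h3
  rw [h1]
  have h4 : ∀ l, (vertexLaw p α β v l).expect (f l) = (FiniteLaw.pi fun _ : Fin n => unif).expect
      fun σ => (obsLaw p α β Finset.univ (Function.update σ v l)).expect (f l) := by
    intro l
    rw [vertexLaw, freshLaw, expect_bind]
    have h5 : ∀ σ : Fin n → Fin 2, (fun w => if w ∈ Finset.univ.erase v then σ w else l)
        = Function.update σ v l := by
      intro σ
      funext w
      rcases eq_or_ne w v with rfl | hw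
      · simp
      · simp [hw]
    simp only [h5]
  simp only [h4]
  refine Eq.trans ?_ (h3.trans ?_)
  · simp [expect, pi_mass, unif_mass]
  · simp [expect, unif_mass]

end Observation

/-! ### The expected advantage as a total variation distance -/

section Advantage

variable {n : ℕ} {a b p : ℝ}

theorem real_law (h : ∀ ω : Outcome n 2, 0 ≤ mass a b p ω) (S : Set (Outcome n 2)) :
    (law n 2 a b p).real S = ∑ ω : Outcome n 2, mass a b p ω * S.indicator 1 ω := by
  rw [measureReal_def, law, Measure.finsetSum_apply, ENNReal.toReal_sum]
  · refine Finset.sum_congr rfl fun ω _ => ?_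
    by_cases hω : ω ∈ S <;> simp [hω, h ω]
  · intro ω _
    by_cases hω : ω ∈ S <;> simp [hω]

theorem integral_law (h : ∀ ω : Outcome n 2, 0 ≤ mass a b p ω) (f : Outcome n 2 → ℝ) :
    ∫ ω, f ω ∂(law n 2 a b p) = ∑ ω : Outcome n 2, mass a b p ω * f ω := by
  rw [law, integral_finsetSum_measure]
  · refine Finset.sum_congr rfl fun ω _ => ?_
    rw [integral_smul_measure, integral_dirac, ENNReal.toReal_ofReal (h ω), smul_eq_mul]
  · intro ω _
    exact (integrable_dirac (by simp)).smul_measure ENNReal.ofReal_ne_top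

theorem sum_add_mul_abs_sub {μ ν : ℝ} (hμ : 0 ≤ μ) (hν : 0 ≤ ν) :
    1 / 2 * (μ + ν) * |(1 / 2 * (μ + ν))⁻¹ * (1 / 2 * μ) - 1 / 2| = 1 / 4 * |μ - ν| := by
  rcases (add_nonneg hμ hν).eq_or_lt with h | h
  · have h1 : μ = 0 := by linarith
    have h2 : ν = 0 := by linarith
    simp [h1, h2]
  · have h' : μ + ν ≠ 0 := h.ne'
    have e : (1 / 2 * (μ + ν))⁻¹ * (1 / 2 * μ) - 1 / 2 = (1 / 2 * (μ + ν))⁻¹ * (1 / 4 * (μ - ν)) := by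
      field_simp
      ring
    rw [e, abs_mul, abs_of_pos (by positivity : 0 < (1 / 2 * (μ + ν))⁻¹), ← mul_assoc,
      mul_inv_cancel₀ (by positivity), one_mul, abs_mul, abs_of_pos (by norm_num : (0 : ℝ) < 1 / 4)]

end Advantage

/-- Bayes' rule with uniform prior: an observation with masses μ, ν under the two labels has
probability (μ+ν)/2 and contributes |μ-ν|/4. Fibres of the observation are the conditioning events.
-/
theorem expectedAdvantage_eq {n : ℕ} {a b : ℝ} {p α β : unitInterval} (ha : 0 ≤ a) (han : a ≤ n)
    (hb : 0 ≤ b) (hbn : b ≤ n) (hα : (α : ℝ) = a / n) (hβ : (β : ℝ) = b / n) (v : Fin n)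
    (i : Fin 2) :
    expectedAdvantage n 2 a b p v i
      = 1 / 2 * tv (vertexLaw p α β v i) (vertexLaw p α β v i.rev) := by
  classical
  have hm : ∀ ω : Outcome n 2, 0 ≤ mass a b p ω :=
    fun ω => mass_nonneg ha han hb hbn p.2.1 p.2.2 ω
  have hsum : ∀ g : Fin 2 → ℝ, ∑ l, g l = g i + g i.rev := by
    intro g
    rw [Fin.sum_univ_two]
    fin_cases i
    · rfl
    · exact add_comm _ _
  have hne : i.rev ≠ i := by
    fin_cases i <;> decide
  have h1 : ∀ ω : Outcome n 2, (law n 2 a b p).real (sameObservation ω)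
      = 1 / 2 * ((vertexLaw p α β v i).mass ω.obs + (vertexLaw p α β v i.rev).mass ω.obs) := by
    intro ω
    have h := sum_mass_mul (p := p) hα hβ v fun _ y => if y = ω.obs then 1 else 0
    rw [real_law hm]
    refine Eq.trans (Finset.sum_congr rfl fun ω' _ => ?_) (h.trans ?_)
    · simp [Set.indicator_apply, obs_eq_iff]
    · rw [hsum]
      simp [expect]
      ring
  have h2 : ∀ ω : Outcome n 2, (law n 2 a b p).real (sameObservation ω ∩ {ω' | ω'.label v = i})
      = 1 / 2 * (vertexLaw p α β v i).mass ω.obs := by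
    intro ω
    have h := sum_mass_mul (p := p) hα hβ v fun l y => if y = ω.obs ∧ l = i then 1 else 0
    rw [real_law hm]
    refine Eq.trans (Finset.sum_congr rfl fun ω' _ => ?_) (h.trans ?_)
    · simp [Set.indicator_apply, obs_eq_iff]
    · rw [hsum]
      simp [expect, hne]
  have h3 : ∀ ω : Outcome n 2, posterior a b p v i ω
      = (1 / 2 * ((vertexLaw p α β v i).mass ω.obs + (vertexLaw p α β v i.rev).mass ω.obs))⁻¹
        * (1 / 2 * (vertexLaw p α β v i).mass ω.obs) := by
    intro ω
    rw [← h1, ← h2, posterior, measureReal_def, cond_apply (MeasurableSet.of_discrete),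
      ENNReal.toReal_mul, ENNReal.toReal_inv]
    rfl
  rw [expectedAdvantage, integral_law hm]
  simp only [h3]
  have h := sum_mass_mul (p := p) hα hβ v fun _ y =>
    |(1 / 2 * ((vertexLaw p α β v i).mass y + (vertexLaw p α β v i.rev).mass y))⁻¹
        * (1 / 2 * (vertexLaw p α β v i).mass y) - 1 / ((2 : ℕ) : ℝ)|
  rw [h, hsum, tv, ← mul_add, expect, expect, ← Finset.sum_add_distrib, Finset.mul_sum,
    Finset.mul_sum, Finset.mul_sum]
  refine Finset.sum_congr rfl fun y _ => ?_
  have := sum_add_mul_abs_sub ((vertexLaw p α β v i).nonneg y) ((vertexLaw p α β v i.rev).nonneg y)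
  rw [← add_mul, ← mul_assoc, Nat.cast_ofNat, this]
  ring

end LabeledSBM

/-! ### Quantitative coarsening from N to M slots -/

namespace FiniteLaw

/-- With x = ⌊N/M⌋ q the block probability lies between x - x² and x, while x lies between d/M - d/N
and d/M. The condition N ≥ M² makes the rounding error d/N harmless even after multiplication by M.
-/
theorem mul_abs_blockProb_sub_le {d : ℝ} (hd : 0 < d) {M N : ℕ} (hM : d ≤ M) (hN : M * M ≤ N)
    {q q' : unitInterval} (hq : (q : ℝ) = d / N) (hq' : (q' : ℝ) = d / M) :
    M * |(blockProb q (N / M) : ℝ) - q'| ≤ (d + d ^ 2) / M := by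
  have hM0 : (0 : ℝ) < M := hd.trans_le hM
  have hMN : (M * M : ℝ) ≤ N := by exact_mod_cast hN
  have hN0 : (0 : ℝ) < N := (mul_pos hM0 hM0).trans_le hMN
  set s : ℝ := ((N / M : ℕ) : ℝ) with hs
  have hs0 : 0 ≤ s := Nat.cast_nonneg _
  have hs1 : s * M ≤ N := by
    rw [hs]
    exact_mod_cast Nat.div_mul_le_self N M
  have hs2 : N ≤ s * M + M := by
    have h : N < N / M * M + M := Nat.lt_div_mul_add (by exact_mod_cast hM0)
    rw [hs]
    exact_mod_cast h.le
  set x : ℝ := s * q with hx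
  have hx0 : 0 ≤ x := mul_nonneg hs0 q.2.1
  have hx1 : x ≤ d / M := by
    rw [hx, hq, ← mul_div_assoc, div_le_div_iff₀ hN0 hM0]
    nlinarith
  have hx2 : d / M - d / N ≤ x := by
    rw [hx, hq, ← mul_div_assoc, div_sub_div _ _ hM0.ne' hN0.ne', div_le_div_iff₀
      (mul_pos hM0 hN0) hN0]
    nlinarith [mul_le_mul_of_nonneg_left hs2 (mul_nonneg hd.le hN0.le)]
  have hdM : d / M ≤ 1 := div_le_one_of_le₀ hM hM0.le
  have h1 : 1 - x ≤ (1 - (q : ℝ)) ^ (N / M) := by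
    have := one_add_mul_le_pow (by linarith [q.2.2] : (-2 : ℝ) ≤ -q) (N / M)
    rw [← sub_eq_add_neg] at this
    linarith
  have h2 : (1 - (q : ℝ)) ^ (N / M) ≤ 1 - x + x ^ 2 := by
    have h3 : (1 - (q : ℝ)) ^ (N / M) ≤ Real.exp (-x) := by
      calc (1 - (q : ℝ)) ^ (N / M) ≤ Real.exp (-q) ^ (N / M) :=
            pow_le_pow_left₀ (by linarith [q.2.2]) (Real.one_sub_le_exp_neg _) _
        _ = Real.exp (-x) := by
            rw [← Real.exp_nat_mul]
            congr 1
            rw [hx]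
            ring
    have h4 := (abs_le.1 (Real.abs_exp_sub_one_sub_id_le (x := -x)
      (by rw [abs_neg, abs_of_nonneg hx0]; linarith))).2
    rw [neg_sq] at h4
    linarith
  have h5 : |(blockProb q (N / M) : ℝ) - q'| ≤ d / N + (d / M) ^ 2 := by
    have h6 : x ^ 2 ≤ (d / M) ^ 2 := pow_le_pow_left₀ hx0 hx1 2
    have h7 : 0 ≤ d / N := by positivity
    rw [coe_blockProb, hq', abs_le]
    constructor <;> nlinarith
  have h8 : d / N ≤ d / (M * M) := div_le_div_of_nonneg_left hd.le (mul_pos hM0 hM0) hMN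
  calc M * |(blockProb q (N / M) : ℝ) - q'| ≤ M * (d / (M * M) + (d / M) ^ 2) :=
        mul_le_mul_of_nonneg_left (h5.trans (by linarith)) hM0.le
    _ = (d + d ^ 2) / M := by
        field_simp

theorem tv_tree_le_tv_tree_add {p c : unitInterval} (base : Fin 2 → FiniteLaw (Fin 2)) {d : ℝ}
    (hd : 0 < d) {M N : ℕ} (hM : d ≤ M) (hN : M * M ≤ N) {q q' : unitInterval}
    (hq : (q : ℝ) = d / N) (hq' : (q' : ℝ) = d / M) (r : ℕ) (i j : Fin 2) :
    tv (tree (Fin M) p q' c base r i) (tree (Fin M) p q' c base r j)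
      ≤ tv (tree (Fin N) p q c base r i) (tree (Fin N) p q c base r j)
        + 2 * ((d + d ^ 2) / M * (2 + d) ^ r) := by
  have hM0 : (0 : ℝ) < M := hd.trans_le hM
  -- M blocks of ⌊N/M⌋ slots each; the leftover slots are ignored.
  have he : Function.Injective fun z : Fin M × Fin (N / M) =>
      Fin.castLE (Nat.mul_div_le N M) (finProdFinEquiv z) :=
    (Fin.castLE_injective _).comp finProdFinEquiv.injective
  obtain ⟨g, hg⟩ := exists_tree_coarsening p q q' c base he r
  rw [Fintype.card_fin, hq', mul_div_cancel₀ _ hM0.ne', ← hq'] at hg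
  have h0 := (coarsenError_le hd.le (by positivity :
    0 ≤ (M : ℝ) * |(blockProb q (N / M) : ℝ) - q'|) r).trans
    (mul_le_mul_of_nonneg_right (mul_abs_blockProb_sub_le hd hM hN hq hq') (by positivity))
  have h1 := (hg i).trans h0
  have h2 := (hg j).trans h0
  rw [tv_comm] at h1
  have h3 := tv_bind_left (tree (Fin N) p q c base r i) (tree (Fin N) p q c base r j) g
  have h4 := (tv_triangle _ _ _).trans (add_le_add h1 ((tv_triangle _ _ _).trans (add_le_add h3 h2)))
  linarith

end FiniteLaw

/-- A bounded sequence that is eventually almost increasing converges. -/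
theorem exists_tendsto_of_eventually_le_add {u : ℕ → ℝ} {A B : ℝ} (hA : ∀ n, A ≤ u n)
    (hB : ∀ n, u n ≤ B) (h : ∀ ε > 0, ∀ᶠ m in atTop, ∀ᶠ n in atTop, u m ≤ u n + ε) :
    ∃ L, Tendsto u atTop (𝓝 L) := by
  have hb : atTop.IsBoundedUnder (· ≤ ·) u := isBoundedUnder_of ⟨B, hB⟩
  have hb' : atTop.IsBoundedUnder (· ≥ ·) u := isBoundedUnder_of ⟨A, hA⟩
  refine ⟨limsup u atTop, tendsto_of_le_liminf_of_limsup_le ?_ le_rfl hb hb'⟩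
  refine le_of_forall_pos_le_add fun ε hε => ?_
  refine limsup_le_of_le hb'.isCoboundedUnder_flip ((h ε hε).mono fun m hm => ?_)
  have : u m - ε ≤ liminf u atTop :=
    le_liminf_of_le hb.isCoboundedUnder_flip (hm.mono fun n hn => by linarith)
  linarith

/-! ### Sandwiching the advantage, and convergence -/

namespace LabeledSBM

open FiniteLaw

/-- The projection of `x` to the unit interval. -/
noncomputable def toUnit (x : ℝ) : unitInterval := Set.projIcc 0 1 zero_le_one x

theorem coe_toUnit {x : ℝ} (h0 : 0 ≤ x) (h1 : x ≤ 1) : (toUnit x : ℝ) = x := by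
  rw [toUnit, Set.projIcc_of_mem _ ⟨h0, h1⟩]

variable {a b : ℝ}

theorem coe_toUnit_div {x : ℝ} (h0 : 0 ≤ x) {N : ℕ} (h1 : x ≤ N) : (toUnit (x / N) : ℝ) = x / N :=
  coe_toUnit (div_nonneg h0 N.cast_nonneg) (div_le_one_of_le₀ h1 N.cast_nonneg)

theorem coe_toUnit_div_add (ha : 0 < a) (hb : 0 < b) : (toUnit (a / (a + b)) : ℝ) = a / (a + b) :=
  coe_toUnit (by positivity) (div_le_one_of_le₀ (by linarith) (by positivity))

/-- The error of the approximation of the neighbourhood of radius `r + 1` by a tree. -/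
noncomputable def treeError (a b : ℝ) (N r : ℕ) : ℝ :=
  8 * √(4 * ((a + b) / 2) * ((a + b) / 2 / N)) * growth ((a + b) / 2) (r + 1)

theorem tendsto_treeError (a b : ℝ) (r : ℕ) :
    Tendsto (fun n : ℕ => treeError a b (n + 1) r) atTop (𝓝 0) := by
  have h1 : Tendsto (fun n : ℕ => (a + b) / 2 / ((n + 1 : ℕ) : ℝ)) atTop (𝓝 0) :=
    (tendsto_const_div_atTop_nhds_zero_nat _).comp (tendsto_add_atTop_nat 1)
  have h2 : Tendsto (fun n : ℕ => √(4 * ((a + b) / 2) * ((a + b) / 2 / ((n + 1 : ℕ) : ℝ)))) atTop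
      (𝓝 0) := by
    have := (Real.continuous_sqrt.tendsto _).comp (h1.const_mul (4 * ((a + b) / 2)))
    rw [mul_zero, Real.sqrt_zero] at this
    exact this
  have h3 := (h2.const_mul 8).mul_const (growth ((a + b) / 2) (r + 1))
  rw [mul_zero, zero_mul] at h3
  exact h3

/-- The total variation distance between the trees with the two root labels that approximate the
neighbourhoods in the block model on `N` vertices. -/
noncomputable def treeTV (a b : ℝ) (p : unitInterval) (base : Fin 2 → FiniteLaw (Fin 2))
    (N r : ℕ) : ℝ :=
  tv (tree (Fin N) p (toUnit ((a + b) / 2 / N)) (toUnit (a / (a + b))) base r 0)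
    (tree (Fin N) p (toUnit ((a + b) / 2 / N)) (toUnit (a / (a + b))) base r 1)

theorem expectedAdvantage_eq_tv (ha : 0 < a) (hb : 0 < b) (p : unitInterval) {N : ℕ}
    (hN : 4 * (a + b) ≤ N) (v : Fin N) (i : Fin 2) :
    expectedAdvantage N 2 a b p v i
      = 1 / 2 * tv (vertexLaw p (toUnit (a / N)) (toUnit (b / N)) v 0)
        (vertexLaw p (toUnit (a / N)) (toUnit (b / N)) v 1) := by
  have haN : a ≤ N := by linarith
  have hbN : b ≤ N := by linarith
  rw [expectedAdvantage_eq ha.le haN hb.le hbN (coe_toUnit_div ha.le haN)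
    (coe_toUnit_div hb.le hbN)]
  fin_cases i
  · rfl
  · rw [tv_comm]
    rfl

/-- The occupation probability q is the average of the two edge probabilities, and c is the
probability that a neighbour has the same label. The last identity produces the Kesten–Stigum ratio.
-/
theorem parameters (hab : 2 < a + b) (ha : 0 < a) (hb : 0 < b) {N : ℕ} (hN : 4 * (a + b) ≤ N) :
    (toUnit (a / N) : ℝ) = 2 * toUnit ((a + b) / 2 / N) * toUnit (a / (a + b)) ∧
    (toUnit (b / N) : ℝ) = 2 * toUnit ((a + b) / 2 / N) * (1 - toUnit (a / (a + b))) ∧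
    (toUnit ((a + b) / 2 / N) : ℝ) = (a + b) / 2 / N ∧
    (toUnit ((a + b) / 2 / N) : ℝ) ≤ 1 / 4 ∧
    (N * toUnit ((a + b) / 2 / N) : ℝ) = (a + b) / 2 ∧
    (N * toUnit ((a + b) / 2 / N) * (2 * toUnit (a / (a + b)) - 1) ^ 2 : ℝ)
      = (a - b) ^ 2 / (2 * (a + b)) := by
  have hN0 : (0 : ℝ) < N := by linarith
  have hs : a + b ≠ 0 := by linarith
  rw [coe_toUnit_div ha.le (by linarith), coe_toUnit_div hb.le (by linarith),
    coe_toUnit_div (by linarith) (by linarith), coe_toUnit_div_add ha hb]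
  refine ⟨by field_simp, by field_simp; ring, rfl, ?_, by field_simp, by field_simp; ring⟩
  rw [div_le_div_iff₀ hN0 (by norm_num)]
  linarith

section Comparison

variable (hab : 2 < a + b) (ha : 0 < a) (hb : 0 < b) (p : unitInterval) {N : ℕ}
  (hN : 4 * (a + b) ≤ N)
include hab ha hb hN

theorem expectedAdvantage_le (v : Fin N) (i : Fin 2) (r : ℕ) :
    expectedAdvantage N 2 a b p v i ≤ 1 / 2 * treeTV a b p pure N (r + 1) + treeError a b N r := by
  obtain ⟨h1, h2, h3, h4, h5, -⟩ := parameters hab ha hb hN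
  have h := tv_vertexLaw_le (p := p) h1 h2 h4 (by linarith : 1 ≤ (a + b) / 2) h5.le r v 0 1
  have h6 := two_le_growth (by linarith : 0 ≤ (a + b) / 2) (r + 1)
  have h7 : 0 ≤ √(4 * ((a + b) / 2) * ((a + b) / 2 / N)) * growth ((a + b) / 2) (r + 1) := by
    positivity
  rw [h3] at h
  rw [expectedAdvantage_eq_tv ha hb p hN, treeTV, treeError]
  linarith

theorem treeTV_le (v : Fin N) (i : Fin 2) (r : ℕ) :
    1 / 2 * treeTV a b p (fun _ => pure 0) N (r + 1)
      ≤ expectedAdvantage N 2 a b p v i + treeError a b N r := by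
  obtain ⟨h1, h2, h3, h4, h5, -⟩ := parameters hab ha hb hN
  have h := tv_tree_le_tv_vertexLaw (p := p) h1 h2 h4 (by linarith : 1 ≤ (a + b) / 2) h5.le r v 0 1
  have h6 := two_le_growth (by linarith : 0 ≤ (a + b) / 2) (r + 1)
  have h7 : 0 ≤ √(4 * ((a + b) / 2) * ((a + b) / 2 / N)) * growth ((a + b) / 2) (r + 1) := by
    positivity
  rw [h3] at h
  rw [expectedAdvantage_eq_tv ha hb p hN, treeTV, treeError]
  linarith

theorem treeTV_pure_le (r : ℕ) {η : ℝ} (hη : 0 < η) :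
    treeTV a b p pure N r ≤ treeTV a b p (fun _ => pure 0) N r + η / 2
      + ((a - b) ^ 2 / (2 * (a + b))) ^ r / η := by
  obtain ⟨-, -, -, -, -, h6⟩ := parameters hab ha hb hN
  exact tv_tree_pure_le _ _ _ (by rw [Fintype.card_fin, h6]) hη r

theorem treeTV_pure_le_sqrt (hKS : (a - b) ^ 2 / (2 * (a + b)) < 1) (r : ℕ) :
    treeTV a b p pure N r ≤ √(p / (1 - (a - b) ^ 2 / (2 * (a + b)))
      + ((a - b) ^ 2 / (2 * (a + b))) ^ r) := by
  obtain ⟨-, -, -, -, -, h6⟩ := parameters hab ha hb hN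
  exact tv_tree_pure_le_sqrt _ _ _ N h6.le hKS r

theorem treeTV_le_treeTV_add (base : Fin 2 → FiniteLaw (Fin 2)) {N' : ℕ} (hN' : N * N ≤ N')
    (r : ℕ) :
    treeTV a b p base N r ≤ treeTV a b p base N' r
      + 2 * (((a + b) / 2 + ((a + b) / 2) ^ 2) / N * (2 + (a + b) / 2) ^ r) := by
  have h0 : (0 : ℝ) < N := by linarith
  have h1 : (N : ℝ) ≤ N' := by
    exact_mod_cast (Nat.le_mul_of_pos_left N (by exact_mod_cast h0)).trans hN'
  exact tv_tree_le_tv_tree_add base (by linarith) (by linarith) hN'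
    (parameters hab ha hb (hN.trans h1)).2.2.1 (parameters hab ha hb hN).2.2.1 r 0 1

end Comparison

theorem eventually_le_natCast_succ (x : ℝ) : ∀ᶠ n : ℕ in atTop, x ≤ ((n + 1 : ℕ) : ℝ) :=
  (tendsto_natCast_atTop_atTop.comp (tendsto_add_atTop_nat 1)).eventually_ge_atTop x

theorem eventually_expectedAdvantage_le_add (hab : 2 < a + b) (ha : 0 < a) (hb : 0 < b)
    (hKS : (a - b) ^ 2 / (2 * (a + b)) < 1) (p : unitInterval) (v : ∀ n : ℕ, Fin (n + 1))
    (i : Fin 2) {ε : ℝ} (hε : 0 < ε) :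
    ∀ᶠ m in atTop, ∀ᶠ n in atTop, expectedAdvantage (m + 1) 2 a b p (v m) i
      ≤ expectedAdvantage (n + 1) 2 a b p (v n) i + ε := by
  have hl0 : 0 ≤ (a - b) ^ 2 / (2 * (a + b)) := by positivity
  -- The depth is fixed before the sizes, with AM–GM parameter η = ε; the tree and coarsening errors
  -- then vanish at this depth as m and n grow.
  obtain ⟨r, hr⟩ : ∃ r : ℕ, ((a - b) ^ 2 / (2 * (a + b))) ^ (r + 1) / ε ≤ ε / 4 := by
    obtain ⟨r, hr⟩ := exists_pow_lt_of_lt_one (by positivity : 0 < ε * (ε / 4)) hKS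
    refine ⟨r, ?_⟩
    rw [div_le_iff₀ hε, mul_comm (ε / 4)]
    exact (pow_le_pow_of_le_one hl0 hKS.le r.le_succ).trans hr.le
  have hC : Tendsto (fun n : ℕ => ((a + b) / 2 + ((a + b) / 2) ^ 2) / ((n + 1 : ℕ) : ℝ)
      * (2 + (a + b) / 2) ^ (r + 1)) atTop (𝓝 0) := by
    have := ((tendsto_const_div_atTop_nhds_zero_nat ((a + b) / 2 + ((a + b) / 2) ^ 2)).comp
      (tendsto_add_atTop_nat 1)).mul_const ((2 + (a + b) / 2) ^ (r + 1))
    rw [zero_mul] at this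
    exact this
  have hE := (tendsto_treeError a b r).eventually_le_const (by positivity : 0 < ε / 8)
  filter_upwards [hE, hC.eventually_le_const (by positivity : 0 < ε / 8),
    eventually_le_natCast_succ (4 * (a + b))] with m hm1 hm2 hm3
  filter_upwards [hE, eventually_le_natCast_succ (4 * (a + b)),
    eventually_ge_atTop ((m + 1) * (m + 1))] with n hn1 hn2 hn3
  have h1 := expectedAdvantage_le hab ha hb p hm3 (v m) i r
  have h2 := treeTV_pure_le hab ha hb p hm3 (r + 1) hε
  have h3 := treeTV_le_treeTV_add hab ha hb p hm3 (fun _ => pure 0) (hn3.trans n.le_succ) (r + 1)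
  have h4 := treeTV_le hab ha hb p hn2 (v n) i r
  linarith

/-- From 2 < a + b one gets (a-b)² < 2(a+b) < (a+b)², hence |a-b| < a+b. -/
theorem pos_of_sq_sub_lt (hab : 2 < a + b) (hKS : (a - b) ^ 2 < 2 * (a + b)) : 0 < a ∧ 0 < b := by
  have h : (a - b) ^ 2 < (a + b) ^ 2 := by nlinarith
  have h' := abs_lt_of_sq_lt_sq h (by linarith)
  rw [abs_lt] at h'
  constructor <;> linarith

end LabeledSBM

theorem theorem3 (a b p : ℝ) (hab : 2 < a + b) (hKS : (a - b) ^ 2 < 2 * (a + b))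
    (hp : 0 ≤ p) (hp' : p ≤ 1) (v : ∀ n : ℕ, Fin (n + 1)) (i : Fin 2) :
    ∃ L : ℝ,
      Tendsto (fun n : ℕ => LabeledSBM.expectedAdvantage (n + 1) 2 a b p (v n) i) atTop (𝓝 L) ∧
      L ≤ 1 / 2 * √(p / (1 - (a - b) ^ 2 / (2 * (a + b)))) := by
  obtain ⟨ha, hb⟩ := LabeledSBM.pos_of_sq_sub_lt hab hKS
  have hl0 : 0 ≤ (a - b) ^ 2 / (2 * (a + b)) := by positivity
  have hl : (a - b) ^ 2 / (2 * (a + b)) < 1 := (div_lt_one (by positivity)).2 hKS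
  lift p to unitInterval using ⟨hp, hp'⟩
  -- The sequence is shifted so that every size satisfies the lower bound under which the tree
  -- comparison holds.
  obtain ⟨k, hk⟩ := exists_nat_ge (4 * (a + b))
  have hN : ∀ n : ℕ, 4 * (a + b) ≤ ((n + k + 1 : ℕ) : ℝ) := by
    intro n
    push_cast
    have : (0 : ℝ) ≤ n := n.cast_nonneg
    linarith
  obtain ⟨L, hL⟩ : ∃ L, Tendsto (fun n : ℕ =>
      LabeledSBM.expectedAdvantage (n + k + 1) 2 a b p (v (n + k)) i) atTop (𝓝 L) := by
    refine exists_tendsto_of_eventually_le_add (A := 0) (B := 1 / 2) (fun n => ?_) (fun n => ?_)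
      fun ε hε => ?_
    · rw [LabeledSBM.expectedAdvantage_eq_tv ha hb p (hN n)]
      exact mul_nonneg (by norm_num) (FiniteLaw.tv_nonneg _ _)
    · rw [LabeledSBM.expectedAdvantage_eq_tv ha hb p (hN n)]
      linarith [FiniteLaw.tv_le_one
        (FiniteLaw.vertexLaw p (LabeledSBM.toUnit (a / (n + k + 1 : ℕ)))
          (LabeledSBM.toUnit (b / (n + k + 1 : ℕ))) (v (n + k)) 0)
        (FiniteLaw.vertexLaw p (LabeledSBM.toUnit (a / (n + k + 1 : ℕ)))
          (LabeledSBM.toUnit (b / (n + k + 1 : ℕ))) (v (n + k)) 1)]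
    · have h := LabeledSBM.eventually_expectedAdvantage_le_add hab ha hb hl p v i hε
      exact ((tendsto_add_atTop_nat k).eventually h).mono fun m hm =>
        (tendsto_add_atTop_nat k).eventually hm
  refine ⟨L, (tendsto_add_atTop_iff_nat k).1 hL, ?_⟩
  -- First the size tends to infinity at fixed depth, which removes the tree error; the depth
  -- follows.
  have h1 : ∀ r : ℕ, L ≤ 1 / 2 * √(p / (1 - (a - b) ^ 2 / (2 * (a + b)))
      + ((a - b) ^ 2 / (2 * (a + b))) ^ (r + 1)) := by
    intro r
    have h2 := ((LabeledSBM.tendsto_treeError a b r).comp (tendsto_add_atTop_nat k)).const_add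
      (1 / 2 * √(p / (1 - (a - b) ^ 2 / (2 * (a + b)))
      + ((a - b) ^ 2 / (2 * (a + b))) ^ (r + 1)))
    rw [add_zero] at h2
    refine le_of_tendsto_of_tendsto' hL h2 fun n => ?_
    have h3 := LabeledSBM.expectedAdvantage_le hab ha hb p (hN n) (v (n + k)) i r
    have h4 := LabeledSBM.treeTV_pure_le_sqrt hab ha hb p (hN n) hl (r + 1)
    simp only [Function.comp_apply]
    linarith
  have h5 : Tendsto (fun r : ℕ => 1 / 2 * √(p / (1 - (a - b) ^ 2 / (2 * (a + b)))
      + ((a - b) ^ 2 / (2 * (a + b))) ^ (r + 1))) atTop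
      (𝓝 (1 / 2 * √(p / (1 - (a - b) ^ 2 / (2 * (a + b))) + 0))) :=
    ((Real.continuous_sqrt.tendsto _).comp
      (((tendsto_pow_atTop_nhds_zero_of_lt_one hl0 hl).comp (tendsto_add_atTop_nat 1)).const_add
        _)).const_mul _
  rw [add_zero] at h5
  exact ge_of_tendsto' h5 h1
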